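/- Consider the following two problems. In kTree, the input is an undirected graph $G$ on $n$ nodes and a tree $T$ on $k$ nodes, and the goal is to decide whether $G$ has a (not necessarily induced) subgraph isomorphic to $T$. In p-Partial Cover, the input is a collection of $m$ subsets of a ground set of $n$ elements and an integer $p\ge 0$, and the goal is to find a sub-collection with the fewest sets whose union contains at least $p$ elements (or to report that no sub-collection covers $p$ elements). The notation $O^*(\cdot)$ hides factors polynomial in the instance size ($n+k$ for kTree, $n+m$ for p-Partial Cover). Theorem. For every fixed $\varepsilon>0$ there is $\delta=\delta(\varepsilon)>0$ such that, if kTree can be solved in time $O^*((2-\varepsilon)^k)$, then p-Partial Cover on $n$ elements and $m$ sets can be solved in time $O^*((2-\delta)^p)$. This holds for deterministic algorithms (a deterministic algorithm for kTree yields a deterministic algorithm for p-Partial Cover), and also for randomized algorithms, which obey the time bound for all outcomes of their coin tosses and answer correctly with probability at least $2/3$. -/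

import Mathlib

/-! ## The machine model

While-programs over binary trees ("pure Lisp").  A program has finitely many variables, each of
which holds a binary tree, and may build and take apart trees, branch, loop, and (if it is a
randomized program) toss fair coins.  Time is the number of steps of the small-step semantics;
every step performs a number of pointer operations bounded in terms of the program text alone.
A computation of `t` steps in this model is simulated by a random access machine with logarithmic
cost, and conversely, with an overhead factor that is polylogarithmic in `t` plus the input size,
so bounds of the form `bᵏ · poly(instance size)` mean the same in both models. -/

namespace TreeMachine

/-- Data: binary trees. -/
inductive Data : Type
  | nil : Data
  | cons (a b : Data) : Data

/-- Left subtree (`nil` for `nil`). -/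
def Data.head : Data → Data
  | .nil => .nil
  | .cons a _ => a

/-- Right subtree (`nil` for `nil`). -/
def Data.tail : Data → Data
  | .nil => .nil
  | .cons _ b => b

/-- The contents of the variables, which are numbered by natural numbers. -/
abbrev Store : Type := ℕ → Data

/-- Expressions. -/
inductive Expr : Type
  | var (x : ℕ) : Expr
  | nil : Expr
  | cons (e f : Expr) : Expr
  | head (e : Expr) : Expr
  | tail (e : Expr) : Expr

/-- The value of an expression. -/
def Expr.eval (s : Store) : Expr → Data
  | .var x => s x
  | .nil => .nil
  | .cons e f => .cons (e.eval s) (f.eval s)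
  | .head e => (e.eval s).head
  | .tail e => (e.eval s).tail

/-- Programs.  A test succeeds when its expression has a value other than `nil`; `flip x` stores a
fair random bit in the variable `x`. -/
inductive Program : Type
  | skip : Program
  | assign (x : ℕ) (e : Expr) : Program
  | flip (x : ℕ) : Program
  | seq (c d : Program) : Program
  | ite (e : Expr) (c d : Program) : Program
  | while (e : Expr) (c : Program) : Program

/-- The program never tosses a coin. -/
def Program.CoinFree : Program → Prop
  | .skip => True
  | .assign _ _ => True
  | .flip _ => False
  | .seq c d => c.CoinFree ∧ d.CoinFree
  | .ite _ c d => c.CoinFree ∧ d.CoinFree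
  | .while _ c => c.CoinFree

/-- Bits as data. -/
def ofBool : Bool → Data
  | false => .nil
  | true => .cons .nil .nil

/-- A configuration: the list of programs that remain to be executed, and the store. -/
structure Config : Type where
  todo : List Program
  store : Store

/-- A configuration is halting when nothing remains to be executed. -/
def Config.Halted (γ : Config) : Prop := γ.todo = []

open Classical in
/-- One step of computation: the distribution of the next configuration.  All steps except coin
tosses are deterministic, and halting configurations do not change. -/
noncomputable def step (γ : Config) : PMF Config :=
  match γ.todo with
  | [] => PMF.pure γ
  | .skip :: K => PMF.pure ⟨K, γ.store⟩
  | .assign x e :: K => PMF.pure ⟨K, Function.update γ.store x (e.eval γ.store)⟩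
  | .flip x :: K =>
      (PMF.uniformOfFintype Bool).map fun b => ⟨K, Function.update γ.store x (ofBool b)⟩
  | .seq c d :: K => PMF.pure ⟨c :: d :: K, γ.store⟩
  | .ite e c d :: K =>
      PMF.pure (if e.eval γ.store = .nil then ⟨d :: K, γ.store⟩ else ⟨c :: K, γ.store⟩)
  | .while e c :: K =>
      PMF.pure (if e.eval γ.store = .nil then ⟨K, γ.store⟩
        else ⟨c :: .while e c :: K, γ.store⟩)

/-- The distribution of the configuration after `t` steps. -/
noncomputable def run : ℕ → Config → PMF Config
  | 0, γ => PMF.pure γ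
  | t + 1, γ => (step γ).bind (run t)

/-- The initial configuration: variable `0` holds the input, all other variables hold `nil`. -/
def init (P : Program) (x : Data) : Config := ⟨[P], Function.update (fun _ => .nil) 0 x⟩

/-- The output of a halting configuration is the content of variable `0`. -/
def Config.output (γ : Config) : Data := γ.store 0

/-- Two kinds of algorithms. -/
inductive Mode : Type
  | deterministic : Mode
  | randomized : Mode

/-- On input `x`, the program `P` halts within `t` steps, for all outcomes of its coin tosses, with
an output in the set `A` of admissible answers: always, and without tossing coins, in the
deterministic mode; with probability at least `2/3` in the randomized mode. -/
def Program.AnswersWithin (P : Program) (μ : Mode) (x : Data) (A : Set Data) (t : ℕ) : Prop :=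
  (∀ γ ∈ (run t (init P x)).support, γ.Halted) ∧
  match μ with
  | .deterministic => P.CoinFree ∧ ∀ γ ∈ (run t (init P x)).support, γ.output ∈ A
  | .randomized => (2 / 3 : ENNReal) ≤ (run t (init P x)).toOuterMeasure {γ | γ.output ∈ A}

/-! ### Encodings -/

/-- Lists as data. -/
def ofList : List Data → Data
  | [] => .nil
  | a :: l => .cons a (ofList l)

/-- Natural numbers in unary. -/
def ofNat (n : ℕ) : Data := ofList (List.replicate n .nil)

open Classical in
/-- A subset of `Fin n` as its characteristic vector of `n` bits. -/
noncomputable def ofSet {n : ℕ} (s : Set (Fin n)) : Data :=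
  ofList (List.ofFn fun i => ofBool (decide (i ∈ s)))

/-- A graph on `Fin n` as its adjacency matrix, a list of `n` rows. -/
noncomputable def ofGraph {n : ℕ} (G : SimpleGraph (Fin n)) : Data :=
  ofList (List.ofFn fun i => ofSet (G.neighborSet i))

/-- A family of `m` subsets of `Fin n` as its incidence matrix, a list of `m` rows. -/
noncomputable def ofFamily {n m : ℕ} (S : Fin m → Finset (Fin n)) : Data :=
  ofList (List.ofFn fun i => ofSet (S i : Set (Fin n)))

end TreeMachine

/-! ## The two problems -/

open TreeMachine in
open Classical in
/-- `kTree` can be solved in time `O*(bᵏ)`: some program decides, given a graph `G` on `n` vertices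
and a tree `T` on `k` vertices, whether `G` has a (not necessarily induced) subgraph isomorphic
to `T`, in time `bᵏ` times a polynomial in the instance size. -/
def KTreeSolvable (μ : Mode) (b : ℝ) : Prop :=
  ∃ (P : Program) (C : ℕ), ∀ (n k : ℕ) (G : SimpleGraph (Fin n)) (T : SimpleGraph (Fin k)),
    T.IsTree → ∃ t : ℕ, (t : ℝ) ≤ C * b ^ k * ((n : ℝ) + k + 1) ^ C ∧
      P.AnswersWithin μ (.cons (ofGraph G) (ofGraph T)) {ofBool (decide (T.IsContained G))} t

/-- The subfamily `(S i)`, `i ∈ I`, covers at least `p` elements. -/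
def IsPartialCover {n m : ℕ} (S : Fin m → Finset (Fin n)) (p : ℕ) (I : Finset (Fin m)) : Prop :=
  p ≤ (I.biUnion S).card

/-- A partial cover with the fewest sets. -/
def IsMinPartialCover {n m : ℕ} (S : Fin m → Finset (Fin n)) (p : ℕ) (I : Finset (Fin m)) :
    Prop :=
  IsPartialCover S p I ∧ ∀ J : Finset (Fin m), IsPartialCover S p J → I.card ≤ J.card

open TreeMachine in
/-- The admissible answers: a smallest subfamily that covers at least `p` elements (tagged, to
tell it from `nil`), or `nil` if no subfamily covers `p` elements. -/
def partialCoverAnswers {n m : ℕ} (S : Fin m → Finset (Fin n)) (p : ℕ) : Set Data :=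
  {d | (∃ I, IsMinPartialCover S p I ∧ d = .cons .nil (ofSet (I : Set (Fin m)))) ∨
    ((∀ I, ¬ IsPartialCover S p I) ∧ d = .nil)}

open TreeMachine in
/-- `p-Partial Cover` can be solved in time `O*(bᵖ)`: some program finds, given `m` subsets of a
ground set of `n` elements and a number `p`, a smallest subfamily whose union has at least `p`
elements, or reports that there is none, in time `bᵖ` times a polynomial in `n` and `m`. -/
def PartialCoverSolvable (μ : Mode) (b : ℝ) : Prop :=
  ∃ (P : Program) (C : ℕ), ∀ (n m p : ℕ) (S : Fin m → Finset (Fin n)),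
    ∃ t : ℕ, (t : ℝ) ≤ C * b ^ p * ((n : ℝ) + m + 1) ^ C ∧
      P.AnswersWithin μ (.cons (ofNat p) (.cons (ofNat n) (ofFamily S)))
        (partialCoverAnswers S p) t

/-! The reduction packs a cover into a tree with little more than `p` vertices. Fix a large constant
`c` and suppose that `t` sets cover `p` elements. Set `t mod c` of them aside in a list `u` and cut
the others into groups of at most `c` sets. As long as some group covers more than `p / c` elements
that `u` misses, move its sets to `u`. After `c` moves `u` alone covers `p` elements, so `u` never
has more than `c + c²` sets and can be guessed in polynomial time (`exists_good_groups`,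
`feasible_iff`).

The remaining groups are light. Given `u`, the host graph has a root joined to all light groups, and
each group is joined to the elements that it newly covers; as `c` is constant, there are
polynomially many groups. The groups supply the `q` missing elements exactly when some tree of depth
two embeds whose root has few children with `q` leaves in total. To keep the root of the pattern off
the groups, both roots get `p / c + 2` pendant vertices, more than a light group has neighbours. The
root of the pattern can still land on an element, and an exchange argument shows that this does no
harm (`exists_groups_of_isContained`, `exists_embeds`).

The numbers of leaves are not known and have to be enumerated. A child costs `c` from a budget of at
most `p + 1` and a leaf costs 1 from a budget of at most `p`, so the search tree obeys `N(a, b) ≤ 1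
+ N(a, b - c) + N(a - 1, b)` and has `O(x^(a + b))` nodes as soon as `1/x + 1/x^c ≤ 1` (`nodes_le`).
For `x` near 1 and `c` large the enumeration, the `O(p / c)` extra vertices of the pattern and all
factors polynomial in `p` together cost `x^(4p)` up to factors polynomial in `n` and `m`, which
gives the base `b x⁴ < 2`.

This decides whether `t` sets suffice. A smallest subfamily results from lowering `t`, starting at
`p + 1`, and then deleting superfluous sets (`exists_greedy`); covering `p` elements never takes
more than `p` sets.

For randomized oracles each question is repeated `K (p + m + 1)` times. The majority errs with
probability at most `(17/18)^(K (p + m + 1))`, and a suitable constant `K` beats the number of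
questions in a union bound (`exists_amplified`, `error_le`). The same program serves the
deterministic mode: it tosses no coins if the oracle tosses none, and then its success probability
can only be 0 or 1. -/

open scoped ENNReal

/-! ## Expectations -/

/-- The expectation of an extended nonnegative function. -/
noncomputable def PMF.expect {α : Type*} (μ : PMF α) (f : α → ℝ≥0∞) : ℝ≥0∞ := ∑' x, μ x * f x

namespace PMF

variable {α β : Type*}

theorem expect_pure (a : α) (f : α → ℝ≥0∞) : (PMF.pure a).expect f = f a := by
  rw [expect, tsum_eq_single a]
  · simp
  · intro b hb; simp [hb]

theorem expect_bind (μ : PMF α) (ν : α → PMF β) (f : β → ℝ≥0∞) :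
    (μ.bind ν).expect f = μ.expect fun a => (ν a).expect f := by
  simp only [expect, bind_apply]
  simp_rw [← ENNReal.tsum_mul_right, ← ENNReal.tsum_mul_left]
  rw [ENNReal.tsum_comm]
  simp only [mul_assoc]

theorem expect_mono_on {μ : PMF α} {f g : α → ℝ≥0∞} (h : ∀ a ∈ μ.support, f a ≤ g a) :
    μ.expect f ≤ μ.expect g := by
  refine ENNReal.tsum_le_tsum fun a => ?_
  by_cases ha : a ∈ μ.support
  · gcongr; exact h a ha
  · rw [PMF.mem_support_iff, not_not] at ha; simp [ha]

/-- A point of positive mass with value `⊤` makes the whole sum infinite. This is what allows `⊤` to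
encode forbidden outcomes below: a finite expectation excludes them with certainty, while finite
values measure the probability of error. -/
theorem lt_top_of_expect {μ : PMF α} {f : α → ℝ≥0∞} (h : μ.expect f ≠ ⊤) {a : α}
    (ha : a ∈ μ.support) : f a ≠ ⊤ := by
  intro hf
  have := ENNReal.ne_top_of_tsum_ne_top h a
  rw [hf, ENNReal.mul_top ((PMF.mem_support_iff _ _).1 ha)] at this
  exact this rfl

theorem bind_congr {μ : PMF α} {f g : α → PMF β} (h : ∀ a ∈ μ.support, f a = g a) :
    μ.bind f = μ.bind g := by
  ext b
  simp only [bind_apply]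
  refine tsum_congr fun a => ?_
  by_cases ha : a ∈ μ.support
  · rw [h a ha]
  · rw [PMF.mem_support_iff, not_not] at ha; simp [ha]

end PMF

/-! ### A program logic for running time and expected penalties -/

namespace TreeMachine

/-! ## Execution of a program in a context -/

/-- All configurations that are reached after `t` steps halt. -/
def HaltsIn (t : ℕ) (γ : Config) : Prop := ∀ γ' ∈ (run t γ).support, γ'.Halted

theorem run_nil (t : ℕ) (s : Store) : run t ⟨[], s⟩ = PMF.pure ⟨[], s⟩ := by
  induction t with
  | zero => rfl
  | succ t ih => simp [run, step, ih]

theorem run_add (t d : ℕ) (γ : Config) : run (t + d) γ = (run t γ).bind (run d) := by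
  induction t generalizing γ with
  | zero => simp [run]
  | succ t ih =>
    rw [show t + 1 + d = (t + d) + 1 by ring]
    simp only [run, PMF.bind_bind]
    congr 1
    funext γ'
    exact ih γ'

theorem run_of_halted {γ : Config} (h : γ.Halted) (t : ℕ) : run t γ = PMF.pure γ := by
  obtain ⟨L, s⟩ := γ
  obtain rfl : L = [] := h
  exact run_nil t s

/-- Halting configurations are fixed points of `step`, so time bounds may be increased at will. -/
theorem HaltsIn.run_add {t : ℕ} {γ : Config} (h : HaltsIn t γ) (d : ℕ) :
    run (t + d) γ = run t γ := by
  rw [TreeMachine.run_add, PMF.bind_congr (g := PMF.pure) fun γ' h' => run_of_halted (h γ' h') d,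
    PMF.bind_pure]

theorem HaltsIn.mono {t t' : ℕ} {γ : Config} (h : HaltsIn t γ) (htt : t ≤ t') : HaltsIn t' γ := by
  obtain ⟨d, rfl⟩ := Nat.exists_eq_add_of_le htt
  intro γ' h'
  rw [h.run_add] at h'
  exact h γ' h'

/-- Started in the store `s`, the program `c` stops within `t` steps, and the resulting store has
the distribution `μ`, whatever remains to be executed afterwards. -/
def Exec (c : Program) (s : Store) (t : ℕ) (μ : PMF Store) : Prop :=
  ∀ K t', (∀ s' ∈ μ.support, HaltsIn t' ⟨K, s'⟩) →
    run (t + t') ⟨c :: K, s⟩ = μ.bind fun s' => run t' ⟨K, s'⟩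

theorem Exec.halts {c : Program} {s : Store} {t t' : ℕ} {μ : PMF Store} {K : List Program}
    (h : Exec c s t μ) (hK : ∀ s' ∈ μ.support, HaltsIn t' ⟨K, s'⟩) :
    HaltsIn (t + t') ⟨c :: K, s⟩ := by
  intro γ hγ
  rw [h K t' hK, PMF.mem_support_bind_iff] at hγ
  obtain ⟨s', hs', hγ⟩ := hγ
  exact hK s' hs' γ hγ

/-- The additional steps are moved behind the continuation, which has halted by then. -/
theorem Exec.mono {c : Program} {s : Store} {t t' : ℕ} {μ : PMF Store} (h : Exec c s t μ)
    (htt : t ≤ t') : Exec c s t' μ := by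
  obtain ⟨d, rfl⟩ := Nat.exists_eq_add_of_le htt
  intro K t'' hK
  rw [add_assoc, add_comm d, ← add_assoc, (h.halts hK).run_add]
  exact h K t'' hK

theorem Exec.skip (s : Store) : Exec .skip s 1 (PMF.pure s) := by
  intro K t' _
  rw [add_comm]
  simp [run, step]

theorem Exec.assign (x : ℕ) (e : Expr) (s : Store) :
    Exec (.assign x e) s 1 (PMF.pure (Function.update s x (e.eval s))) := by
  intro K t' _
  rw [add_comm]
  simp [run, step]

theorem Exec.seq {c d : Program} {s : Store} {t₁ t₂ : ℕ} {μ : PMF Store} {ν : Store → PMF Store}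
    (hc : Exec c s t₁ μ) (hd : ∀ s' ∈ μ.support, Exec d s' t₂ (ν s')) :
    Exec (.seq c d) s (1 + t₁ + t₂) (μ.bind ν) := by
  intro K t' hK
  have h2 : ∀ s' ∈ μ.support, ∀ s'' ∈ (ν s').support, HaltsIn t' ⟨K, s''⟩ := fun s' hs' s'' hs'' =>
    hK s'' ((PMF.mem_support_bind_iff _ _ _).2 ⟨s', hs', hs''⟩)
  have h1 : run (t₁ + (t₂ + t')) ⟨c :: d :: K, s⟩ = _ :=
    hc (d :: K) (t₂ + t') fun s' hs' => (hd s' hs').halts (h2 s' hs')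
  rw [show 1 + t₁ + t₂ + t' = (t₁ + (t₂ + t')) + 1 by ring]
  simp only [run, step, PMF.pure_bind]
  rw [h1, PMF.bind_bind]
  exact PMF.bind_congr fun s' hs' => hd s' hs' K t' (h2 s' hs')

theorem Exec.ite_nil {e : Expr} {c d : Program} {s : Store} {t : ℕ} {μ : PMF Store}
    (he : e.eval s = .nil) (h : Exec d s t μ) : Exec (.ite e c d) s (1 + t) μ := by
  intro K t' hK
  rw [show 1 + t + t' = (t + t') + 1 by ring]
  simp only [run, step, PMF.pure_bind, if_pos he]
  exact h K t' hK

theorem Exec.ite_cons {e : Expr} {c d : Program} {s : Store} {t : ℕ} {μ : PMF Store}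
    (he : e.eval s ≠ .nil) (h : Exec c s t μ) : Exec (.ite e c d) s (1 + t) μ := by
  intro K t' hK
  rw [show 1 + t + t' = (t + t') + 1 by ring]
  simp only [run, step, PMF.pure_bind, if_neg he]
  exact h K t' hK

theorem Exec.while_nil {e : Expr} {c : Program} {s : Store} (he : e.eval s = .nil) :
    Exec (.while e c) s 1 (PMF.pure s) := by
  intro K t' hK
  rw [add_comm]
  simp [run, step, he]

/-- After one step, a loop whose test succeeds is in the same configuration as `seq c (while e c)`,
so the claim is that of `Exec.seq`. -/
theorem Exec.while_cons {e : Expr} {c : Program} {s : Store} {t₁ t₂ : ℕ} {μ : PMF Store}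
    {ν : Store → PMF Store} (he : e.eval s ≠ .nil) (hc : Exec c s t₁ μ)
    (hd : ∀ s' ∈ μ.support, Exec (.while e c) s' t₂ (ν s')) :
    Exec (.while e c) s (1 + t₁ + t₂) (μ.bind ν) := by
  intro K t' hK
  have h := Exec.seq hc hd K t' hK
  rw [show 1 + t₁ + t₂ + t' = (t₁ + t₂ + t') + 1 by ring] at h ⊢
  simp only [run, step, PMF.pure_bind, if_neg he] at h ⊢
  exact h

/-! ## Running a program as a subroutine -/

theorem step_append (c : Program) (L K : List Program) (s : Store) :
    step ⟨c :: L ++ K, s⟩ = (step ⟨c :: L, s⟩).map fun γ => ⟨γ.todo ++ K, γ.store⟩ := by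
  cases c <;> simp only [step, List.cons_append, PMF.pure_map]
  · rw [PMF.map_comp]; rfl
  all_goals split_ifs <;> rfl

/-- Different coin outcomes can reach `K` at different times. Since `K` halts within `t'` steps on
each branch, the steps left over from `t` have no effect. -/
theorem run_append (t t' : ℕ) (L K : List Program) (s : Store) (hL : HaltsIn t ⟨L, s⟩)
    (hK : ∀ γ ∈ (run t ⟨L, s⟩).support, HaltsIn t' ⟨K, γ.store⟩) :
    run (t + t') ⟨L ++ K, s⟩ = (run t ⟨L, s⟩).bind fun γ => run t' ⟨K, γ.store⟩ := by
  induction t generalizing L s with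
  | zero =>
    obtain rfl : L = [] := hL ⟨L, s⟩ (by simp [run])
    simp [run]
  | succ t ih =>
    cases L with
    | nil =>
      rw [run_nil, PMF.pure_bind, add_comm]
      exact HaltsIn.run_add (hK ⟨[], s⟩ (by simp [run_nil])) _
    | cons c L =>
      rw [show t + 1 + t' = (t + t') + 1 by ring]
      simp only [run]
      rw [step_append, PMF.map, PMF.bind_bind, PMF.bind_bind]
      refine PMF.bind_congr fun γ hγ => ?_
      simp only [Function.comp_apply, PMF.pure_bind]
      have hsub : ∀ γ' ∈ (run t γ).support, γ' ∈ (run (t + 1) ⟨c :: L, s⟩).support := fun γ' h' =>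
        (PMF.mem_support_bind_iff _ _ _).2 ⟨γ, hγ, h'⟩
      exact ih γ.todo γ.store (fun γ' h' => hL γ' (hsub γ' h')) fun γ' h' => hK γ' (hsub γ' h')

theorem Exec.of_run {P : Program} {s : Store} {t : ℕ} (h : HaltsIn t ⟨[P], s⟩) :
    Exec P s t ((run t ⟨[P], s⟩).map Config.store) := by
  intro K t' hK
  have := run_append t t' [P] K s h fun γ hγ =>
    hK _ ((PMF.mem_support_map_iff _ _ _).2 ⟨γ, hγ, rfl⟩)
  rw [PMF.map, PMF.bind_bind]
  simpa [Function.comp_def] using this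

/-- An upper bound for the variables of an expression. -/
def Expr.bound : Expr → ℕ
  | .var x => x + 1
  | .nil => 0
  | .cons e f => max e.bound f.bound
  | .head e => e.bound
  | .tail e => e.bound

/-- An upper bound for the variables of a program. -/
def Program.bound : Program → ℕ
  | .skip => 0
  | .assign x e => max (x + 1) e.bound
  | .flip x => x + 1
  | .seq c d => max c.bound d.bound
  | .ite e c d => max e.bound (max c.bound d.bound)
  | .while e c => max e.bound c.bound

/-- The store that agrees with `s` on the variables below `a`, and with `r` elsewhere. -/
def mergeStore (a : ℕ) (r s : Store) : Store := fun x => if x < a then s x else r x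

theorem Expr.eval_mergeStore {a : ℕ} (r s : Store) {e : Expr} (h : e.bound ≤ a) :
    e.eval (mergeStore a r s) = e.eval s := by
  induction e with
  | var x => simp only [Expr.bound] at h; simp [Expr.eval, mergeStore, show x < a by omega]
  | nil => rfl
  | cons e f ihe ihf =>
    simp only [Expr.bound, max_le_iff] at h
    simp [Expr.eval, ihe h.1, ihf h.2]
  | head e ih => simp [Expr.eval, ih h]
  | tail e ih => simp [Expr.eval, ih h]

theorem update_mergeStore {a x : ℕ} (r s : Store) (d : Data) (h : x < a) :
    Function.update (mergeStore a r s) x d = mergeStore a r (Function.update s x d) := by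
  funext y
  by_cases hy : y = x
  · subst hy; simp [mergeStore, h]
  · simp [mergeStore, Function.update_of_ne hy]

/-- A step reads and writes only variables below the bound, and it puts only subprograms on the list
of things to do; the second half keeps the bound available for the next step. -/
theorem step_mergeStore {a : ℕ} (r : Store) (γ : Config) (h : ∀ c ∈ γ.todo, c.bound ≤ a) :
    step ⟨γ.todo, mergeStore a r γ.store⟩ =
        (step γ).map (fun γ' => ⟨γ'.todo, mergeStore a r γ'.store⟩) ∧
      ∀ γ' ∈ (step γ).support, ∀ c ∈ γ'.todo, c.bound ≤ a := by
  obtain ⟨L, s⟩ := γ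
  cases L with
  | nil => simp [step, PMF.pure_map]
  | cons c L =>
    simp only [List.mem_cons, forall_eq_or_imp] at h
    obtain ⟨hc, hL⟩ := h
    cases c with
    | skip => simpa [step, PMF.pure_map] using hL
    | assign x e =>
      simp only [Program.bound, max_le_iff] at hc
      simpa [step, PMF.pure_map, Expr.eval_mergeStore r s hc.2,
        update_mergeStore r s _ (Nat.lt_of_succ_le hc.1)] using hL
    | flip x =>
      simp only [Program.bound] at hc
      refine ⟨?_, ?_⟩
      · simp only [step, PMF.map_comp, Function.comp_def,
          update_mergeStore r s _ (Nat.lt_of_succ_le hc)]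
      · intro γ' h'
        simp only [step, PMF.mem_support_map_iff] at h'
        obtain ⟨b, -, rfl⟩ := h'
        exact hL
    | seq c d =>
      simp only [Program.bound, max_le_iff] at hc
      simpa [step, PMF.pure_map] using ⟨hc.1, hc.2, hL⟩
    | ite e c d =>
      simp only [Program.bound, max_le_iff] at hc
      have he := Expr.eval_mergeStore r s hc.1
      by_cases h0 : e.eval s = .nil
      · simpa [step, PMF.pure_map, he, h0] using ⟨hc.2.2, hL⟩
      · simpa [step, PMF.pure_map, he, h0] using ⟨hc.2.1, hL⟩
    | _ e c =>
      simp only [Program.bound, max_le_iff] at hc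
      have he := Expr.eval_mergeStore r s hc.1
      by_cases h0 : e.eval s = .nil
      · simpa [step, PMF.pure_map, he, h0] using hL
      · simpa [step, PMF.pure_map, he, h0, Program.bound] using ⟨hc.2, hc, hL⟩

theorem run_mergeStore {a : ℕ} (r : Store) (t : ℕ) (γ : Config)
    (h : ∀ c ∈ γ.todo, c.bound ≤ a) :
    run t ⟨γ.todo, mergeStore a r γ.store⟩ =
      (run t γ).map fun γ' => ⟨γ'.todo, mergeStore a r γ'.store⟩ := by
  induction t generalizing γ with
  | zero => simp [run, PMF.pure_map]
  | succ t ih =>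
    obtain ⟨h1, h2⟩ := step_mergeStore r γ h
    simp only [run]
    rw [h1, PMF.map_bind, PMF.bind_map]
    exact PMF.bind_congr fun γ' h' => ih γ' (h2 γ' h')

/-- A program whose variables are below `a` leaves the other variables alone. -/
theorem Exec.of_run_init {P : Program} {a t : ℕ} (ha : P.bound ≤ a) (r : Store) (x : Data)
    (h : HaltsIn t (init P x)) :
    Exec P (mergeStore a r (init P x).store) t
      ((run t (init P x)).map fun γ => mergeStore a r γ.store) := by
  have hrun := run_mergeStore (a := a) r t (init P x) (by simpa [init] using ha)
  have : HaltsIn t ⟨[P], mergeStore a r (init P x).store⟩ := by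
    intro γ hγ
    rw [show [P] = (init P x).todo from rfl, hrun, PMF.mem_support_map_iff] at hγ
    obtain ⟨γ', h', rfl⟩ := hγ
    exact h γ' h'
  have h2 := Exec.of_run this
  rw [show [P] = (init P x).todo from rfl, hrun, PMF.map_comp] at h2
  exact h2

/-! ## Coin-free programs -/

theorem step_coinFree {γ : Config} (h : ∀ c ∈ γ.todo, c.CoinFree) :
    ∃ γ', step γ = PMF.pure γ' ∧ ∀ c ∈ γ'.todo, c.CoinFree := by
  obtain ⟨L, s⟩ := γ
  cases L with
  | nil => exact ⟨_, rfl, by simp⟩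
  | cons c L =>
    simp only [List.mem_cons, forall_eq_or_imp] at h
    obtain ⟨hc, hL⟩ := h
    cases c with
    | skip => exact ⟨_, rfl, hL⟩
    | assign x e => exact ⟨_, rfl, hL⟩
    | flip x => exact hc.elim
    | seq c d => exact ⟨_, rfl, by simpa using ⟨hc.1, hc.2, hL⟩⟩
    | ite e c d =>
      refine ⟨_, rfl, ?_⟩
      split_ifs
      · simpa using ⟨hc.2, hL⟩
      · simpa using ⟨hc.1, hL⟩
    | _ e c =>
      refine ⟨_, rfl, ?_⟩
      split_ifs
      · simpa using hL
      · simpa using ⟨hc, hc, hL⟩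

theorem run_coinFree (t : ℕ) {γ : Config} (h : ∀ c ∈ γ.todo, c.CoinFree) :
    ∃ γ', run t γ = PMF.pure γ' := by
  induction t generalizing γ with
  | zero => exact ⟨γ, rfl⟩
  | succ t ih =>
    obtain ⟨γ', h1, h2⟩ := step_coinFree h
    obtain ⟨γ'', h3⟩ := ih h2
    exact ⟨γ'', by rw [run, h1, PMF.pure_bind, h3]⟩

/-! ## Expectation bounds for the final store -/

/-- From the store `s`, the program `c` stops within `t` steps, and the expectation of `f` in the
resulting store is at most `v`; there is no claim if `v` is infinite. -/
def Tri (c : Program) (s : Store) (t : ℕ) (f : Store → ℝ≥0∞) (v : ℝ≥0∞) : Prop :=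
  v ≠ ⊤ → ∃ μ, Exec c s t μ ∧ μ.expect f ≤ v

theorem Tri.mono {c : Program} {s : Store} {t t' : ℕ} {f f' : Store → ℝ≥0∞} {v v' : ℝ≥0∞}
    (h : Tri c s t f v) (ht : t ≤ t') (hf : ∀ s', f' s' ≤ f s') (hv : v ≤ v') :
    Tri c s t' f' v' := by
  intro hv'
  obtain ⟨μ, h1, h2⟩ := h (ne_top_of_le_ne_top hv' hv)
  exact ⟨μ, h1.mono ht, (PMF.expect_mono_on fun a _ => hf a).trans (h2.trans hv)⟩

theorem Tri.of_pure {c : Program} {s s' : Store} {t : ℕ} {f : Store → ℝ≥0∞}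
    (h : Exec c s t (PMF.pure s')) : Tri c s t f (f s') := fun _ =>
  ⟨_, h, (PMF.expect_pure s' f).le⟩

/-- Finiteness of `v` makes `g` finite on the whole support, so every reachable store has a
continuation with an actual distribution. The rest is the law of total expectation. -/
theorem Tri.bind_aux {c : Program} {s : Store} {t t' : ℕ} {f g : Store → ℝ≥0∞} {v : ℝ≥0∞}
    {d : Program} (hc : Tri c s t g v) (hd : ∀ s', g s' ≠ ⊤ → Tri d s' t' f (g s')) (hv : v ≠ ⊤) :
    ∃ (μ : PMF Store) (ν : Store → PMF Store), Exec c s t μ ∧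
      (∀ s' ∈ μ.support, Exec d s' t' (ν s')) ∧ (μ.bind ν).expect f ≤ v := by
  obtain ⟨μ, h1, h2⟩ := hc hv
  have h3 : ∀ s' ∈ μ.support, ∃ ν, Exec d s' t' ν ∧ ν.expect f ≤ g s' := fun s' hs' =>
    have := PMF.lt_top_of_expect (ne_top_of_le_ne_top hv h2) hs'
    hd s' this this
  choose! ν hν using h3
  refine ⟨μ, ν, h1, fun s' hs' => (hν s' hs').1, ?_⟩
  rw [PMF.expect_bind]
  exact (PMF.expect_mono_on fun s' hs' => (hν s' hs').2).trans h2

theorem Tri.seq {c d : Program} {s : Store} {t t' : ℕ} {f g : Store → ℝ≥0∞} {v : ℝ≥0∞}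
    (hc : Tri c s t g v) (hd : ∀ s', g s' ≠ ⊤ → Tri d s' t' f (g s')) :
    Tri (.seq c d) s (1 + t + t') f v := by
  intro hv
  obtain ⟨μ, ν, h1, h2, h3⟩ := hc.bind_aux hd hv
  exact ⟨_, h1.seq h2, h3⟩

theorem Tri.while_cons {e : Expr} {c : Program} {s : Store} {t t' : ℕ} {f g : Store → ℝ≥0∞}
    {v : ℝ≥0∞} (he : e.eval s ≠ .nil) (hc : Tri c s t g v)
    (hd : ∀ s', g s' ≠ ⊤ → Tri (.while e c) s' t' f (g s')) :
    Tri (.while e c) s (1 + t + t') f v := by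
  intro hv
  obtain ⟨μ, ν, h1, h2, h3⟩ := hc.bind_aux hd hv
  exact ⟨_, h1.while_cons he h2, h3⟩

end TreeMachine

/-! ### A calculus of polynomial-time functions on trees -/

namespace TreeMachine

/-! ## Programs with an accumulator and a stack

The variable `a` is the accumulator, the variable `a + 1` is the stack; the variables below `a` are
free for a subroutine. -/

variable {a : ℕ}

/-- With `x` in the accumulator and `k` on the stack, the program `c` stops within `t` steps, and
the expectation of `F`, applied to the new contents of accumulator and stack, is at most `v`. -/
def Does (a : ℕ) (c : Program) (x k : Data) (t : ℕ) (F : Data → Data → ℝ≥0∞) (v : ℝ≥0∞) : Prop :=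
  ∀ s : Store, s a = x → s (a + 1) = k → Tri c s t (fun s' => F (s' a) (s' (a + 1))) v

theorem Does.mono {c : Program} {x k : Data} {t t' : ℕ} {F F' : Data → Data → ℝ≥0∞} {v v' : ℝ≥0∞}
    (h : Does a c x k t F v) (ht : t ≤ t') (hF : ∀ y k, F' y k ≤ F y k) (hv : v ≤ v') :
    Does a c x k t' F' v' := fun s hx hk => (h s hx hk).mono ht (fun _ => hF _ _) hv

theorem Does.seq {c d : Program} {x k : Data} {t t' : ℕ} {F G : Data → Data → ℝ≥0∞} {v : ℝ≥0∞}
    (hc : Does a c x k t G v) (hd : ∀ y k', G y k' ≠ ⊤ → Does a d y k' t' F (G y k')) :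
    Does a (.seq c d) x k (1 + t + t') F v := fun s hx hk =>
  (hc s hx hk).seq fun s' h' => hd _ _ h' s' rfl rfl

/-- With `x` in the accumulator and `k` on the stack, the program `c` stops within `t` steps with
`y` in the accumulator and `k'` on the stack. -/
def Det (a : ℕ) (c : Program) (x k : Data) (t : ℕ) (y k' : Data) : Prop :=
  ∀ F, Does a c x k t F (F y k')

theorem Det.mono {c : Program} {x k y k' : Data} {t t' : ℕ} (h : Det a c x k t y k')
    (ht : t ≤ t') : Det a c x k t' y k' := fun F => (h F).mono ht (fun _ _ => le_rfl) le_rfl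

-- The first program is applied to the function that is `v` at the expected result and `⊤`
-- elsewhere, so that a continuation is needed for that result only.
open Classical in
theorem Det.seq_does {c d : Program} {x k y k' : Data} {t t' : ℕ} {F : Data → Data → ℝ≥0∞}
    {v : ℝ≥0∞} (hc : Det a c x k t y k') (hd : Does a d y k' t' F v) :
    Does a (.seq c d) x k (1 + t + t') F v := by
  have := hc fun y₁ k₁ => if y₁ = y ∧ k₁ = k' then v else ⊤
  simp only [and_self, if_true] at this
  refine this.seq fun y₁ k₁ h => ?_
  by_cases h' : y₁ = y ∧ k₁ = k'
  · obtain ⟨rfl, rfl⟩ := h'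
    simpa using hd
  · simp [h'] at h

theorem Det.seq {c d : Program} {x k y k' z k'' : Data} {t t' : ℕ} (hc : Det a c x k t y k')
    (hd : Det a d y k' t' z k'') : Det a (.seq c d) x k (1 + t + t') z k'' :=
  fun F => hc.seq_does (hd F)

/-- Store a value in the accumulator. -/
theorem Det.assign_acc {x k : Data} (e : Expr) (y : Data)
    (h : ∀ s : Store, s a = x → s (a + 1) = k → e.eval s = y) :
    Det a (.assign a e) x k 1 y k := by
  intro F s hx hk
  have := Tri.of_pure (f := fun s' => F (s' a) (s' (a + 1))) (Exec.assign a e s)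
  simpa [h s hx hk, hk] using this

/-- Store a value on the stack. -/
theorem Det.assign_stack {x k : Data} (e : Expr) (k' : Data)
    (h : ∀ s : Store, s a = x → s (a + 1) = k → e.eval s = k') :
    Det a (.assign (a + 1) e) x k 1 x k' := by
  intro F s hx hk
  have := Tri.of_pure (f := fun s' => F (s' a) (s' (a + 1))) (Exec.assign (a + 1) e s)
  simpa [h s hx hk, hx] using this

/-- Push the accumulator on the stack. -/
def push (a : ℕ) : Program := .assign (a + 1) (.cons (.var a) (.var (a + 1)))

/-- Move the top of the stack to the accumulator. -/
def pop (a : ℕ) : Program :=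
  .seq (.assign a (.head (.var (a + 1)))) (.assign (a + 1) (.tail (.var (a + 1))))

/-- Store the accumulator below the top of the stack, and move the top to the accumulator. -/
def swap (a : ℕ) : Program :=
  .seq (.assign (a + 1) (.cons (.head (.var (a + 1))) (.cons (.var a) (.tail (.var (a + 1))))))
    (pop a)

/-- Combine the top of the stack and the accumulator to a pair. -/
def join (a : ℕ) : Program :=
  .seq (.assign a (.cons (.head (.var (a + 1))) (.var a)))
    (.assign (a + 1) (.tail (.var (a + 1))))

theorem det_push (x k : Data) : Det a (push a) x k 1 x (.cons x k) :=
  Det.assign_stack _ _ fun s h1 h2 => by simp [Expr.eval, h1, h2]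

theorem det_pop (x y k : Data) : Det a (pop a) x (.cons y k) 3 y k :=
  (Det.assign_acc (y := y) _ fun s _ h2 => by simp [Expr.eval, h2, Data.head]).seq
    (Det.assign_stack _ _ fun s _ h2 => by simp [Expr.eval, h2, Data.tail])

theorem det_swap (x y k : Data) : Det a (swap a) x (.cons y k) 5 y (.cons x k) :=
  (Det.assign_stack (k' := .cons y (.cons x k)) _ fun s h1 h2 => by
    simp [Expr.eval, h1, h2, Data.head, Data.tail]).seq (det_pop _ _ _)

theorem det_join (x y k : Data) : Det a (join a) x (.cons y k) 3 (.cons y x) k :=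
  (Det.assign_acc (y := .cons y x) _ fun s h1 h2 => by simp [Expr.eval, h1, h2, Data.head]).seq
    (Det.assign_stack _ _ fun s _ h2 => by simp [Expr.eval, h2, Data.tail])

theorem Does.ite_nil {c d : Program} {k : Data} {t : ℕ} {F : Data → Data → ℝ≥0∞} {v : ℝ≥0∞}
    (h : Does a d .nil k t F v) : Does a (.ite (.var a) c d) .nil k (1 + t) F v :=
  fun s hx hk hv => by
    obtain ⟨μ, h1, h2⟩ := h s hx hk hv
    exact ⟨μ, h1.ite_nil (by simp [Expr.eval, hx]), h2⟩

theorem Does.ite_cons {c d : Program} {x k : Data} {t : ℕ} {F : Data → Data → ℝ≥0∞} {v : ℝ≥0∞}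
    (hx0 : x ≠ .nil) (h : Does a c x k t F v) : Does a (.ite (.var a) c d) x k (1 + t) F v :=
  fun s hx hk hv => by
    obtain ⟨μ, h1, h2⟩ := h s hx hk hv
    exact ⟨μ, h1.ite_cons (by simpa [Expr.eval, hx] using hx0), h2⟩

/-- Repeat `c` as long as the left subtree of the accumulator is not `nil`. -/
def loop (a : ℕ) (c : Program) : Program := .while (.head (.var a)) c

theorem Does.loop_nil {c : Program} {x k : Data} {F : Data → Data → ℝ≥0∞} (hx0 : x.head = .nil) :
    Does a (loop a c) x k 1 F (F x k) := fun s hx hk => by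
  have := Tri.of_pure (f := fun s' => F (s' a) (s' (a + 1)))
    (Exec.while_nil (c := c) (s := s) (e := .head (.var a)) (by simp [Expr.eval, hx, hx0]))
  simpa [hx, hk, loop] using this

theorem Does.loop_cons {c : Program} {x k : Data} {t t' : ℕ} {F G : Data → Data → ℝ≥0∞}
    {v : ℝ≥0∞} (hx0 : x.head ≠ .nil) (hc : Does a c x k t G v)
    (hd : ∀ y k', G y k' ≠ ⊤ → Does a (loop a c) y k' t' F (G y k')) :
    Does a (loop a c) x k (1 + t + t') F v := fun s hx hk =>
  Tri.while_cons (by simpa [Expr.eval, hx] using hx0) (hc s hx hk) fun s' h' =>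
    hd _ _ h' s' rfl rfl

open Classical in
theorem Det.loop_cons {c : Program} {x k y k' z k'' : Data} {t t' : ℕ} (hx0 : x.head ≠ .nil)
    (hc : Det a c x k t y k') (hd : Det a (loop a c) y k' t' z k'') :
    Det a (loop a c) x k (1 + t + t') z k'' := fun F => by
  have := hc fun y₁ k₁ => if y₁ = y ∧ k₁ = k' then F z k'' else ⊤
  simp only [and_self, if_true] at this
  refine this.loop_cons hx0 fun y₁ k₁ h => ?_
  by_cases h' : y₁ = y ∧ k₁ = k'
  · obtain ⟨rfl, rfl⟩ := h'
    simpa using hd F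
  · simp [h'] at h

theorem Det.loop_iterate {c : Program} {f : Data → Data} {k : Data} {τ : ℕ} (n : ℕ) (x : Data)
    (hc : ∀ i < n, Det a c (f^[i] x) k τ (f^[i + 1] x) k)
    (hcons : ∀ i < n, (f^[i] x).head ≠ .nil) (hnil : (f^[n] x).head = .nil) :
    Det a (loop a c) x k (n * (τ + 1) + 1) (f^[n] x) k := by
  induction n generalizing x with
  | zero => exact fun F => (Does.loop_nil hnil).mono (by omega) (fun _ _ => le_rfl) le_rfl
  | succ n ih =>
    have h0 := hc 0 n.succ_pos
    have := ih (f x) (fun i hi => by simpa using hc (i + 1) (by omega))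
      (fun i hi => by simpa using hcons (i + 1) (by omega)) (by simpa using hnil)
    rw [← Function.iterate_succ_apply] at this
    exact (Det.loop_cons (by simpa using hcons 0 n.succ_pos) h0 this).mono (by ring_nf; omega)

/-! ## Sizes and polynomial bounds -/

/-- The number of inner nodes of a tree. -/
def Data.size : Data → ℕ
  | .nil => 0
  | .cons x y => x.size + y.size + 1

@[simp] theorem Data.size_nil : Data.nil.size = 0 := rfl
@[simp] theorem Data.size_cons (x y : Data) : (Data.cons x y).size = x.size + y.size + 1 := rfl
@[simp] theorem Data.head_cons (x y : Data) : (Data.cons x y).head = x := rfl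
@[simp] theorem Data.tail_cons (x y : Data) : (Data.cons x y).tail = y := rfl
@[simp] theorem Data.head_nil : Data.nil.head = .nil := rfl
@[simp] theorem Data.tail_nil : Data.nil.tail = .nil := rfl

theorem Data.size_head_le (x : Data) : x.head.size ≤ x.size := by
  cases x <;> simp; omega

theorem Data.size_tail_le (x : Data) : x.tail.size ≤ x.size := by
  cases x <;> simp; omega

/-- A function is bounded by a polynomial in the size of its argument. -/
def PolyBound (g : Data → ℕ) : Prop := ∃ C : ℕ, ∀ x, g x ≤ (x.size + 2) ^ C

namespace PolyBound

variable {g h : Data → ℕ}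

theorem mono (hg : PolyBound g) (hle : ∀ x, h x ≤ g x) : PolyBound h :=
  let ⟨C, hC⟩ := hg
  ⟨C, fun x => (hle x).trans (hC x)⟩

/-- The base `x.size + 2` is at least 2, so a large exponent absorbs any constant. -/
theorem const (n : ℕ) : PolyBound fun _ => n :=
  ⟨n, fun x => (Nat.lt_two_pow_self (n := n)).le.trans (Nat.pow_le_pow_left (by omega) n)⟩

theorem size : PolyBound Data.size := ⟨1, fun x => by simp⟩

theorem add (hg : PolyBound g) (hh : PolyBound h) : PolyBound fun x => g x + h x := by
  obtain ⟨C, hC⟩ := hg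
  obtain ⟨D, hD⟩ := hh
  -- The sum of two powers is at most twice the larger one, and the factor 2 is paid by one more
  -- factor of the base.
  refine ⟨max C D + 1, fun x => ?_⟩
  have h1 : (x.size + 2) ^ C ≤ (x.size + 2) ^ max C D :=
    Nat.pow_le_pow_right (by omega) (le_max_left _ _)
  have h2 : (x.size + 2) ^ D ≤ (x.size + 2) ^ max C D :=
    Nat.pow_le_pow_right (by omega) (le_max_right _ _)
  have h3 := hC x
  have h4 := hD x
  rw [pow_succ]
  nlinarith [Nat.zero_le ((x.size + 2) ^ max C D * x.size)]

theorem mul (hg : PolyBound g) (hh : PolyBound h) : PolyBound fun x => g x * h x := by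
  obtain ⟨C, hC⟩ := hg
  obtain ⟨D, hD⟩ := hh
  exact ⟨C + D, fun x => by rw [pow_add]; exact Nat.mul_le_mul (hC x) (hD x)⟩

theorem pow (hg : PolyBound g) (n : ℕ) : PolyBound fun x => g x ^ n := by
  obtain ⟨C, hC⟩ := hg
  exact ⟨C * n, fun x => by rw [pow_mul]; exact Nat.pow_le_pow_left (hC x) n⟩

theorem comp (hg : PolyBound g) {f : Data → Data} (hf : PolyBound fun x => (f x).size) :
    PolyBound fun x => g (f x) := by
  obtain ⟨C, hC⟩ := hg
  exact ((hf.add (const 2)).pow C).mono fun x => hC (f x)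

end PolyBound

/-- The function `f` is computed, without coin tosses, in polynomial time, by a program with
accumulator `a`, and the size of its values is bounded by a polynomial. -/
def Poly (a : ℕ) (f : Data → Data) : Prop :=
  (PolyBound fun x => (f x).size) ∧ ∃ c : Program, c.CoinFree ∧
    ∃ T : Data → ℕ, PolyBound T ∧ ∀ x k, Det a c x k (T x) (f x) k

namespace Poly

variable {f g h : Data → Data}

theorem id : Poly a fun x => x :=
  ⟨PolyBound.size, .skip, trivial, fun _ => 1, .const 1, fun x k F s hx hk => by
    have := Tri.of_pure (f := fun s' => F (s' a) (s' (a + 1))) (Exec.skip s)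
    simpa [hx, hk] using this⟩

theorem nil : Poly a fun _ => .nil :=
  ⟨.const 0, .assign a .nil, trivial, fun _ => 1, .const 1, fun _ _ =>
    Det.assign_acc _ _ fun _ _ _ => rfl⟩

/-- The second program runs on `g x`; the bound on the size of values in `Poly` makes its time
polynomial in the size of `x`. -/
theorem comp (hf : Poly a f) (hg : Poly a g) : Poly a fun x => f (g x) := by
  obtain ⟨sf, cf, ff, Tf, pf, df⟩ := hf
  obtain ⟨sg, cg, fg, Tg, pg, dg⟩ := hg
  exact ⟨sf.comp sg, .seq cg cf, ⟨fg, ff⟩, _, ((PolyBound.const 1).add pg).add (pf.comp sg),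
    fun x k => (dg x k).seq (df _ k)⟩

theorem head (hf : Poly a f) : Poly a fun x => (f x).head :=
  comp (f := Data.head) ⟨PolyBound.size.mono Data.size_head_le, .assign a (.head (.var a)), trivial,
    fun _ => 1, .const 1, fun _ _ => Det.assign_acc _ _ fun _ h _ => by simp [Expr.eval, h]⟩ hf

theorem tail (hf : Poly a f) : Poly a fun x => (f x).tail :=
  comp (f := Data.tail) ⟨PolyBound.size.mono Data.size_tail_le, .assign a (.tail (.var a)), trivial,
    fun _ => 1, .const 1, fun _ _ => Det.assign_acc _ _ fun _ h _ => by simp [Expr.eval, h]⟩ hf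

/-- The argument waits on the stack while `f` is computed, `swap` exchanges it for the value of `f`,
and `join` pairs that with the value of `g`. -/
theorem cons (hf : Poly a f) (hg : Poly a g) : Poly a fun x => .cons (f x) (g x) := by
  obtain ⟨sf, cf, ff, Tf, pf, df⟩ := hf
  obtain ⟨sg, cg, fg, Tg, pg, dg⟩ := hg
  refine ⟨(sf.add sg).add (.const 1),
    .seq (.seq (.seq (.seq (push a) cf) (swap a)) cg) (join a),
    ⟨⟨⟨⟨trivial, ff⟩, trivial, trivial, trivial⟩, fg⟩, trivial, trivial⟩,
    _, ?_, fun x k => ((((det_push x k).seq (df x _)).seq (det_swap _ _ _)).seq (dg x _)).seq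
      (det_join _ _ _)⟩
  exact (((((PolyBound.const 1).add (((PolyBound.const 1).add ((((PolyBound.const 1).add
    (((PolyBound.const 1).add (.const 1)).add pf))).add (.const 5))).add pg))).add (.const 3)))

end Poly

/-- Case distinction. -/
def sel (b x y : Data) : Data :=
  match b with
  | .nil => y
  | .cons _ _ => x

@[simp] theorem sel_nil (x y : Data) : sel .nil x y = y := rfl
@[simp] theorem sel_cons (b b' x y : Data) : sel (.cons b b') x y = x := rfl

theorem sel_of_ne {b : Data} (h : b ≠ .nil) (x y : Data) : sel b x y = x := by
  cases b with
  | nil => exact (h rfl).elim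
  | cons => rfl

namespace Poly

variable {f g h : Data → Data}

theorem sel (hf : Poly a f) (hg : Poly a g) (hh : Poly a h) :
    Poly a fun x => sel (f x) (g x) (h x) := by
  obtain ⟨sf, cf, ff, Tf, pf, df⟩ := hf
  obtain ⟨sg, cg, fg, Tg, pg, dg⟩ := hg
  obtain ⟨sh, ch, fh, Th, ph, dh⟩ := hh
  refine ⟨(sg.add sh).mono fun x => ?_, .seq (.seq (push a) cf)
    (.ite (.var a) (.seq (pop a) cg) (.seq (pop a) ch)),
    ⟨⟨trivial, ff⟩, ⟨⟨trivial, trivial⟩, fg⟩, ⟨trivial, trivial⟩, fh⟩,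
    -- Either branch is charged for both, which makes the time bound independent of the test.
    fun x => 1 + (1 + 1 + Tf x) + (1 + (1 + 3 + (Tg x + Th x))), ?_, fun x k => ?_⟩
  · by_cases hfx : f x = .nil
    · simp [hfx]
    · simp [sel_of_ne hfx]
  · exact ((PolyBound.const 1).add ((PolyBound.const _).add pf)).add
      ((PolyBound.const 1).add ((PolyBound.const _).add (pg.add ph)))
  · refine ((det_push x k).seq (df x _)).seq fun F => ?_
    by_cases hfx : f x = .nil
    · simp only [hfx, sel_nil]
      exact .ite_nil ((((det_pop _ _ _).seq (dh x k)).mono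
        (t' := 1 + 3 + (Tg x + Th x)) (by omega)) F)
    · simp only [sel_of_ne hfx]
      exact .ite_cons hfx ((((det_pop _ _ _).seq (dg x k)).mono
        (t' := 1 + 3 + (Tg x + Th x)) (by omega)) F)

/-- Iteration as long as the left subtree is not `nil`. -/
theorem iterate {i : Data → Data} (hf : Poly a f) (hi : Poly a i) {n : Data → ℕ}
    (hn : PolyBound n) (hs : ∃ S, PolyBound S ∧ ∀ x, ∀ j ≤ n x, (f^[j] (i x)).size ≤ S x)
    (hcons : ∀ x, ∀ j < n x, (f^[j] (i x)).head ≠ .nil)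
    (hnil : ∀ x, (f^[n x] (i x)).head = .nil) : Poly a fun x => f^[n x] (i x) := by
  obtain ⟨-, cf, ff, T, ⟨C, hC⟩, df⟩ := hf
  obtain ⟨-, ci, fi, Ti, pi, di⟩ := hi
  obtain ⟨S, pS, hS⟩ := hs
  refine ⟨pS.mono fun x => hS x _ le_rfl, .seq ci (loop a cf), ⟨fi, ff⟩,
    fun x => 1 + Ti x + (n x * ((S x + 2) ^ C + 1) + 1), ?_, fun x k => (di x k).seq ?_⟩
  · exact ((PolyBound.const 1).add pi).add
      ((hn.mul (((pS.add (.const 2)).pow C).add (.const 1))).add (.const 1))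
  · refine Det.loop_iterate (n x) (i x) (fun j hj => ?_) (hcons x) (hnil x)
    rw [Function.iterate_succ_apply']
    refine (df _ k).mono ((hC _).trans (Nat.pow_le_pow_left ?_ C))
    have := hS x j hj.le
    omega

end Poly

end TreeMachine

namespace TreeMachine

variable {a : ℕ}

/-! ## Lists -/

/-- A tree as a list. -/
def Data.toList : Data → List Data
  | .nil => []
  | .cons x y => x :: y.toList

@[simp] theorem Data.toList_nil : Data.nil.toList = [] := rfl
@[simp] theorem Data.toList_cons (x y : Data) : (Data.cons x y).toList = x :: y.toList := rfl
@[simp] theorem ofList_nil : ofList [] = .nil := rfl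
@[simp] theorem ofList_cons (x : Data) (l : List Data) :
    ofList (x :: l) = .cons x (ofList l) := rfl

@[simp] theorem toList_ofList (l : List Data) : (ofList l).toList = l := by
  induction l <;> simp_all

@[simp] theorem ofList_toList (x : Data) : ofList x.toList = x := by
  induction x <;> simp_all

theorem ofList_injective : Function.Injective ofList :=
  Function.LeftInverse.injective toList_ofList

theorem toList_eq_nil {x : Data} : x.toList = [] ↔ x = .nil := by cases x <;> simp

theorem size_ofList (l : List Data) : (ofList l).size = (l.map Data.size).sum + l.length := by
  induction l <;> simp_all; omega

theorem size_eq (x : Data) : x.size = (x.toList.map Data.size).sum + x.toList.length := by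
  rw [← size_ofList, ofList_toList]

theorem length_toList_le (x : Data) : x.toList.length ≤ x.size := by rw [size_eq]; omega

theorem size_le_of_mem_toList {x y : Data} (h : y ∈ x.toList) : y.size ≤ x.size := by
  rw [size_eq x]
  exact (List.le_sum_of_mem (List.mem_map_of_mem h)).trans (Nat.le_add_right _ _)

theorem size_ofList_le {l : List Data} {B : ℕ} (h : ∀ x ∈ l, x.size ≤ B) :
    (ofList l).size ≤ l.length * (B + 1) := by
  induction l with
  | nil => simp
  | cons x l ih =>
    simp only [List.mem_cons, forall_eq_or_imp] at h
    have := ih h.2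
    simp only [ofList_cons, Data.size_cons, List.length_cons]
    nlinarith [h.1]

@[simp] theorem size_ofNat (n : ℕ) : (ofNat n).size = n := by
  simp [ofNat, size_ofList]

@[simp] theorem ofNat_zero : ofNat 0 = .nil := rfl
@[simp] theorem ofNat_succ (n : ℕ) : ofNat (n + 1) = .cons .nil (ofNat n) := by
  simp [ofNat, List.replicate_succ]

@[simp] theorem tail_ofNat (n : ℕ) : (ofNat n).tail = ofNat (n - 1) := by cases n <;> simp

@[simp] theorem length_ofNat (n : ℕ) : (ofNat n).toList.length = n := by simp [ofNat]

theorem ofNat_injective : Function.Injective ofNat := fun m n h => by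
  simpa using congrArg Data.size h

@[simp] theorem ofNat_eq_nil {n : ℕ} : ofNat n = .nil ↔ n = 0 := by
  rw [← ofNat_zero]; exact ofNat_injective.eq_iff

namespace Poly

variable {l i x y : Data → Data} {F : Data → Data → Data → Data}

/-- The loop state consists of the rest of the list, the accumulated value and the parameter `x`,
with the list in front because `loop` tests the left subtree. Since iterating a polynomially bounded
function may blow up sizes, the intermediate values need the separate bound `hs`. -/
theorem foldl (hF : Poly a fun y => F y.head y.tail.head y.tail.tail) (hl : Poly a l)
    (hi : Poly a i) (hs : ∃ S, PolyBound S ∧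
      ∀ x, ∀ l', l' <+: (l x).toList → (l'.foldl (fun s e => F e s x) (i x)).size ≤ S x) :
    Poly a fun x => (l x).toList.foldl (fun s e => F e s x) (i x) := by
  let B : Data → Data := fun z =>
    .cons z.head.tail (.cons (F z.head.head z.tail.head z.tail.tail) z.tail.tail)
  have hB : Poly a B := id.head.tail.cons
    ((hF.comp (id.head.head.cons id.tail)).cons id.tail.tail)
  have key : ∀ (x : Data) (j : ℕ) (L s : Data), j ≤ L.toList.length →
      B^[j] (.cons L (.cons s x)) = .cons (ofList (L.toList.drop j))
        (.cons ((L.toList.take j).foldl (fun s e => F e s x) s) x) := by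
    intro x j
    induction j with
    | zero => simp
    | succ j ih =>
      intro L s hj
      cases L with
      | nil => simp at hj
      | cons e L =>
        rw [Function.iterate_succ_apply]
        simpa [B] using ih L _ (by simpa using hj)
  obtain ⟨S, pS, hS⟩ := hs
  have hlen : PolyBound fun x => (l x).toList.length := hl.1.mono fun x => length_toList_le _
  have := iterate hB (hl.cons (hi.cons id)) hlen
    ⟨fun x => (l x).size + S x + x.size + 2, ?_, fun x j hj => ?_⟩ (fun x j hj => ?_) (fun x => ?_)
  · convert this.tail.head using 2 with x
    rw [key x _ _ _ le_rfl]
    simp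
  · exact ((hl.1.add pS).add PolyBound.size).add (.const 2)
  · rw [key x _ _ _ hj]
    have h1 : (ofList ((l x).toList.drop j)).size ≤ (l x).size := by
      rw [size_ofList, size_eq (l x)]
      have := ((List.drop_sublist j (l x).toList).map Data.size).sum_le_sum (by simp)
      have h2 := (List.drop_sublist j (l x).toList).length_le
      omega
    have h2 := hS x _ (List.take_prefix j (l x).toList)
    simp only [Data.size_cons]
    omega
  · rw [key x _ _ _ hj.le]
    rw [Data.head_cons, ← ofList_nil, ofList_injective.ne_iff]
    simpa using hj
  · rw [key x _ _ _ le_rfl]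
    simp

end Poly

/-- Reversal of a list. -/
def rev (x : Data) : Data := ofList x.toList.reverse

/-- Concatenation of two lists. -/
def app (x y : Data) : Data := ofList (x.toList ++ y.toList)

/-- `y` with as many entries removed as `x` has. -/
def dropLen (x y : Data) : Data := ofList (y.toList.drop x.toList.length)

@[simp] theorem toList_rev (x : Data) : (rev x).toList = x.toList.reverse := toList_ofList _
@[simp] theorem toList_app (x y : Data) : (app x y).toList = x.toList ++ y.toList :=
  toList_ofList _
@[simp] theorem toList_dropLen (x y : Data) :
    (dropLen x y).toList = y.toList.drop x.toList.length := toList_ofList _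

theorem dropLen_eq_nil {x y : Data} :
    dropLen x y = .nil ↔ y.toList.length ≤ x.toList.length := by
  rw [← toList_eq_nil]; simp

@[simp] theorem dropLen_ofNat (m n : ℕ) : dropLen (ofNat m) (ofNat n) = ofNat (n - m) := by
  simp [dropLen, ofNat]

theorem foldl_cons (l : List Data) (y : Data) :
    l.foldl (fun s e => .cons e s) y = ofList (l.reverse ++ y.toList) := by
  induction l generalizing y <;> simp_all

theorem foldl_tail (l : List Data) (y : Data) :
    l.foldl (fun s _ => s.tail) y = ofList (y.toList.drop l.length) := by
  induction l generalizing y with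
  | nil => simp
  | cons e l ih => rw [List.foldl_cons, ih]; cases y <;> simp

theorem size_ofList_append (l l' : List Data) :
    (ofList (l ++ l')).size = (ofList l).size + (ofList l').size := by
  simp [size_ofList]; omega

theorem size_ofList_reverse (l : List Data) : (ofList l.reverse).size = (ofList l).size := by
  simp [size_ofList, List.sum_reverse]

theorem size_ofList_sublist {l l' : List Data} (h : l.Sublist l') :
    (ofList l).size ≤ (ofList l').size := by
  rw [size_ofList, size_ofList]
  have := (h.map Data.size).sum_le_sum (by simp)
  have h2 := h.length_le
  omega

@[simp] theorem size_app (x y : Data) : (app x y).size = x.size + y.size := by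
  simp [app, size_ofList_append]

namespace Poly

variable {l x y : Data → Data} {F : Data → Data → Data}

theorem rev (hx : Poly a x) : Poly a fun z => rev (x z) := by
  have := foldl (F := fun e s _ => .cons e s) (id.head.cons id.tail.head) hx nil
    ⟨fun z => (x z).size, hx.1, fun z l' h => ?_⟩
  · simpa only [foldl_cons, Data.toList_nil, List.append_nil, TreeMachine.rev] using this
  · simp only [foldl_cons, Data.toList_nil, List.append_nil, size_ofList_reverse]
    exact (size_ofList_sublist h.sublist).trans (by simp)

theorem app (hx : Poly a x) (hy : Poly a y) : Poly a fun z => app (x z) (y z) := by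
  have := foldl (F := fun e s _ => .cons e s) (id.head.cons id.tail.head) hx.rev hy
    ⟨fun z => (x z).size + (y z).size, hx.1.add hy.1, fun z l' h => ?_⟩
  · simpa only [foldl_cons, toList_rev, List.reverse_reverse, TreeMachine.app] using this
  · simp only [foldl_cons, size_ofList_append, size_ofList_reverse, ofList_toList]
    have := size_ofList_sublist h.sublist
    rw [toList_rev, size_ofList_reverse, ofList_toList] at this
    omega

theorem dropLen (hx : Poly a x) (hy : Poly a y) : Poly a fun z => dropLen (x z) (y z) := by
  have := foldl (F := fun e s _ => s.tail) id.tail.head.tail hx hy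
    ⟨fun z => (y z).size, hy.1, fun z l' h => ?_⟩
  · simpa only [foldl_tail, TreeMachine.dropLen] using this
  · simp only [foldl_tail]
    exact (size_ofList_sublist (List.drop_sublist _ _)).trans (by simp)

theorem foldl_app (l : List Data) (G : Data → Data) (s : Data) :
    l.foldl (fun s e => TreeMachine.app (G e) s) s =
      ofList ((l.reverse.flatMap fun e => (G e).toList) ++ s.toList) := by
  induction l generalizing s with
  | nil => simp
  | cons e l ih => rw [List.foldl_cons, ih]; simp

/-- List comprehension. -/
theorem flatMap (hF : Poly a fun y => F y.head y.tail) (hl : Poly a l) :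
    Poly a fun x => ofList ((l x).toList.flatMap fun e => (F e x).toList) := by
  obtain ⟨C, hC⟩ := hF.1
  have := foldl (F := fun e s x => TreeMachine.app (F e x) s)
    (app (hF.comp (id.head.cons id.tail.tail)) id.tail.head) hl.rev nil
    ⟨fun x => (l x).size * ((l x).size + x.size + 3) ^ C, ?_, fun x l' h => ?_⟩
  · simpa only [foldl_app, toList_rev, List.reverse_reverse, Data.toList_nil, List.append_nil]
      using this
  · exact hl.1.mul (((hl.1.add PolyBound.size).add (.const 3)).pow C)
  · have h1 : ∀ (l' : List Data), (∀ e ∈ l', e ∈ (l x).toList) → ∀ s : Data,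
        (l'.foldl (fun s e => TreeMachine.app (F e x) s) s).size ≤
          l'.length * ((l x).size + x.size + 3) ^ C + s.size := by
      intro l'
      induction l' with
      | nil => simp
      | cons e l' ih =>
        intro hl' s
        simp only [List.mem_cons, forall_eq_or_imp] at hl'
        have h2 := ih hl'.2 (TreeMachine.app (F e x) s)
        have h3 := hC (.cons e x)
        simp only [Data.head_cons, Data.tail_cons, Data.size_cons] at h3
        have h4 : (e.size + x.size + 1 + 2) ^ C ≤ ((l x).size + x.size + 3) ^ C :=
          Nat.pow_le_pow_left (by have := size_le_of_mem_toList hl'.1; omega) C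
        rw [size_app] at h2
        simp only [List.foldl_cons, List.length_cons]
        nlinarith
    have h2 := h1 l' (fun e he => by simpa using h.sublist.subset he) .nil
    refine h2.trans ?_
    simp only [Data.size_nil, add_zero]
    gcongr
    have := h.sublist.length_le
    rw [toList_rev, List.length_reverse] at this
    exact this.trans (length_toList_le _)

theorem map (hF : Poly a fun y => F y.head y.tail) (hl : Poly a l) :
    Poly a fun x => ofList ((l x).toList.map fun e => F e x) := by
  have := flatMap (F := fun e x => .cons (F e x) .nil) (hF.cons nil) hl
  simpa only [Data.toList_cons, Data.toList_nil, ← List.map_eq_flatMap] using this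

end Poly

end TreeMachine

/-! ### The reduction, written as functions on trees -/

namespace TreeMachine

variable {a : ℕ}

/-! ## The combinatorial building blocks as functions of trees -/

/-- The tree that stands for "true". -/
def yes : Data := .cons .nil .nil

@[simp] theorem sel_yes (x y : Data) : sel yes x y = x := rfl
@[simp] theorem yes_ne_nil : yes ≠ .nil := by simp [yes]
@[simp] theorem ofBool_true : ofBool true = yes := rfl
@[simp] theorem ofBool_false : ofBool false = .nil := rfl

/-- Does some row of the list `u` have a `1` in column `e`? -/
def anyBit (e u : Data) : Data :=
  ofList (u.toList.flatMap fun r => (dropLen e r).head.toList)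

/-- The list of the numbers `n - 1, …, 0`. -/
def columns (n : Data) : Data :=
  (n.toList.foldl (fun s _ => Data.cons (.cons .nil s.head) s) (.cons .nil .nil)).tail

/-- The columns with a `1` in some row of `v`, but in no row of `u`. -/
def newColumns (n v u : Data) : Data :=
  ofList ((columns n).toList.flatMap fun e =>
    (sel (anyBit e v) (sel (anyBit e u) .nil (.cons e .nil)) .nil).toList)

/-- The concatenation of `c` copies of a list. -/
def copies : ℕ → Data → Data
  | 0, _ => .nil
  | c + 1, x => app x (copies c x)

/-- Is `c` times the length of `x` at most the length of `y`? -/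
def mulLe (c : ℕ) (x y : Data) : Data := sel (dropLen y (copies c x)) .nil yes

/-- The numbers up to `p / c + 1`. -/
def pendants (c : ℕ) (p : Data) : Data :=
  ofList ((columns (.cons .nil (.cons .nil p))).toList.flatMap fun y =>
    (sel (mulLe c y.tail p) (.cons y .nil) .nil).toList)

/-- The lists of at most `j` of the given rows, each with `t` minus its length. -/
def selections : ℕ → Data → Data → Data
  | 0, _, t => .cons (.cons .nil t) .nil
  | j + 1, rows, t => app (selections j rows t)
      (ofList ((selections j rows t).toList.flatMap fun s =>
        (ofList (rows.toList.flatMap fun r =>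
          (sel s.tail (.cons (.cons (.cons r s.head) s.tail.tail) .nil) .nil).toList)).toList))

/-- The lists of at most `c` rows that have at most `p / c` columns outside of `u`. -/
def groups (c : ℕ) (p n rows u : Data) : Data :=
  ofList ((selections c rows (ofNat c)).toList.flatMap fun s =>
    (sel (mulLe c (newColumns n s.head u) p) (.cons s.head .nil) .nil).toList)

/-- The label of the root. -/
def rootLabel : Data := .cons (.cons .nil .nil) .nil
/-- The label of a pendant vertex at the root. -/
def pendLabel (x : Data) : Data := .cons (.cons .nil yes) x
/-- The label of a group. -/
def groupLabel (x : Data) : Data := .cons (.cons yes .nil) x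
/-- The label of an element. -/
def elemLabel (x : Data) : Data := .cons (.cons yes yes) x

/-- One orientation of the adjacency of labelled vertices. -/
def halfAdj (R : Data → Data → Data) (x y : Data) : Data :=
  sel x.head.head
    (sel x.head.tail .nil (sel y.head.head (sel y.head.tail (R x.tail y.tail) .nil) .nil))
    (sel x.head.tail .nil (sel y.head.head (sel y.head.tail .nil yes) (sel y.head.tail yes .nil)))

/-- Adjacency of labelled vertices: the root is adjacent to the pendant vertices and to the groups,
and a group is adjacent to the elements to which it is related by `R`. -/
def labelAdj (R : Data → Data → Data) (x y : Data) : Data :=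
  sel (halfAdj R x y) yes (sel (halfAdj R y x) yes .nil)

/-- The adjacency matrix of a list of labelled vertices. -/
def matrix (R : Data → Data → Data) (l : Data) : Data :=
  ofList (l.toList.map fun x => ofList (l.toList.map fun y => labelAdj R x y))

/-- A group contains an element that is not yet covered. -/
def covRel (u v e : Data) : Data := sel (anyBit e v) (sel (anyBit e u) .nil yes) .nil

/-- Two lists have equal lengths. -/
def lenEq (x y : Data) : Data := sel (dropLen x y) .nil (sel (dropLen y x) .nil yes)

/-- The vertices of the host graph. -/
def hostLabels (c : ℕ) (p n rows u : Data) : Data :=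
  .cons rootLabel (app (ofList ((pendants c p).toList.map fun y => pendLabel y))
    (app (ofList ((groups c p n rows u).toList.map fun y => groupLabel y))
      (ofList ((columns n).toList.map fun y => elemLabel y))))

/-- The vertices of the pattern tree. -/
def patternLabels (c : ℕ) (p w : Data) : Data :=
  .cons rootLabel (app (ofList ((pendants c p).toList.map fun y => pendLabel y)) w)

/-- The host graph and the pattern tree. -/
def queryOf (c : ℕ) (p n rows u w : Data) : Data :=
  .cons (matrix (covRel u) (hostLabels c p n rows u)) (matrix lenEq (patternLabels c p w))

/-- The entries are unary numbers, hence the quadratic bound; the induction also bounds the first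
entry, from which the next one is built. -/
theorem size_foldl_columns (l : List Data) :
    (l.foldl (fun s _ => Data.cons (.cons .nil s.head) s) (.cons .nil .nil)).size ≤
      (l.length + 1) * (l.length + 1) := by
  suffices h : ∀ (l : List Data) (s : Data) (j : ℕ), s.head.size ≤ j → s.size ≤ (j + 1) * (j + 1) →
      (l.foldl (fun s _ => Data.cons (.cons .nil s.head) s) s).size ≤
        (j + l.length + 1) * (j + l.length + 1) by
    simpa using h l (.cons .nil .nil) 0 (by simp) (by simp)
  intro l
  induction l with
  | nil => intro s j _ h; simpa using h
  | cons e l ih =>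
    intro s j h1 h2
    have := ih (.cons (.cons .nil s.head) s) (j + 1) (by simp; omega) (by simp; nlinarith)
    rw [List.foldl_cons, List.length_cons]
    convert this using 2 <;> ring

/-! ### The graph constructions take polynomial time -/

namespace Poly

variable {x y z e u v w p n l t rows : Data → Data} {R : Data → Data → Data → Data}

theorem yes : Poly a fun _ => yes := nil.cons nil

theorem ofNat (k : ℕ) : Poly a fun _ => ofNat k := by
  induction k with
  | zero => exact nil
  | succ k ih => simpa only [ofNat_succ] using nil.cons ih

theorem anyBit (he : Poly a e) (hu : Poly a u) : Poly a fun x => anyBit (e x) (u x) :=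
  flatMap (F := fun r x => (TreeMachine.dropLen (e x) r).head)
    (dropLen (he.comp id.tail) id.head).head hu

theorem columns (hn : Poly a n) : Poly a fun x => columns (n x) :=
  tail (foldl (F := fun _ s _ => .cons (.cons .nil s.head) s)
    ((nil.cons id.tail.head.head).cons id.tail.head) hn (nil.cons nil)
    ⟨fun x => ((n x).size + 1) * ((n x).size + 1),
      (hn.1.add (.const 1)).mul (hn.1.add (.const 1)), fun x l' h => by
        refine (size_foldl_columns l').trans ?_
        have := h.length_le.trans (length_toList_le _)
        exact Nat.mul_le_mul (by omega) (by omega)⟩)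

theorem newColumns (hn : Poly a n) (hv : Poly a v) (hu : Poly a u) :
    Poly a fun x => newColumns (n x) (v x) (u x) :=
  flatMap (F := fun e x => TreeMachine.sel (TreeMachine.anyBit e (v x))
      (TreeMachine.sel (TreeMachine.anyBit e (u x)) .nil (.cons e .nil)) .nil)
    (sel (anyBit id.head (hv.comp id.tail))
      (sel (anyBit id.head (hu.comp id.tail)) nil (id.head.cons nil)) nil) hn.columns

theorem copies (c : ℕ) (hx : Poly a x) : Poly a fun y => copies c (x y) := by
  induction c with
  | zero => exact nil
  | succ c ih => exact hx.app ih

theorem mulLe (c : ℕ) (hx : Poly a x) (hy : Poly a y) : Poly a fun z => mulLe c (x z) (y z) :=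
  sel (dropLen hy (hx.copies c)) nil yes

theorem pendants (c : ℕ) (hp : Poly a p) : Poly a fun x => pendants c (p x) :=
  flatMap (F := fun y x => TreeMachine.sel (TreeMachine.mulLe c y.tail (p x)) (.cons y .nil) .nil)
    (sel (mulLe c id.head.tail (hp.comp id.tail)) (id.head.cons nil) nil)
    (nil.cons (nil.cons hp)).columns

theorem selections (j : ℕ) (hr : Poly a rows) (ht : Poly a t) :
    Poly a fun x => selections j (rows x) (t x) := by
  induction j with
  | zero => exact (nil.cons ht).cons nil
  | succ j ih =>
    refine ih.app (flatMap (F := fun s x => ofList ((rows x).toList.flatMap fun r =>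
      (TreeMachine.sel s.tail (.cons (.cons (.cons r s.head) s.tail.tail) .nil) .nil).toList))
      ?_ ih)
    exact flatMap (F := fun r y => TreeMachine.sel y.head.tail
      (.cons (.cons (.cons r y.head.head) y.head.tail.tail) .nil) .nil)
      (sel id.tail.head.tail
        (((id.head.cons id.tail.head.head).cons id.tail.head.tail.tail).cons nil) nil)
      (hr.comp id.tail)

theorem groups (c : ℕ) (hp : Poly a p) (hn : Poly a n) (hr : Poly a rows) (hu : Poly a u) :
    Poly a fun x => groups c (p x) (n x) (rows x) (u x) :=
  flatMap (F := fun s x => TreeMachine.sel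
      (TreeMachine.mulLe c (TreeMachine.newColumns (n x) s.head (u x)) (p x))
      (.cons s.head .nil) .nil)
    (sel (mulLe c (newColumns (hn.comp id.tail) id.head.head (hu.comp id.tail)) (hp.comp id.tail))
      (id.head.head.cons nil) nil) (selections c hr (ofNat c))

theorem halfAdj (hR : Poly a fun y => R y.head y.tail.head y.tail.tail) (hx : Poly a x)
    (hy : Poly a y) : Poly a fun z => halfAdj (fun v e => R v e z) (x z) (y z) :=
  sel hx.head.head
    (sel hx.head.tail nil (sel hy.head.head (sel hy.head.tail
      (hR.comp (hx.tail.cons (hy.tail.cons id))) nil) nil))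
    (sel hx.head.tail nil (sel hy.head.head (sel hy.head.tail nil yes) (sel hy.head.tail yes nil)))

theorem labelAdj (hR : Poly a fun y => R y.head y.tail.head y.tail.tail) (hx : Poly a x)
    (hy : Poly a y) : Poly a fun z => labelAdj (fun v e => R v e z) (x z) (y z) :=
  sel (hR.halfAdj hx hy) yes (sel (hR.halfAdj hy hx) yes nil)

theorem matrix (hR : Poly a fun y => R y.head y.tail.head y.tail.tail) (hl : Poly a l) :
    Poly a fun z => matrix (fun v e => R v e z) (l z) := by
  refine map (F := fun x z => ofList ((l z).toList.map fun y =>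
    TreeMachine.labelAdj (fun v e => R v e z) x y)) ?_ hl
  refine map (F := fun y z => TreeMachine.labelAdj (fun v e => R v e z.tail) z.head y) ?_
    (hl.comp id.tail)
  exact labelAdj (R := fun v e z => R v e z.tail.tail)
    (hR.comp (id.head.cons (id.tail.head.cons id.tail.tail.tail.tail))) id.tail.head id.head

theorem hostLabels (c : ℕ) (hp : Poly a p) (hn : Poly a n) (hr : Poly a rows) (hu : Poly a u) :
    Poly a fun x => hostLabels c (p x) (n x) (rows x) (u x) :=
  ((nil.cons nil).cons nil).cons
    ((map (F := fun y _ => pendLabel y) ((nil.cons yes).cons id.head) (hp.pendants c)).app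
      ((map (F := fun y _ => groupLabel y) ((yes.cons nil).cons id.head)
        (groups c hp hn hr hu)).app
          (map (F := fun y _ => elemLabel y) ((yes.cons yes).cons id.head) hn.columns)))

theorem patternLabels (c : ℕ) (hp : Poly a p) (hw : Poly a w) :
    Poly a fun x => patternLabels c (p x) (w x) :=
  ((nil.cons nil).cons nil).cons
    ((map (F := fun y _ => pendLabel y) ((nil.cons yes).cons id.head) (hp.pendants c)).app hw)

theorem queryOf (c : ℕ) (hp : Poly a p) (hn : Poly a n) (hr : Poly a rows) (hu : Poly a u)
    (hw : Poly a w) : Poly a fun x => queryOf c (p x) (n x) (rows x) (u x) (w x) := by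
  refine (matrix (R := fun v e x => covRel (u x) v e) ?_ (hostLabels c hp hn hr hu)).cons
    (matrix (R := fun i j _ => lenEq i j) ?_ (patternLabels c hp hw))
  · exact sel (anyBit id.tail.head id.head)
      (sel (anyBit id.tail.head (hu.comp id.tail.tail)) nil yes) nil
  · exact sel (dropLen id.head id.tail.head) nil
      (sel (dropLen id.tail.head id.head) nil yes)

end Poly

/-! ## The search for a pattern tree -/

/-- The initial state of the search: all choices of at most `j` rows, with nothing else. -/
def searchInit (j : ℕ) (y : Data) : Data :=
  .cons (ofList ((selections j y.head.tail.tail.tail y.tail).toList.map fun s =>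
      .cons s.head (.cons .nil (.cons .nil
        (.cons (dropLen (newColumns y.head.tail.tail.head s.head .nil) y.head.tail.head) s.tail)))))
    (.cons .nil y.head)

/-- The question that is asked in a state of the search. -/
def searchQuery (c : ℕ) (x : Data) : Data :=
  .cons x.tail.tail.head
    (queryOf c x.tail.tail.tail.head x.tail.tail.tail.tail.head x.tail.tail.tail.tail.tail
      x.head.head.head x.head.head.tail.tail.head)

/-- The items that result from the addition of a child of the root. -/
def openChild (c : ℕ) (x : Data) : Data :=
  sel (mulLe c yes x.tail.tail.tail.tail)
    (.cons (.cons x.head (.cons (.cons .nil x.tail.head)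
      (.cons (.cons (groupLabel (.cons .nil x.tail.head)) x.tail.tail.head)
        (.cons x.tail.tail.tail.head (dropLen (ofNat c) x.tail.tail.tail.tail))))) .nil) .nil

/-- The items that result from the addition of a leaf. -/
def addLeaf (x : Data) : Data :=
  sel x.tail.head
    (.cons (.cons x.head (.cons x.tail.head
      (.cons (.cons (elemLabel x.tail.head) x.tail.tail.head)
        (.cons x.tail.tail.tail.head.tail x.tail.tail.tail.tail)))) .nil) .nil

/-- The next state of the search. -/
def searchUpdate (c : ℕ) (y : Data) : Data :=
  sel y.tail.head.head.tail.tail.tail.head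
    (.cons (app (openChild c y.tail.head.head) (app (addLeaf y.tail.head.head) y.tail.head.tail))
      y.tail.tail)
    (.cons y.tail.head.tail (.cons (sel y.head yes y.tail.tail.head) y.tail.tail.tail))

/-! ## The search for a smallest subfamily -/

/-- The initial state. -/
def greedyInit (K : ℕ) (x : Data) : Data :=
  .cons (app (.cons .nil x.head) (ofList (x.tail.tail.toList.map fun _ => yes)))
    (.cons (.cons (copies K (.cons .nil (app x.head x.tail.tail))) (.cons x.head x.tail.head))
      (.cons (.cons .nil x.head) (.cons (rev x.tail.tail) .nil)))

/-- The question that is asked. -/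
def greedyQuery (x : Data) : Data :=
  .cons (.cons x.tail.head.head (.cons x.tail.head.tail.head (.cons x.tail.head.tail.tail
      (sel x.head.head x.tail.tail.tail.head.tail x.tail.tail.tail.head))))
    (sel x.head.head x.tail.tail.head x.tail.tail.head.tail)

/-- The next state. -/
def greedyUpdate (y : Data) : Data :=
  .cons y.tail.head.tail (.cons y.tail.tail.head
    (sel y.tail.head.head
      (.cons y.tail.tail.tail.head
        (.cons (sel y.head y.tail.tail.tail.tail.head.tail
            (app y.tail.tail.tail.tail.head.tail (.cons y.tail.tail.tail.tail.head.head .nil)))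
          (.cons (sel y.head .nil yes) y.tail.tail.tail.tail.tail)))
      (.cons (sel y.head y.tail.tail.tail.head.tail y.tail.tail.tail.head)
        y.tail.tail.tail.tail)))

/-- The output. -/
def greedyOutput (x : Data) : Data :=
  sel (dropLen x.tail.head.tail.head x.tail.tail.head) .nil (.cons .nil x.tail.tail.tail.tail)

/-! ### Initialization, questions and updates of both searches take polynomial time -/

namespace Poly

theorem searchInit (j : ℕ) : Poly a (searchInit j) :=
  (map (F := fun s y => .cons s.head (.cons .nil (.cons .nil
      (.cons (TreeMachine.dropLen (TreeMachine.newColumns y.head.tail.tail.head s.head .nil)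
        y.head.tail.head) s.tail))))
    (id.head.head.cons (nil.cons (nil.cons ((dropLen (newColumns id.tail.head.tail.tail.head
      id.head.head nil) id.tail.head.tail.head).cons id.head.tail))))
    (selections j id.head.tail.tail.tail id.tail)).cons (nil.cons id.head)

theorem searchQuery (c : ℕ) : Poly a (searchQuery c) :=
  id.tail.tail.head.cons (queryOf c id.tail.tail.tail.head id.tail.tail.tail.tail.head
    id.tail.tail.tail.tail.tail id.head.head.head id.head.head.tail.tail.head)

theorem openChild (c : ℕ) : Poly a (openChild c) :=
  sel (mulLe c yes id.tail.tail.tail.tail)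
    ((id.head.cons ((nil.cons id.tail.head).cons
      ((((yes.cons nil).cons (nil.cons id.tail.head)).cons id.tail.tail.head).cons
        (id.tail.tail.tail.head.cons (dropLen (ofNat c) id.tail.tail.tail.tail))))).cons nil) nil

theorem addLeaf : Poly a addLeaf :=
  sel id.tail.head
    ((id.head.cons (id.tail.head.cons
      ((((yes.cons yes).cons id.tail.head).cons id.tail.tail.head).cons
        (id.tail.tail.tail.head.tail.cons id.tail.tail.tail.tail)))).cons nil) nil

theorem searchUpdate (c : ℕ) : Poly a (searchUpdate c) :=
  sel id.tail.head.head.tail.tail.tail.head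
    ((app ((openChild c).comp id.tail.head.head)
      (app (addLeaf.comp id.tail.head.head) id.tail.head.tail)).cons id.tail.tail)
    (id.tail.head.tail.cons ((sel id.head yes id.tail.tail.head).cons id.tail.tail.tail))

theorem greedyInit (K : ℕ) : Poly a (greedyInit K) :=
  ((nil.cons id.head).app (map (F := fun _ _ => TreeMachine.yes) yes id.tail.tail)).cons
    (((copies K (nil.cons (id.head.app id.tail.tail))).cons (id.head.cons id.tail.head)).cons
      ((nil.cons id.head).cons (id.tail.tail.rev.cons nil)))

theorem greedyQuery : Poly a greedyQuery :=
  (id.tail.head.head.cons (id.tail.head.tail.head.cons (id.tail.head.tail.tail.cons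
      (sel id.head.head id.tail.tail.tail.head.tail id.tail.tail.tail.head)))).cons
    (sel id.head.head id.tail.tail.head id.tail.tail.head.tail)

theorem greedyUpdate : Poly a greedyUpdate :=
  id.tail.head.tail.cons (id.tail.tail.head.cons
    (sel id.tail.head.head
      (id.tail.tail.tail.head.cons
        ((sel id.head id.tail.tail.tail.tail.head.tail
            (app id.tail.tail.tail.tail.head.tail (id.tail.tail.tail.tail.head.head.cons nil))).cons
          ((sel id.head nil yes).cons id.tail.tail.tail.tail.tail)))
      ((sel id.head id.tail.tail.tail.head.tail id.tail.tail.tail.head).cons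
        id.tail.tail.tail.tail)))

theorem greedyOutput : Poly a greedyOutput :=
  sel (dropLen id.tail.head.tail.head id.tail.tail.head) nil (nil.cons id.tail.tail.tail.tail)

end Poly

end TreeMachine

/-! ### Combinatorics of the pattern trees and host graphs -/

namespace TreeMachine

/-! ## Graphs on labelled vertices -/

theorem labelAdj_eq (R : Data → Data → Data) (x y : Data) :
    labelAdj R x y = .nil ∨ labelAdj R x y = yes := by
  unfold labelAdj
  by_cases h : halfAdj R x y = .nil
  · by_cases h' : halfAdj R y x = .nil
    · simp [h, h']
    · simp [h, sel_of_ne h']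
  · simp [sel_of_ne h]

theorem labelAdj_ne_nil {R : Data → Data → Data} {x y : Data} :
    labelAdj R x y ≠ .nil ↔ halfAdj R x y ≠ .nil ∨ halfAdj R y x ≠ .nil := by
  unfold labelAdj
  by_cases h : halfAdj R x y = .nil
  · by_cases h' : halfAdj R y x = .nil
    · simp [h, h']
    · simp [h, sel_of_ne h', h']
  · simp [sel_of_ne h, h]

theorem halfAdj_self (R : Data → Data → Data) (x : Data) : halfAdj R x x = .nil := by
  unfold halfAdj
  cases x.head.head <;> cases x.head.tail <;> simp

/-- The graph on the indices of a list of labels. -/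
def labelGraph (R : Data → Data → Data) (l : List Data) : SimpleGraph (Fin l.length) where
  Adj i j := labelAdj R l[i] l[j] ≠ .nil
  symm := ⟨fun i j h => by rw [labelAdj_ne_nil] at h ⊢; exact h.symm⟩
  loopless := ⟨fun i h => by simp [labelAdj_ne_nil, halfAdj_self] at h⟩

theorem labelGraph_adj {R : Data → Data → Data} {l : List Data} {i j : Fin l.length} :
    (labelGraph R l).Adj i j ↔ labelAdj R l[i] l[j] ≠ .nil := Iff.rfl

/-- The bridge from the matrix that the program writes to the graph about which the oracle speaks.
The entries have to be literally bits, which is `labelAdj_eq`. -/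
theorem ofGraph_labelGraph (R : Data → Data → Data) (l : List Data) :
    ofGraph (labelGraph R l) = matrix R (ofList l) := by
  have key : ∀ f : Data → Data, List.ofFn (fun i : Fin l.length => f l[i]) = l.map f := fun f =>
    List.ext_getElem (by simp) (by simp)
  unfold ofGraph ofSet matrix
  rw [toList_ofList]
  rw [← key]
  congr 2
  funext i
  rw [← key]
  congr 2
  funext j
  rcases labelAdj_eq R l[i] l[j] with h | h
  · rw [h, ← ofBool_false]
    congr 1
    simpa [labelGraph_adj] using h
  · rw [h, ← ofBool_true]
    congr 1
    have : labelAdj R l[i] l[j] ≠ .nil := by rw [h]; exact yes_ne_nil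
    simpa [labelGraph_adj] using this

section Adjacency

variable (R : Data → Data → Data) (x y : Data)

@[simp] theorem rootLabel_adj_root : labelAdj R rootLabel rootLabel = .nil := rfl
@[simp] theorem rootLabel_adj_pend : labelAdj R rootLabel (pendLabel x) = yes := rfl
@[simp] theorem rootLabel_adj_group : labelAdj R rootLabel (groupLabel x) = yes := rfl
@[simp] theorem rootLabel_adj_elem : labelAdj R rootLabel (elemLabel x) = .nil := rfl
@[simp] theorem pendLabel_adj_root : labelAdj R (pendLabel x) rootLabel = yes := rfl
@[simp] theorem pendLabel_adj_pend : labelAdj R (pendLabel x) (pendLabel y) = .nil := rfl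
@[simp] theorem pendLabel_adj_group : labelAdj R (pendLabel x) (groupLabel y) = .nil := rfl
@[simp] theorem pendLabel_adj_elem : labelAdj R (pendLabel x) (elemLabel y) = .nil := rfl
@[simp] theorem groupLabel_adj_root : labelAdj R (groupLabel x) rootLabel = yes := rfl
@[simp] theorem groupLabel_adj_pend : labelAdj R (groupLabel x) (pendLabel y) = .nil := rfl
@[simp] theorem groupLabel_adj_group : labelAdj R (groupLabel x) (groupLabel y) = .nil := rfl
@[simp] theorem elemLabel_adj_root : labelAdj R (elemLabel x) rootLabel = .nil := rfl
@[simp] theorem elemLabel_adj_pend : labelAdj R (elemLabel x) (pendLabel y) = .nil := rfl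
@[simp] theorem elemLabel_adj_elem : labelAdj R (elemLabel x) (elemLabel y) = .nil := rfl

variable {R x y}

theorem groupLabel_adj_elem : labelAdj R (groupLabel x) (elemLabel y) ≠ .nil ↔ R x y ≠ .nil := by
  rw [labelAdj_ne_nil]
  simp [halfAdj, groupLabel, elemLabel, yes]

theorem elemLabel_adj_group : labelAdj R (elemLabel y) (groupLabel x) ≠ .nil ↔ R x y ≠ .nil := by
  rw [labelAdj_ne_nil]
  simp [halfAdj, groupLabel, elemLabel, yes]

@[simp] theorem pendLabel_inj : pendLabel x = pendLabel y ↔ x = y := by simp [pendLabel]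
@[simp] theorem groupLabel_inj : groupLabel x = groupLabel y ↔ x = y := by simp [groupLabel]
@[simp] theorem elemLabel_inj : elemLabel x = elemLabel y ↔ x = y := by simp [elemLabel]
@[simp] theorem rootLabel_ne_pend : rootLabel ≠ pendLabel x := by simp [rootLabel, pendLabel, yes]
@[simp] theorem rootLabel_ne_group : rootLabel ≠ groupLabel x := by
  simp [rootLabel, groupLabel, yes]
@[simp] theorem rootLabel_ne_elem : rootLabel ≠ elemLabel x := by simp [rootLabel, elemLabel, yes]
@[simp] theorem pendLabel_ne_group : pendLabel x ≠ groupLabel y := by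
  simp [pendLabel, groupLabel, yes]
@[simp] theorem pendLabel_ne_elem : pendLabel x ≠ elemLabel y := by
  simp [pendLabel, elemLabel, yes]
@[simp] theorem groupLabel_ne_elem : groupLabel x ≠ elemLabel y := by
  simp [groupLabel, elemLabel, yes]
@[simp] theorem pendLabel_ne_root : pendLabel x ≠ rootLabel := rootLabel_ne_pend.symm
@[simp] theorem groupLabel_ne_root : groupLabel x ≠ rootLabel := rootLabel_ne_group.symm
@[simp] theorem elemLabel_ne_root : elemLabel x ≠ rootLabel := rootLabel_ne_elem.symm
@[simp] theorem groupLabel_ne_pend : groupLabel x ≠ pendLabel y := pendLabel_ne_group.symm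
@[simp] theorem elemLabel_ne_pend : elemLabel x ≠ pendLabel y := pendLabel_ne_elem.symm
@[simp] theorem elemLabel_ne_group : elemLabel x ≠ groupLabel y := groupLabel_ne_elem.symm

end Adjacency

/-- Vertices are positions in a list of labels, and labels may repeat: the leaves of a child share
theirs, and the same group may be listed twice. The hypothesis says that labels with property `p` do
not repeat, so that they identify a vertex. -/
theorem eq_of_getElem_eq {α : Type*} {l : List α} {p : α → Prop}
    (h : l.Pairwise fun x y => x = y → ¬ p x) {i j : Fin l.length} (hij : l[i] = l[j])
    (hp : p l[i]) : i = j := by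
  rw [List.pairwise_iff_getElem] at h
  rcases lt_trichotomy i j with hlt | rfl | hlt
  · exact (h i j i.2 j.2 hlt hij hp).elim
  · rfl
  · exact (h j i j.2 i.2 hlt hij.symm (hij ▸ hp)).elim

open Classical in
theorem card_filter_getElem {α : Type*} (l : List α) (p : α → Prop) :
    (Finset.univ.filter fun i : Fin l.length => p l[i]).card = l.countP fun x => decide (p x) := by
  induction l with
  | nil => simp
  | cons x l ih =>
    refine (Fin.card_filter_univ_succ (n := l.length) fun i => p (x :: l)[i]).trans ?_
    rw [List.countP_cons, ← ih]
    by_cases h : p x <;> simp [h]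

/-! ## The pattern tree and the host graph -/

/-- The labels of the children with the given numbers of leaves, and of their leaves. -/
def branchLabels : List ℕ → List Data
  | [] => []
  | s :: σ => List.replicate s (elemLabel (ofNat (σ.length + 1))) ++
      groupLabel (ofNat (σ.length + 1)) :: branchLabels σ

/-- The labels of the pattern tree. -/
def patternList (pds : List Data) (σ : List ℕ) : List Data :=
  rootLabel :: (pds.map pendLabel ++ branchLabels σ)

/-- The labels of the host graph. -/
def hostList (pds gs es : List Data) : List Data :=
  rootLabel :: (pds.map pendLabel ++ (gs.map groupLabel ++ es.map elemLabel))

theorem lenEq_ofNat {i j : ℕ} : lenEq (ofNat i) (ofNat j) ≠ .nil ↔ i = j := by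
  unfold lenEq
  rw [dropLen_ofNat, dropLen_ofNat]
  rcases lt_trichotomy i j with h | rfl | h
  · rw [sel_of_ne (by simp; omega)]; simp; omega
  · simp
  · rw [show j - i = 0 by omega, ofNat_zero, sel_nil, sel_of_ne (by simp; omega)]; simp; omega

theorem length_branchLabels (σ : List ℕ) : (branchLabels σ).length = σ.sum + σ.length := by
  induction σ with
  | nil => rfl
  | cons s σ ih => simp [branchLabels, ih]; omega

/-- The bound `j ≤ σ.length` separates a newly prepended child, which has number `σ.length + 1`,
from all earlier ones. -/
theorem mem_branchLabels {σ : List ℕ} {x : Data} (h : x ∈ branchLabels σ) :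
    ∃ j, 1 ≤ j ∧ j ≤ σ.length ∧ (x = groupLabel (ofNat j) ∨
      x = elemLabel (ofNat j) ∧ groupLabel (ofNat j) ∈ branchLabels σ) := by
  induction σ with
  | nil => simp [branchLabels] at h
  | cons s σ ih =>
    simp only [branchLabels, List.mem_append, List.mem_replicate, List.mem_cons] at h
    rcases h with ⟨-, rfl⟩ | rfl | h
    · exact ⟨σ.length + 1, by omega, by simp, Or.inr ⟨rfl, by simp [branchLabels]⟩⟩
    · exact ⟨σ.length + 1, by omega, by simp, Or.inl rfl⟩
    · obtain ⟨j, h1, h2, h3⟩ := ih h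
      refine ⟨j, h1, by simp; omega, h3.imp id fun h3 => ⟨h3.1, ?_⟩⟩
      simp [branchLabels, h3.2]

/-- A label of a group. -/
def IsGroup (x : Data) : Prop := ∃ y, x = groupLabel y

/-- A label of an element. -/
def IsElem (x : Data) : Prop := ∃ y, x = elemLabel y

@[simp] theorem isElem_elem (y : Data) : IsElem (elemLabel y) := ⟨y, rfl⟩
@[simp] theorem not_isElem_group (y : Data) : ¬ IsElem (groupLabel y) := by simp [IsElem]
@[simp] theorem not_isElem_pend (y : Data) : ¬ IsElem (pendLabel y) := by simp [IsElem]
@[simp] theorem not_isElem_root : ¬ IsElem rootLabel := by simp [IsElem]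
@[simp] theorem isGroup_group (y : Data) : IsGroup (groupLabel y) := ⟨y, rfl⟩
@[simp] theorem not_isGroup_elem (y : Data) : ¬ IsGroup (elemLabel y) := by simp [IsGroup]
@[simp] theorem not_isGroup_pend (y : Data) : ¬ IsGroup (pendLabel y) := by simp [IsGroup]
@[simp] theorem not_isGroup_root : ¬ IsGroup rootLabel := by simp [IsGroup]

open Classical in
theorem countP_isElem (σ : List ℕ) (pds : List Data) :
    (patternList pds σ).countP (fun x => decide (IsElem x)) = σ.sum := by
  have h : (branchLabels σ).countP (fun x => decide (IsElem x)) = σ.sum := by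
    induction σ with
    | nil => rfl
    | cons s σ ih =>
      simp [branchLabels, List.countP_replicate, ih]
  simp [patternList, h, List.countP_map, Function.comp_def]

open Classical in
theorem countP_isGroup (σ : List ℕ) (pds : List Data) :
    (patternList pds σ).countP (fun x => decide (IsGroup x)) = σ.length := by
  have h : (branchLabels σ).countP (fun x => decide (IsGroup x)) = σ.length := by
    induction σ with
    | nil => rfl
    | cons s σ ih =>
      simp [branchLabels, List.countP_replicate, ih]
  simp [patternList, h, List.countP_map, Function.comp_def]

theorem pairwise_branchLabels (σ : List ℕ) :
    (branchLabels σ).Pairwise fun x y => x = y → ¬ IsGroup x := by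
  induction σ with
  | nil => exact List.Pairwise.nil
  | cons s σ ih =>
    rw [branchLabels, List.pairwise_append, List.pairwise_cons]
    refine ⟨?_, ⟨fun x hx h => ?_, ih⟩, ?_⟩
    · exact List.pairwise_replicate.2 (Or.inr (by simp [IsGroup]))
    · obtain ⟨j, -, h1, h2 | h2⟩ := mem_branchLabels hx
      · rw [← h, groupLabel_inj] at h2
        have := ofNat_injective h2
        omega
      · rw [← h] at h2; simp at h2
    · intro x hx y _ _
      rw [List.mem_replicate] at hx
      simp [hx.2, IsGroup]

theorem pairwise_patternList (pds : List Data) (σ : List ℕ) :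
    (patternList pds σ).Pairwise fun x y => x = y → ¬ (x = rootLabel ∨ IsGroup x) := by
  rw [patternList, List.pairwise_cons, List.pairwise_append]
  have hb : ∀ x ∈ branchLabels σ, x ≠ rootLabel := fun x hx => by
    obtain ⟨j, -, -, rfl | ⟨rfl, -⟩⟩ := mem_branchLabels hx <;> simp
  refine ⟨fun x hx h => ?_, ?_, ?_, ?_⟩
  · rw [List.mem_append, List.mem_map] at hx
    rcases hx with ⟨y, -, rfl⟩ | hx
    · simp at h
    · exact (hb x hx h.symm).elim
  · rw [List.pairwise_map]
    exact List.pairwise_of_forall fun x y => by simp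
  · exact (pairwise_branchLabels σ).imp_of_mem fun hx _ h h' => by
      simpa [hb _ hx] using h h'
  · intro x hx y _ _
    rw [List.mem_map] at hx
    obtain ⟨z, -, rfl⟩ := hx
    simp [IsGroup]

theorem mem_patternList {pds : List Data} {σ : List ℕ} {x : Data} (h : x ∈ patternList pds σ) :
    x = rootLabel ∨ (∃ y, x = pendLabel y) ∨ (∃ j, x = groupLabel (ofNat j)) ∨
      ∃ j, x = elemLabel (ofNat j) ∧ groupLabel (ofNat j) ∈ patternList pds σ := by
  rw [patternList, List.mem_cons, List.mem_append, List.mem_map] at h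
  rcases h with h | ⟨y, -, rfl⟩ | h
  · exact Or.inl h
  · exact Or.inr (Or.inl ⟨y, rfl⟩)
  · obtain ⟨j, -, -, h1 | ⟨h1, h2⟩⟩ := mem_branchLabels h
    · exact Or.inr (Or.inr (Or.inl ⟨j, h1⟩))
    · exact Or.inr (Or.inr (Or.inr ⟨j, h1, by simp [patternList, h2]⟩))

/-- Every vertex other than the root has a parent: the child with its number for a leaf, the root
for all others. The edges to parents connect the graph, and there are no other edges, so there are
fewer edges than vertices. -/
theorem isTree_pattern (pds : List Data) (σ : List ℕ) :
    (labelGraph lenEq (patternList pds σ)).IsTree := by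
  set l := patternList pds σ with hl
  have hpos : 0 < l.length := by simp [hl, patternList]
  let r : Fin l.length := ⟨0, hpos⟩
  have hr : l[r] = rootLabel := by simp [r, hl, patternList]
  have huniq : ∀ {i j : Fin l.length}, l[i] = l[j] → (l[i] = rootLabel ∨ IsGroup l[i]) → i = j :=
    fun h h' => eq_of_getElem_eq (pairwise_patternList pds σ) h h'
  have hcases := fun i : Fin l.length => mem_patternList (pds := pds) (σ := σ) (x := l[i])
    (List.getElem_mem _)
  have hpar : ∀ i : Fin l.length, ∃ q : Fin l.length, (∀ j, l[i] = elemLabel j →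
      l[q] = groupLabel j) ∧ ((∀ j, l[i] ≠ elemLabel j) → q = r) := by
    intro i
    by_cases h : ∃ j, l[i] = elemLabel j
    · obtain ⟨j, hj⟩ := h
      have : groupLabel j ∈ l := by
        rcases hcases i with h | ⟨y, h⟩ | ⟨j', h⟩ | ⟨j', h, h'⟩
        · simp [h] at hj
        · simp [h] at hj
        · simp [h] at hj
        · rw [h, elemLabel_inj] at hj
          exact hj ▸ h'
      obtain ⟨q, hq, hq'⟩ := List.mem_iff_getElem.1 this
      refine ⟨⟨q, hq⟩, fun j' hj' => ?_, fun h => (h j hj).elim⟩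
      rw [hj, elemLabel_inj] at hj'
      subst hj'
      exact hq'
    · push Not at h
      exact ⟨r, fun j hj => (h j hj).elim, fun _ => rfl⟩
  choose par hpar1 hpar2 using hpar
  have hadj : ∀ i, i ≠ r → (labelGraph lenEq l).Adj i (par i) := by
    intro i hi
    rw [labelGraph_adj]
    rcases hcases i with h | ⟨y, h⟩ | ⟨j, h⟩ | ⟨j, h, -⟩
    · exact (hi (huniq (h.trans hr.symm) (Or.inl h))).elim
    · rw [hpar2 i (by simp [h]), hr, h]; simp
    · rw [hpar2 i (by simp [h]), hr, h]; simp
    · rw [hpar1 i _ h, h, elemLabel_adj_group, lenEq_ofNat]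
  have hroot : ∀ i, (labelGraph lenEq l).Reachable i r := by
    have h1 : ∀ i, (∀ j, l[i] ≠ elemLabel j) → (labelGraph lenEq l).Reachable i r := by
      intro i h
      by_cases hi : i = r
      · rw [hi]
      · have := hadj i hi
        rw [hpar2 i h] at this
        exact this.reachable
    intro i
    by_cases h : ∃ j, l[i] = elemLabel j
    · obtain ⟨j, hj⟩ := h
      have hi : i ≠ r := by rintro rfl; rw [hr] at hj; simp at hj
      exact (hadj i hi).reachable.trans (h1 _ (by simp [hpar1 i j hj]))
    · push Not at h
      exact h1 i h
  have hconn : (labelGraph lenEq l).Connected :=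
    have : Nonempty (Fin l.length) := ⟨r⟩
    ⟨fun i j => (hroot i).trans (hroot j).symm⟩
  rw [SimpleGraph.isTree_iff_connected_and_card]
  refine ⟨hconn, le_antisymm ?_ hconn.card_vert_le_card_edgeSet_add_one⟩
  -- The relation `halfAdj` is directed away from the root, hence from parents to their children.
  have hhalf : ∀ i j, halfAdj lenEq l[i] l[j] ≠ .nil → j ≠ r ∧ i = par j := by
    intro i j h
    have h' : labelAdj lenEq l[i] l[j] ≠ .nil := labelAdj_ne_nil.2 (Or.inl h)
    rcases hcases i with hi | ⟨y, hi⟩ | ⟨m, hi⟩ | ⟨m, hi, -⟩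
    · have hir : i = r := huniq (hi.trans hr.symm) (Or.inl hi)
      rw [hi] at h'
      refine ⟨?_, ?_⟩
      · rintro rfl; rw [hr] at h'; simp at h'
      · rw [hir, hpar2 j]
        rintro m hm; rw [hm] at h'; simp at h'
    · rw [hi] at h; simp [halfAdj, pendLabel, yes] at h
    · rcases hcases j with hj | ⟨y, hj⟩ | ⟨m', hj⟩ | ⟨m', hj, -⟩
      · rw [hi, hj] at h; simp [halfAdj, groupLabel, rootLabel, yes] at h
      · rw [hi, hj] at h'; simp at h'
      · rw [hi, hj] at h'; simp at h'
      · rw [hi, hj, groupLabel_adj_elem, lenEq_ofNat] at h'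
        subst h'
        refine ⟨?_, huniq (hi.trans (hpar1 j _ hj).symm) (Or.inr ⟨_, hi⟩)⟩
        rintro rfl; rw [hr] at hj; simp at hj
    · rw [hi] at h; simp [halfAdj, elemLabel, yes] at h
  have hsurj : Function.Surjective fun i : {i : Fin l.length // i ≠ r} =>
      (⟨s(i.1, par i.1), hadj i.1 i.2⟩ : (labelGraph lenEq l).edgeSet) := by
    rintro ⟨e, he⟩
    induction e using Sym2.ind with
    | _ x y =>
      rw [SimpleGraph.mem_edgeSet, labelGraph_adj, labelAdj_ne_nil] at he
      rcases he with he | he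
      · obtain ⟨h1, h2⟩ := hhalf x y he
        exact ⟨⟨y, h1⟩, Subtype.ext (by simp [h2, Sym2.eq_swap])⟩
      · obtain ⟨h1, h2⟩ := hhalf y x he
        exact ⟨⟨x, h1⟩, Subtype.ext (by simp [h2])⟩
  have h1 : Nat.card (labelGraph lenEq l).edgeSet ≤ _ := Nat.card_le_card_of_surjective _ hsurj
  have h2 : Nat.card {i : Fin l.length // i ≠ r} = l.length - 1 := by
    rw [Nat.card_eq_fintype_card, Fintype.card_subtype_compl]
    simp
  rw [Nat.card_eq_fintype_card (α := Fin l.length), Fintype.card_fin]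
  omega

end TreeMachine

namespace TreeMachine

/-! ## Copies of the pattern tree in the host graph -/

theorem mem_hostList {pds gs es : List Data} {x : Data} (h : x ∈ hostList pds gs es) :
    x = rootLabel ∨ (∃ y, x = pendLabel y) ∨ (∃ g ∈ gs, x = groupLabel g) ∨
      ∃ e ∈ es, x = elemLabel e := by
  simp only [hostList, List.mem_cons, List.mem_append, List.mem_map] at h
  rcases h with h | ⟨y, -, rfl⟩ | ⟨g, hg, rfl⟩ | ⟨e, he, rfl⟩
  · exact Or.inl h
  · exact Or.inr (Or.inl ⟨y, rfl⟩)
  · exact Or.inr (Or.inr (Or.inl ⟨g, hg, rfl⟩))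
  · exact Or.inr (Or.inr (Or.inr ⟨e, he, rfl⟩))

theorem pairwise_hostList (pds gs : List Data) {es : List Data} (hes : es.Nodup) :
    (hostList pds gs es).Pairwise fun x y => x = y → ¬ (x = rootLabel ∨ IsElem x) := by
  simp only [hostList, List.pairwise_cons, List.pairwise_append, List.pairwise_map]
  refine ⟨fun x hx h => ?_, ?_, ⟨?_, ?_, ?_⟩, ?_⟩
  · simp only [List.mem_append, List.mem_map] at hx
    rcases hx with ⟨y, -, rfl⟩ | ⟨g, -, rfl⟩ | ⟨e, -, rfl⟩ <;> simp at h
  · exact List.pairwise_of_forall fun x y => by simp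
  · exact List.pairwise_of_forall fun x y => by simp
  · exact hes.imp fun h h' => (h (elemLabel_inj.1 h')).elim
  · intro x hx y _ _
    obtain ⟨z, -, rfl⟩ := List.mem_map.1 hx
    simp
  · intro x hx y _ _
    obtain ⟨z, -, rfl⟩ := List.mem_map.1 hx
    simp

open Classical in
/-- A copy of the pattern tree in the host graph yields few groups that cover many elements. -/
theorem exists_groups_of_isContained {R : Data → Data → Data} {pds gs es : List Data} {σ : List ℕ}
    (hes : es.Nodup) (hpds : 2 ≤ pds.length)
    (hdeg : ∀ g ∈ gs, (es.toFinset.filter fun e => R g e ≠ .nil).card + 1 < pds.length)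
    (h : (labelGraph lenEq (patternList pds σ)).IsContained (labelGraph R (hostList pds gs es))) :
    ∃ gl : List Data, gl.length ≤ σ.length ∧ (∀ g ∈ gl, g ∈ gs) ∧
      σ.sum ≤ (es.toFinset.filter fun e => ∃ g ∈ gl, R g e ≠ .nil).card := by
  obtain ⟨φ⟩ := h
  set l := patternList pds σ with hl
  set l' := hostList pds gs es with hl'
  have hφ : Function.Injective φ := φ.injective
  have hadj : ∀ {i j : Fin l.length}, labelAdj lenEq l[i] l[j] ≠ .nil →
      labelAdj R l'[φ i] l'[φ j] ≠ .nil := fun {i j} h => φ.toHom.map_adj (v := i) (w := j) h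
  have huniq : ∀ {i j : Fin l'.length}, l'[i] = l'[j] → (l'[i] = rootLabel ∨ IsElem l'[i]) →
      i = j := fun h h' => eq_of_getElem_eq (pairwise_hostList pds gs hes) h h'
  have hcases := fun i : Fin l'.length => mem_hostList (pds := pds) (gs := gs) (es := es)
    (x := l'[i]) (List.getElem_mem _)
  have hpos : 0 < l.length := by simp [hl, patternList]
  let r : Fin l.length := ⟨0, hpos⟩
  have hr : l[r] = rootLabel := by simp [r, hl, patternList]
  have hpend : ∀ d : Fin pds.length, ∃ i : Fin l.length, i.1 = d.1 + 1 ∧ ∃ y,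
      l[i] = pendLabel y := by
    intro d
    have : d.1 + 1 < l.length := by simp [hl, patternList]; omega
    refine ⟨⟨d.1 + 1, this⟩, rfl, pds[d], ?_⟩
    simp [hl, patternList]
  choose pe hpe1 hpe2 using hpend
  have hpeinj : Function.Injective pe := fun d d' h => by
    have h1 := hpe1 d
    have h2 := hpe1 d'
    rw [h] at h1
    exact Fin.ext (by omega)
  have hpeadj : ∀ d, labelAdj R l'[φ r] l'[φ (pe d)] ≠ .nil := fun d => by
    obtain ⟨y, hy⟩ := hpe2 d
    exact hadj (by rw [hr, hy]; simp)
  -- The image of the root is the root or an element.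
  have hroot : l'[φ r] = rootLabel ∨ ∃ e ∈ es, l'[φ r] = elemLabel e := by
    rcases hcases (φ r) with h | ⟨y, h⟩ | ⟨g, hg, h⟩ | h
    · exact Or.inl h
    · exfalso
      -- A pendant vertex of the host has the root as its only neighbour, which leaves no room for
      -- two pendant vertices of the pattern.
      have h1 : ∀ d, l'[φ (pe d)] = rootLabel := by
        intro d
        have h2 := hpeadj d
        rw [h] at h2
        rcases hcases (φ (pe d)) with h3 | ⟨y, h3⟩ | ⟨g, hg, h3⟩ | ⟨e, he, h3⟩
        · exact h3
        all_goals rw [h3] at h2; simp at h2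
      have h2 := hpeinj (hφ (huniq ((h1 ⟨0, by omega⟩).trans (h1 ⟨1, by omega⟩).symm)
        (Or.inl (h1 _))))
      simp at h2
    · exfalso
      -- The neighbours of a group are the root and its elements, and by `hdeg` these are too few
      -- for the pendant vertices of the pattern.
      have h1 : ∀ d, l'[φ (pe d)] ∈ insert rootLabel
          ((es.toFinset.filter fun e => R g e ≠ .nil).image elemLabel) := by
        intro d
        have h2 := hpeadj d
        rw [h] at h2
        rcases hcases (φ (pe d)) with h3 | ⟨y, h3⟩ | ⟨g', hg', h3⟩ | ⟨e, he, h3⟩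
        · simp [h3]
        · rw [h3] at h2; simp at h2
        · rw [h3] at h2; simp at h2
        · rw [h3, groupLabel_adj_elem] at h2
          rw [h3]
          exact Finset.mem_insert_of_mem (Finset.mem_image_of_mem _ (by simp [he, h2]))
      have h2 := Finset.card_le_card_of_injOn (s := Finset.univ) (fun d => l'[φ (pe d)])
        (fun d _ => h1 d) (fun d _ d' _ hdd => by
          refine hpeinj (hφ (huniq hdd ?_))
          have := h1 d
          rw [Finset.mem_insert, Finset.mem_image] at this
          exact this.imp id fun ⟨e, _, he⟩ => ⟨e, he.symm⟩)
      rw [Finset.card_univ, Fintype.card_fin] at h2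
      have h3 := Finset.card_insert_le rootLabel
        ((es.toFinset.filter fun e => R g e ≠ .nil).image elemLabel)
      have h4 := Finset.card_image_le (s := es.toFinset.filter fun e => R g e ≠ .nil)
        (f := elemLabel)
      have h5 := hdeg g hg
      omega
    · exact Or.inr h
  -- The children go to pendant vertices or to groups, the latter are the groups that we take.
  let I : Finset (Fin l.length) := Finset.univ.filter fun i => IsGroup l[i] ∧ IsGroup l'[φ i]
  let gl : List Data := (I.image fun i => l'[φ i].tail).toList
  have hgl : ∀ i, IsGroup l[i] → ∀ g, l'[φ i] = groupLabel g → g ∈ gl := by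
    intro i hi g hg
    rw [Finset.mem_toList, Finset.mem_image]
    exact ⟨i, by simp only [I, Finset.mem_filter, Finset.mem_univ, true_and]
                 exact ⟨hi, g, hg⟩, by rw [hg]; rfl⟩
  refine ⟨gl, ?_, ?_, ?_⟩
  · rw [Finset.length_toList, ← countP_isGroup σ pds, ← card_filter_getElem]
    refine Finset.card_image_le.trans (Finset.card_le_card fun i hi => ?_)
    simp only [I, Finset.mem_filter, Finset.mem_univ, true_and] at hi ⊢
    exact hi.1
  · intro g hg
    rw [Finset.mem_toList, Finset.mem_image] at hg
    obtain ⟨i, hi, rfl⟩ := hg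
    simp only [I, Finset.mem_filter, Finset.mem_univ, true_and] at hi
    obtain ⟨g', hg'⟩ := hi.2
    rcases hcases (φ i) with h3 | ⟨y, h3⟩ | ⟨g, hg, h3⟩ | ⟨e, he, h3⟩
    · rw [h3] at hg'; simp at hg'
    · rw [h3] at hg'; simp at hg'
    · rw [h3]; exact hg
    · rw [h3] at hg'; simp at hg'
  -- The parent of a leaf has two neighbours, the root and the leaf, whose images differ; this
  -- excludes a pendant vertex as its image, and only a group remains. The leaf goes to an element
  -- of this group or to the root of the host. The latter requires that the root of the pattern sits
  -- on an element, which then belongs to the same group.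
  have hleaf : ∀ i, IsElem l[i] → ∃ g ∈ gl, (∃ e ∈ es, l'[φ i] = elemLabel e ∧ R g e ≠ .nil) ∨
      (l'[φ i] = rootLabel ∧ ∃ e ∈ es, l'[φ r] = elemLabel e ∧ R g e ≠ .nil) := by
    intro i hi
    have hir : i ≠ r := by rintro rfl; rw [hr] at hi; simp at hi
    have hjx : ∃ j, l[i] = elemLabel (ofNat j) ∧ groupLabel (ofNat j) ∈ l := by
      obtain ⟨y, hy⟩ := hi
      rcases mem_patternList (pds := pds) (σ := σ) (x := l[i]) (List.getElem_mem _) with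
        h | ⟨y, h⟩ | ⟨j', h⟩ | h
      · rw [h] at hy; simp at hy
      · rw [h] at hy; simp at hy
      · rw [h] at hy; simp at hy
      · exact h
    obtain ⟨j, hj, hj'⟩ := hjx
    obtain ⟨x, hx, hx'⟩ := List.mem_iff_getElem.1 hj'
    let x' : Fin l.length := ⟨x, hx⟩
    have hx' : l[x'] = groupLabel (ofNat j) := hx'
    have h1 : labelAdj R l'[φ r] l'[φ x'] ≠ .nil := hadj (by rw [hr, hx']; simp)
    have h2 : labelAdj R l'[φ x'] l'[φ i] ≠ .nil :=
      hadj (by rw [hx', hj, groupLabel_adj_elem, lenEq_ofNat])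
    have hgx : ∃ g ∈ gs, l'[φ x'] = groupLabel g := by
      rcases hcases (φ x') with h3 | ⟨y, h3⟩ | ⟨g, hg, h3⟩ | ⟨e, he, h3⟩
      · rw [h3] at h1
        rcases hroot with h | ⟨e, -, h⟩ <;> rw [h] at h1 <;> simp at h1
      · exfalso
        rw [h3] at h1 h2
        rcases hroot with h | ⟨e, -, h⟩
        · rcases hcases (φ i) with h4 | ⟨y, h4⟩ | ⟨g, hg, h4⟩ | ⟨e, he, h4⟩
          · exact hir (hφ (huniq (h4.trans h.symm) (Or.inl h4)))
          all_goals rw [h4] at h2; simp at h2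
        · rw [h] at h1; simp at h1
      · exact ⟨g, hg, h3⟩
      · rw [h3] at h1
        rcases hroot with h | ⟨e, -, h⟩ <;> rw [h] at h1 <;> simp at h1
    obtain ⟨g, hg, hgx⟩ := hgx
    refine ⟨g, hgl x' ⟨_, hx'⟩ g hgx, ?_⟩
    rw [hgx] at h1 h2
    rcases hcases (φ i) with h4 | ⟨y, h4⟩ | ⟨g', -, h4⟩ | ⟨e, he, h4⟩
    · refine Or.inr ⟨h4, ?_⟩
      rcases hroot with h | ⟨e, he, h⟩
      · exact (hir (hφ (huniq (h4.trans h.symm) (Or.inl h4)))).elim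
      · rw [h, elemLabel_adj_group] at h1
        exact ⟨e, he, h, h1⟩
    · rw [h4] at h2; simp at h2
    · rw [h4] at h2; simp at h2
    · rw [h4, groupLabel_adj_elem] at h2
      exact Or.inl ⟨e, he, h4, h2⟩
  rw [← countP_isElem σ pds, ← card_filter_getElem]
  -- The exchange: the leaf on the root of the host, if there is one, is charged to the element
  -- under the root of the pattern. By injectivity of the copy no other leaf occupies that element,
  -- so the map to covered elements stays injective.
  refine Finset.card_le_card_of_injOn
    (fun i => if l'[φ i] = rootLabel then l'[φ r].tail else l'[φ i].tail) ?_ ?_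
  · intro i hi
    simp only [Finset.coe_filter, Finset.mem_univ, true_and, Set.mem_ofPred_eq] at hi
    obtain ⟨g, hg, ⟨e, he, h1, h2⟩ | ⟨h1, e, he, h2, h3⟩⟩ := hleaf i hi
    · simp only [h1, elemLabel_ne_root, if_false]
      simpa [elemLabel, he] using ⟨g, hg, h2⟩
    · simp only [h1, h2, if_true]
      simpa [elemLabel, he] using ⟨g, hg, h3⟩
  · intro i hi j hj hij
    simp only [Finset.coe_filter, Finset.mem_univ, true_and, Set.mem_ofPred_eq] at hi hj
    have hir : i ≠ r := by rintro rfl; rw [hr] at hi; simp at hi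
    have hjr : j ≠ r := by rintro rfl; rw [hr] at hj; simp at hj
    obtain ⟨g, hg, ⟨e, he, h1, h2⟩ | ⟨h1, e, he, h2, h3⟩⟩ := hleaf i hi <;>
    obtain ⟨g', hg', ⟨e', he', h1', h2'⟩ | ⟨h1', e', he', h2', h3'⟩⟩ := hleaf j hj
    · simp only [h1, h1', elemLabel_ne_root, if_false] at hij
      have : e = e' := hij
      subst this
      exact hφ (huniq (h1.trans h1'.symm) (Or.inr ⟨e, h1⟩))
    · simp only [h1, h1', h2', elemLabel_ne_root, if_false, if_true] at hij
      have : e = e' := hij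
      subst this
      exact (hir (hφ (huniq (h1.trans h2'.symm) (Or.inr ⟨e, h1⟩)))).elim
    · simp only [h1, h1', h2, elemLabel_ne_root, if_false, if_true] at hij
      have : e = e' := hij
      subst this
      exact (hjr (hφ (huniq (h1'.trans h2.symm) (Or.inr ⟨e, h1'⟩)))).elim
    · exact hφ (huniq (h1.trans h1'.symm) (Or.inl h1))

/-- A list of pairs of labels describes a copy of a graph in another one. -/
theorem isContained_of_pairs {R R' : Data → Data → Data} {l' : List Data} (z : List (Data × Data))
    (hmem : ∀ q ∈ z, q.2 ∈ l') (hnd : (z.map Prod.snd).Nodup)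
    (hadj : ∀ q ∈ z, ∀ q' ∈ z, labelAdj R q.1 q'.1 ≠ .nil → labelAdj R' q.2 q'.2 ≠ .nil) :
    (labelGraph R (z.map Prod.fst)).IsContained (labelGraph R' l') := by
  have h : ∀ i : Fin (z.map Prod.fst).length, ∃ j : Fin l'.length,
      l'[j] = (z[i.1]'(by simpa using i.2)).2 := by
    intro i
    obtain ⟨j, hj, hj'⟩ := List.mem_iff_getElem.1 (hmem _ (List.getElem_mem (l := z)
      (n := i.1) (by simpa using i.2)))
    exact ⟨⟨j, hj⟩, hj'⟩
  choose f hf using h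
  refine ⟨⟨⟨f, fun {i j} hij => ?_⟩, fun i j hij => ?_⟩⟩
  · rw [labelGraph_adj] at hij ⊢
    rw [hf, hf]
    refine hadj _ (List.getElem_mem _) _ (List.getElem_mem _) ?_
    simpa using hij
  · have h1 := hf i
    have h2 := hf j
    have hij : f i = f j := hij
    rw [hij, h2] at h1
    have hi : i.1 < (z.map Prod.snd).length := by simpa using i.2
    have hj : j.1 < (z.map Prod.snd).length := by simpa using j.2
    have h3 : (z.map Prod.snd)[i.1] = (z.map Prod.snd)[j.1] := by simpa using h1.symm
    exact Fin.ext ((hnd.getElem_inj_iff).1 h3)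

/-- The children and leaves of the pattern tree, with the groups and elements to which they are
mapped. -/
def branchPairs : List (Data × List Data) → List (Data × Data)
  | [] => []
  | q :: parts => q.2.map (fun e => (elemLabel (ofNat (parts.length + 1)), elemLabel e)) ++
      (groupLabel (ofNat (parts.length + 1)), groupLabel q.1) :: branchPairs parts

theorem map_fst_branchPairs (parts : List (Data × List Data)) :
    (branchPairs parts).map Prod.fst = branchLabels (parts.map fun q => q.2.length) := by
  induction parts with
  | nil => rfl
  | cons q parts ih =>
    simp [branchPairs, branchLabels, ih, Function.comp_def, List.map_const']

theorem mem_branchPairs {parts : List (Data × List Data)} {q : Data × Data}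
    (h : q ∈ branchPairs parts) : ∃ j ≤ parts.length, ∃ b ∈ parts,
      q = (groupLabel (ofNat j), groupLabel b.1) ∨
        ∃ e ∈ b.2, q = (elemLabel (ofNat j), elemLabel e) := by
  induction parts with
  | nil => simp [branchPairs] at h
  | cons b parts ih =>
    simp only [branchPairs, List.mem_append, List.mem_map, List.mem_cons] at h
    rcases h with ⟨e, he, rfl⟩ | rfl | h
    · exact ⟨_, le_rfl, b, by simp, Or.inr ⟨e, he, rfl⟩⟩
    · exact ⟨_, le_rfl, b, by simp, Or.inl rfl⟩
    · obtain ⟨j, hj, b', hb', h'⟩ := ih h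
      exact ⟨j, by simp; omega, b', by simp [hb'], h'⟩

theorem nodup_map_snd_branchPairs {parts : List (Data × List Data)}
    (h1 : (parts.map Prod.fst).Nodup) (h2 : (parts.flatMap Prod.snd).Nodup) :
    ((branchPairs parts).map Prod.snd).Nodup := by
  induction parts with
  | nil => simp [branchPairs]
  | cons b parts ih =>
    simp only [List.map_cons, List.nodup_cons, List.flatMap_cons] at h1 h2
    rw [List.nodup_append] at h2
    have h3 := ih h1.2 h2.2.1
    simp only [branchPairs, List.map_append, List.map_map, List.map_cons, List.nodup_append,
      List.nodup_cons]
    refine ⟨?_, ⟨?_, h3⟩, ?_⟩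
    · exact h2.1.map fun e e' h => by simpa using h
    · intro h
      obtain ⟨q, hq, hq'⟩ := List.mem_map.1 h
      obtain ⟨j, -, b', hb', rfl | ⟨e, -, rfl⟩⟩ := mem_branchPairs hq
      · simp only [groupLabel_inj] at hq'
        exact h1.1 (List.mem_map.2 ⟨b', hb', hq'⟩)
      · simp at hq'
    · intro x hx y hy
      obtain ⟨e, he, rfl⟩ := List.mem_map.1 hx
      rw [List.mem_cons] at hy
      rcases hy with rfl | hy
      · simp
      · obtain ⟨q, hq, rfl⟩ := List.mem_map.1 hy
        obtain ⟨j, -, b', hb', rfl | ⟨e', he', rfl⟩⟩ := mem_branchPairs hq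
        · simp
        · have := h2.2.2 e he e' (List.mem_flatMap.2 ⟨b', hb', he'⟩)
          simpa using this

/-- Adjacency in the pattern requires equal numbers, and the numbers in the tail are smaller than
that of the first part. Hence the first part and the tail do not interact. -/
theorem adj_branchPairs {R : Data → Data → Data} {parts : List (Data × List Data)}
    (hR : ∀ b ∈ parts, ∀ e ∈ b.2, R b.1 e ≠ .nil) :
    ∀ q ∈ branchPairs parts, ∀ q' ∈ branchPairs parts,
      labelAdj lenEq q.1 q'.1 ≠ .nil → labelAdj R q.2 q'.2 ≠ .nil := by
  induction parts with
  | nil => simp [branchPairs]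
  | cons b parts ih =>
    simp only [List.mem_cons, forall_eq_or_imp] at hR
    have key : ∀ q ∈ branchPairs (b :: parts),
        ((∃ e ∈ b.2, q = (elemLabel (ofNat (parts.length + 1)), elemLabel e)) ∨
          q = (groupLabel (ofNat (parts.length + 1)), groupLabel b.1)) ∨
        q ∈ branchPairs parts := by
      intro q hq
      simp only [branchPairs, List.mem_append, List.mem_map, List.mem_cons] at hq
      rcases hq with ⟨e, he, rfl⟩ | rfl | h
      · exact Or.inl (Or.inl ⟨e, he, rfl⟩)
      · exact Or.inl (Or.inr rfl)
      · exact Or.inr h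
    intro q hq q' hq' hadj
    rcases key q hq with (⟨e, he, rfl⟩ | rfl) | h <;>
    rcases key q' hq' with (⟨e', he', rfl⟩ | rfl) | h'
    · simp at hadj
    · rw [elemLabel_adj_group]; exact hR.1 e he
    · exfalso
      obtain ⟨j, hj, b', -, rfl | ⟨e', he', rfl⟩⟩ := mem_branchPairs h'
      · rw [elemLabel_adj_group, lenEq_ofNat] at hadj; omega
      · simp at hadj
    · rw [groupLabel_adj_elem]; exact hR.1 e' he'
    · simp at hadj
    · exfalso
      obtain ⟨j, hj, b', -, rfl | ⟨e', he', rfl⟩⟩ := mem_branchPairs h'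
      · simp at hadj
      · rw [groupLabel_adj_elem, lenEq_ofNat] at hadj; omega
    · exfalso
      obtain ⟨j, hj, b', -, rfl | ⟨e', he', rfl⟩⟩ := mem_branchPairs h
      · rw [groupLabel_adj_elem, lenEq_ofNat] at hadj; omega
      · simp at hadj
    · exfalso
      obtain ⟨j, hj, b', -, rfl | ⟨e', he', rfl⟩⟩ := mem_branchPairs h
      · simp at hadj
      · rw [elemLabel_adj_group, lenEq_ofNat] at hadj; omega
    · exact ih hR.2 q h q' h' hadj

/-- Groups with disjoint sets of elements yield a copy of a pattern tree in the host graph. -/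
theorem isContained_of_parts {R : Data → Data → Data} {pds gs es : List Data} (hpds : pds.Nodup)
    {parts : List (Data × List Data)} (h1 : (parts.map Prod.fst).Nodup)
    (h2 : (parts.flatMap Prod.snd).Nodup) (hgs : ∀ b ∈ parts, b.1 ∈ gs)
    (hes : ∀ b ∈ parts, ∀ e ∈ b.2, e ∈ es ∧ R b.1 e ≠ .nil) :
    (labelGraph lenEq (patternList pds (parts.map fun q => q.2.length))).IsContained
      (labelGraph R (hostList pds gs es)) := by
  let z : List (Data × Data) := (rootLabel, rootLabel) ::
    (pds.map (fun y => (pendLabel y, pendLabel y)) ++ branchPairs parts)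
  have hz : patternList pds (parts.map fun q => q.2.length) = z.map Prod.fst := by
    simp [z, patternList, map_fst_branchPairs, Function.comp_def]
  have key : ∀ q ∈ z, q = (rootLabel, rootLabel) ∨ (∃ y ∈ pds, q = (pendLabel y, pendLabel y)) ∨
      q ∈ branchPairs parts := by
    intro q hq
    simp only [z, List.mem_cons, List.mem_append, List.mem_map] at hq
    rcases hq with h | ⟨y, hy, rfl⟩ | h
    · exact Or.inl h
    · exact Or.inr (Or.inl ⟨y, hy, rfl⟩)
    · exact Or.inr (Or.inr h)
  rw [hz]
  refine isContained_of_pairs z ?_ ?_ ?_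
  · intro q hq
    simp only [hostList, List.mem_cons, List.mem_append, List.mem_map]
    rcases key q hq with rfl | ⟨y, hy, rfl⟩ | h
    · exact Or.inl rfl
    · exact Or.inr (Or.inl ⟨y, hy, rfl⟩)
    · obtain ⟨j, -, b, hb, rfl | ⟨e, he, rfl⟩⟩ := mem_branchPairs h
      · exact Or.inr (Or.inr (Or.inl ⟨_, hgs b hb, rfl⟩))
      · exact Or.inr (Or.inr (Or.inr ⟨e, (hes b hb e he).1, rfl⟩))
  · simp only [z, List.map_cons, List.map_append, List.map_map, List.nodup_cons,
      List.nodup_append]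
    refine ⟨?_, ?_, nodup_map_snd_branchPairs h1 h2, ?_⟩
    · rw [List.mem_append]
      rintro (h | h)
      · obtain ⟨y, -, hy⟩ := List.mem_map.1 h
        simp at hy
      · obtain ⟨q, hq, hq'⟩ := List.mem_map.1 h
        obtain ⟨j, -, b, -, rfl | ⟨e, -, rfl⟩⟩ := mem_branchPairs hq <;> simp at hq'
    · exact hpds.map fun y y' h => by simpa using h
    · intro x hx y hy
      obtain ⟨w, -, rfl⟩ := List.mem_map.1 hx
      obtain ⟨q, hq, rfl⟩ := List.mem_map.1 hy
      obtain ⟨j, -, b, -, rfl | ⟨e, -, rfl⟩⟩ := mem_branchPairs hq <;> simp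
  · intro q hq q' hq' hadj
    rcases key q hq with rfl | ⟨y, hy, rfl⟩ | h <;>
    rcases key q' hq' with rfl | ⟨y', hy', rfl⟩ | h'
    · simp at hadj
    · simp
    · obtain ⟨j, -, b, -, rfl | ⟨e, -, rfl⟩⟩ := mem_branchPairs h'
      · simp
      · simp at hadj
    · simp
    · simp at hadj
    · obtain ⟨j, -, b, -, rfl | ⟨e, -, rfl⟩⟩ := mem_branchPairs h' <;> simp at hadj
    · obtain ⟨j, -, b, -, rfl | ⟨e, -, rfl⟩⟩ := mem_branchPairs h
      · simp
      · simp at hadj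
    · obtain ⟨j, -, b, -, rfl | ⟨e, -, rfl⟩⟩ := mem_branchPairs h <;> simp at hadj
    · exact adj_branchPairs (fun b hb e he => (hes b hb e he).2) q h q' h' hadj

open Classical in
/-- Elements that are covered by few groups can be distributed among these groups. -/
theorem exists_parts {R : Data → Data → Data} {gl es : List Data} {m : ℕ}
    (h : m ≤ (es.toFinset.filter fun e => ∃ g ∈ gl, R g e ≠ .nil).card) :
    ∃ parts : List (Data × List Data), parts.length ≤ gl.length ∧ (∀ b ∈ parts, b.1 ∈ gl) ∧
      (parts.map Prod.fst).Nodup ∧ (parts.flatMap Prod.snd).Nodup ∧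
      (∀ b ∈ parts, ∀ e ∈ b.2, e ∈ es ∧ R b.1 e ≠ .nil) ∧ (∀ b ∈ parts, 0 < b.2.length) ∧
      (parts.map fun b => b.2.length).sum = m := by
  -- Exactly `m` of the covered elements are retained, since the numbers of leaves have to add up to
  -- `m`.
  obtain ⟨A, hA, rfl⟩ := Finset.exists_subset_card_eq h
  have hA' : ∀ e ∈ A, e ∈ es ∧ ∃ g ∈ gl, R g e ≠ .nil := fun e he => by simpa using hA he
  choose! f hf using fun e he => (hA' e he).2
  -- The parts are the fibres of the choice `f` of a group for each element: disjoint by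
  -- construction, and nonempty because only groups in the image are listed.
  refine ⟨(A.image f).toList.map fun g => (g, (A.filter fun e => f e = g).toList), ?_, ?_, ?_, ?_,
    ?_, ?_, ?_⟩
  · rw [List.length_map, Finset.length_toList]
    refine (Finset.card_le_card fun g hg => ?_).trans gl.toFinset_card_le
    obtain ⟨e, he, rfl⟩ := Finset.mem_image.1 hg
    exact List.mem_toFinset.2 (hf e he).1
  · intro b hb
    obtain ⟨g, hg, rfl⟩ := List.mem_map.1 hb
    obtain ⟨e, he, rfl⟩ := Finset.mem_image.1 (Finset.mem_toList.1 hg)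
    exact (hf e he).1
  · simp [Function.comp_def, Finset.nodup_toList]
  · rw [List.nodup_flatMap]
    refine ⟨fun b hb => ?_, ?_⟩
    · obtain ⟨g, hg, rfl⟩ := List.mem_map.1 hb
      exact Finset.nodup_toList _
    · rw [List.pairwise_map]
      refine (Finset.nodup_toList _).imp fun {g g'} hgg e he he' => hgg ?_
      simp only [Finset.mem_toList, Finset.mem_filter] at he he'
      exact he.2.symm.trans he'.2
  · intro b hb e he
    obtain ⟨g, hg, rfl⟩ := List.mem_map.1 hb
    simp only [Finset.mem_toList, Finset.mem_filter] at he
    obtain ⟨he, rfl⟩ := he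
    exact ⟨(hA' e he).1, (hf e he).2⟩
  · intro b hb
    obtain ⟨g, hg, rfl⟩ := List.mem_map.1 hb
    obtain ⟨e, he, rfl⟩ := Finset.mem_image.1 (Finset.mem_toList.1 hg)
    rw [Finset.length_toList, Finset.card_pos]
    exact ⟨e, by simp [he]⟩
  · rw [List.map_map, Finset.card_eq_sum_card_image f A, ← Finset.sum_map_toList]
    simp [Function.comp_def]

end TreeMachine

/-! ### From trees in the host graph to coverage -/

namespace TreeMachine

/-! ## What the building blocks compute -/

/-- The row `r` has a `1` in column `e`. -/
def HasBit (e : ℕ) (r : Data) : Prop := (dropLen (ofNat e) r).head ≠ .nil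

open Classical in
/-- The columns below `n` with a `1` in some of the given rows. -/
noncomputable def cov (n : ℕ) (L : List Data) : Finset ℕ :=
  (Finset.range n).filter fun e => ∃ r ∈ L, HasBit e r

theorem mem_cov {n e : ℕ} {L : List Data} : e ∈ cov n L ↔ e < n ∧ ∃ r ∈ L, HasBit e r := by
  simp [cov]

theorem cov_append (n : ℕ) (L L' : List Data) : cov n (L ++ L') = cov n L ∪ cov n L' := by
  ext e
  simp only [mem_cov, Finset.mem_union, List.mem_append]
  constructor
  · rintro ⟨h, r, hr | hr, h'⟩
    · exact Or.inl ⟨h, r, hr, h'⟩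
    · exact Or.inr ⟨h, r, hr, h'⟩
  · rintro (⟨h, r, hr, h'⟩ | ⟨h, r, hr, h'⟩)
    · exact ⟨h, r, Or.inl hr, h'⟩
    · exact ⟨h, r, Or.inr hr, h'⟩

theorem card_cov_append (n : ℕ) (L L' : List Data) :
    (cov n (L' ++ L)).card = (cov n L).card + (cov n L' \ cov n L).card := by
  rw [cov_append, Finset.union_comm, ← Finset.union_sdiff_self_eq_union,
    Finset.card_union_of_disjoint Finset.disjoint_sdiff]

theorem anyBit_ne_nil {e : ℕ} {u : Data} :
    anyBit (ofNat e) u ≠ .nil ↔ ∃ r ∈ u.toList, HasBit e r := by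
  rw [anyBit, Ne, ← toList_eq_nil, toList_ofList, List.flatMap_eq_nil_iff]
  simp only [toList_eq_nil, HasBit]
  push Not
  rfl

theorem covRel_ne_nil {e : ℕ} {u v : Data} : covRel u v (ofNat e) ≠ .nil ↔
    (∃ r ∈ v.toList, HasBit e r) ∧ ¬ ∃ r ∈ u.toList, HasBit e r := by
  rw [← anyBit_ne_nil, ← anyBit_ne_nil, covRel]
  by_cases h : anyBit (ofNat e) v = .nil
  · simp [h]
  · by_cases h' : anyBit (ofNat e) u = .nil
    · simp [sel_of_ne h, h, h']
    · simp [sel_of_ne h, h, h', sel_of_ne h']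

-- The list programs express filters as comprehensions over lists with at most one entry; this
-- brings them back to `filter` and `map`.
open Classical in
theorem flatMap_sel (l : List Data) (b f : Data → Data) :
    (l.flatMap fun e => (sel (b e) (.cons (f e) .nil) .nil).toList) =
      (l.filter fun e => decide (b e ≠ .nil)).map f := by
  induction l with
  | nil => rfl
  | cons x l ih =>
    rw [List.flatMap_cons, ih, List.filter_cons]
    by_cases h : b x = .nil
    · simp [h]
    · simp [h, sel_of_ne h]

theorem toList_columns (n : ℕ) :
    (columns (ofNat n)).toList = (List.range n).reverse.map ofNat := by
  have h : ∀ n, (List.replicate n Data.nil).foldl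
      (fun s _ => Data.cons (.cons .nil s.head) s) (.cons .nil .nil) =
      ofList ((List.range (n + 1)).reverse.map ofNat) := by
    intro n
    induction n with
    | zero => rfl
    | succ n ih =>
      rw [List.replicate_succ', List.foldl_append, ih]
      simp [List.range_succ]
  rw [columns, ofNat, toList_ofList, h, List.range_succ]
  simp

theorem nodup_columns (n : ℕ) : (columns (ofNat n)).toList.Nodup := by
  rw [toList_columns]
  exact (List.nodup_reverse.2 List.nodup_range).map ofNat_injective

theorem mem_columns {n : ℕ} {x : Data} :
    x ∈ (columns (ofNat n)).toList ↔ ∃ e < n, x = ofNat e := by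
  simp [toList_columns, eq_comm]

open Classical in
theorem card_filter_columns (n : ℕ) (p : Data → Prop) :
    ((columns (ofNat n)).toList.toFinset.filter p).card =
      ((Finset.range n).filter fun e => p (ofNat e)).card := by
  rw [← Finset.card_image_of_injective _ ofNat_injective]
  congr 1
  ext x
  simp only [Finset.mem_filter, List.mem_toFinset, mem_columns, Finset.mem_image, Finset.mem_range]
  constructor
  · rintro ⟨⟨e, he, rfl⟩, h⟩
    exact ⟨e, ⟨he, h⟩, rfl⟩
  · rintro ⟨e, ⟨he, h⟩, rfl⟩
    exact ⟨⟨e, he, rfl⟩, h⟩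

open Classical in
theorem toList_newColumns (n v u : Data) : (newColumns n v u).toList =
    (columns n).toList.filter fun e => decide (covRel u v e ≠ .nil) := by
  rw [newColumns, toList_ofList]
  have h := flatMap_sel (columns n).toList (fun e => covRel u v e) (fun e => e)
  rw [List.map_id'] at h
  rw [← h]
  congr 1
  funext e
  congr 1
  rw [covRel]
  by_cases h : anyBit e v = .nil
  · simp [h]
  · by_cases h' : anyBit e u = .nil
    · simp [sel_of_ne h, h']
    · simp [sel_of_ne h, sel_of_ne h']

open Classical in
theorem length_newColumns (n : ℕ) (v u : Data) : (newColumns (ofNat n) v u).toList.length =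
    ((columns (ofNat n)).toList.toFinset.filter fun e => covRel u v e ≠ .nil).card := by
  rw [toList_newColumns, ← List.toFinset_card_of_nodup ((nodup_columns n).filter _)]
  congr 1
  ext x
  simp

-- Translates neighbourhoods of groups in the host graph into newly covered elements, for use in
-- both directions of the reduction.
open Classical in
theorem card_filter_covRel (n : ℕ) (gl : List Data) (u : Data) :
    ((columns (ofNat n)).toList.toFinset.filter fun e => ∃ g ∈ gl, covRel u g e ≠ .nil).card =
      (cov n (gl.flatMap Data.toList) \ cov n u.toList).card := by
  have h := card_filter_columns n fun e => ∃ g ∈ gl, covRel u g e ≠ .nil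
  refine Eq.trans (by congr!) (h.trans (congrArg Finset.card (Finset.ext fun e => ?_)))
  simp only [Finset.mem_filter, Finset.mem_range, covRel_ne_nil, Finset.mem_sdiff, mem_cov,
    List.mem_flatMap]
  constructor
  · rintro ⟨he, g, hg, ⟨r, hr, hr'⟩, h⟩
    exact ⟨⟨he, r, ⟨g, hg, hr⟩, hr'⟩, fun h' => h h'.2⟩
  · rintro ⟨⟨he, r, ⟨g, hg, hr⟩, hr'⟩, h⟩
    exact ⟨he, g, hg, ⟨r, hr, hr'⟩, fun h' => h ⟨he, h'⟩⟩

open Classical in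
theorem length_newColumns_eq (n : ℕ) (v u : Data) : (newColumns (ofNat n) v u).toList.length =
    (cov n v.toList \ cov n u.toList).card := by
  rw [length_newColumns]
  simpa using card_filter_covRel n [v] u

theorem length_copies (c : ℕ) (x : Data) :
    (copies c x).toList.length = c * x.toList.length := by
  induction c with
  | zero => simp [copies]
  | succ c ih => simp [copies, ih]; ring

theorem mulLe_ne_nil {c : ℕ} {x y : Data} :
    mulLe c x y ≠ .nil ↔ c * x.toList.length ≤ y.toList.length := by
  rw [mulLe, ← length_copies]
  by_cases h : dropLen y (copies c x) = .nil
  · rw [h, sel_nil]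
    rw [dropLen_eq_nil] at h
    simpa using h
  · rw [sel_of_ne h]
    rw [dropLen_eq_nil] at h
    simpa using h

/-- The test is `c * (y - 1) ≤ p` with truncated subtraction, so it admits `0` and the numbers from
`1` to `p / c + 1`. The range below `p + 2` contains all of them. -/
theorem toList_pendants {c : ℕ} (hc : 0 < c) (p : ℕ) :
    ∃ l : List ℕ, (pendants c (ofNat p)).toList = l.map ofNat ∧ l.Nodup ∧ l.length = p / c + 2 := by
  classical
  have h := flatMap_sel (columns (.cons .nil (.cons .nil (ofNat p)))).toList
    (fun y => mulLe c y.tail (ofNat p)) (fun e => e)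
  rw [List.map_id'] at h
  rw [pendants, toList_ofList, h]
  rw [← ofNat_succ, ← ofNat_succ, toList_columns, List.filter_map]
  refine ⟨_, rfl, (List.nodup_reverse.2 List.nodup_range).filter _, ?_⟩
  rw [← List.toFinset_card_of_nodup ((List.nodup_reverse.2 List.nodup_range).filter _)]
  conv_rhs => rw [← Finset.card_range (p / c + 2)]
  congr 1
  ext y
  simp only [List.toFinset_filter, Finset.mem_filter, List.mem_toFinset, List.mem_reverse,
    List.mem_range, Function.comp_apply, tail_ofNat, decide_eq_true_eq, mulLe_ne_nil, length_ofNat,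
    Finset.mem_range, mul_comm c, ← Nat.le_div_iff_mul_le hc]
  have := Nat.div_le_self p c
  generalize p / c = q at *
  omega

theorem nodup_pendants {c : ℕ} (hc : 0 < c) (p : ℕ) : (pendants c (ofNat p)).toList.Nodup := by
  obtain ⟨l, h1, h2, -⟩ := toList_pendants hc p
  rw [h1]
  exact h2.map ofNat_injective

theorem length_pendants {c : ℕ} (hc : 0 < c) (p : ℕ) :
    (pendants c (ofNat p)).toList.length = p / c + 2 := by
  obtain ⟨l, h1, -, h2⟩ := toList_pendants hc p
  rw [h1, List.length_map, h2]

theorem mem_selections {j t : ℕ} {rows : List Data} {s : Data} :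
    s ∈ (selections j (ofList rows) (ofNat t)).toList ↔ ∃ L : List Data, L.length ≤ j ∧
      L.length ≤ t ∧ (∀ r ∈ L, r ∈ rows) ∧ s = .cons (ofList L) (ofNat (t - L.length)) := by
  induction j generalizing s with
  | zero =>
    simp only [selections, Data.toList_cons, Data.toList_nil, List.mem_singleton]
    constructor
    · rintro rfl; exact ⟨[], by simp⟩
    · rintro ⟨L, h, -, -, rfl⟩
      obtain rfl : L = [] := by simpa using h
      simp
  | succ j ih =>
    simp only [selections, toList_app, List.mem_append, toList_ofList, List.mem_flatMap]
    constructor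
    · rintro (h | ⟨s', h, r, hr, h'⟩)
      · obtain ⟨L, h1, h2⟩ := ih.1 h
        exact ⟨L, by omega, h2⟩
      · obtain ⟨L, h1, h2, h3, rfl⟩ := ih.1 h
        by_cases h0 : t - L.length = 0
        · simp [h0] at h'
        · rw [Data.tail_cons, sel_of_ne (by simpa using h0)] at h'
          simp only [Data.head_cons, tail_ofNat, Data.toList_cons, Data.toList_nil,
            List.mem_singleton] at h'
          subst h'
          refine ⟨r :: L, by simp; omega, by simp; omega, ?_, ?_⟩
          · simpa using ⟨hr, h3⟩
          · simp [Nat.sub_sub]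
    · rintro ⟨L, h1, h2, h3, rfl⟩
      cases L with
      | nil => exact Or.inl (ih.2 ⟨[], by simp⟩)
      | cons r L =>
        simp only [List.length_cons, List.mem_cons, forall_eq_or_imp] at h1 h2 h3
        refine Or.inr ⟨_, ih.2 ⟨L, by omega, by omega, h3.2, rfl⟩, r, h3.1, ?_⟩
        rw [Data.tail_cons, sel_of_ne (by simp; omega)]
        simp [Nat.sub_sub]

theorem length_selections (j : ℕ) (rows t : Data) :
    (selections j rows t).toList.length ≤ (rows.toList.length + 1) ^ j := by
  induction j with
  | zero => simp [selections]
  | succ j ih =>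
    have h : ∀ l : List Data, (l.flatMap fun s => (ofList (rows.toList.flatMap fun r =>
        (sel s.tail (.cons (.cons (.cons r s.head) s.tail.tail) .nil) .nil).toList)).toList).length ≤
        l.length * rows.toList.length := by
      intro l
      induction l with
      | nil => simp
      | cons s l ih =>
        rw [List.flatMap_cons, List.length_append, List.length_cons, toList_ofList]
        classical
        rw [flatMap_sel rows.toList (fun _ => s.tail)
          (fun r => .cons (.cons r s.head) s.tail.tail), List.length_map]
        have := List.length_filter_le (fun _ => decide (s.tail ≠ .nil)) rows.toList
        nlinarith
    have := h (selections j rows t).toList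
    simp only [selections, toList_app, List.length_append, toList_ofList] at this ⊢
    rw [pow_succ]
    nlinarith

theorem mem_groups {c p n : ℕ} {rows : List Data} {u v : Data} :
    v ∈ (groups c (ofNat p) (ofNat n) (ofList rows) u).toList ↔ ∃ L : List Data, v = ofList L ∧
      L.length ≤ c ∧ (∀ r ∈ L, r ∈ rows) ∧ c * (cov n L \ cov n u.toList).card ≤ p := by
  classical
  rw [groups, toList_ofList, flatMap_sel _ _ Data.head]
  simp only [List.mem_map, List.mem_filter, decide_eq_true_eq, mulLe_ne_nil, length_newColumns_eq,
    length_ofNat, mem_selections]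
  constructor
  · rintro ⟨s, ⟨⟨L, h1, -, h2, rfl⟩, h3⟩, rfl⟩
    exact ⟨L, rfl, h1, h2, by simpa using h3⟩
  · rintro ⟨L, rfl, h1, h2, h3⟩
    exact ⟨_, ⟨⟨L, h1, h1, h2, rfl⟩, by simpa using h3⟩, rfl⟩

theorem length_groups (c : ℕ) (p n rows u : Data) :
    (groups c p n rows u).toList.length ≤ (rows.toList.length + 1) ^ c := by
  classical
  rw [groups, toList_ofList, flatMap_sel _ _ Data.head, List.length_map]
  exact (List.length_filter_le _ _).trans (length_selections _ _ _)

/-! ## The host graph and the pattern tree of a search item -/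

/-- The vertices of the host graph when the rows in `u` have been chosen. -/
def hostOf (c p n : ℕ) (rows u : List Data) : List Data :=
  hostList (pendants c (ofNat p)).toList
    (groups c (ofNat p) (ofNat n) (ofList rows) (ofList u)).toList (columns (ofNat n)).toList

/-- The vertices of the pattern tree with the given numbers of leaves. -/
def patternOf (c p : ℕ) (σ : List ℕ) : List Data :=
  patternList (pendants c (ofNat p)).toList σ

/-- The host graph contains the pattern tree. -/
def Embeds (c p n : ℕ) (rows u : List Data) (σ : List ℕ) : Prop :=
  (labelGraph lenEq (patternOf c p σ)).IsContained
    (labelGraph (covRel (ofList u)) (hostOf c p n rows u))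

theorem queryOf_eq (c p n : ℕ) (rows u : List Data) (σ : List ℕ) :
    queryOf c (ofNat p) (ofNat n) (ofList rows) (ofList u) (ofList (branchLabels σ)) =
      .cons (ofGraph (labelGraph (covRel (ofList u)) (hostOf c p n rows u)))
        (ofGraph (labelGraph lenEq (patternOf c p σ))) := by
  rw [ofGraph_labelGraph, ofGraph_labelGraph, queryOf]
  simp [hostLabels, patternLabels, hostOf, patternOf, hostList, patternList, app]

theorem length_patternOf {c : ℕ} (hc : 0 < c) (p : ℕ) (σ : List ℕ) :
    (patternOf c p σ).length = p / c + 3 + σ.sum + σ.length := by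
  simp [patternOf, patternList, length_pendants hc, length_branchLabels]
  generalize p / c = q
  omega

theorem length_hostOf_le {c : ℕ} (hc : 0 < c) (p n : ℕ) (rows u : List Data) :
    (hostOf c p n rows u).length ≤ p + 3 + (rows.length + 1) ^ c + n := by
  have h1 := length_groups c (ofNat p) (ofNat n) (ofList rows) (ofList u)
  have h2 := Nat.div_le_self p c
  rw [toList_ofList] at h1
  simp only [hostOf, hostList, List.length_cons, List.length_append, List.length_map,
    length_pendants hc, toList_columns, List.length_reverse, List.length_range]
  generalize p / c = q at *
  omega

/-- The listed groups have at most `p / c` new columns, so with the root they have at most `p / c +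
1` neighbours, one less than there are pendant vertices. Thus `exists_groups_of_isContained`
applies. -/
theorem Embeds.exists_groups {c p n : ℕ} (hc : 0 < c) {rows u : List Data} {σ : List ℕ}
    (h : Embeds c p n rows u σ) : ∃ gl : List (List Data), gl.length ≤ σ.length ∧
      (∀ L ∈ gl, L.length ≤ c ∧ ∀ r ∈ L, r ∈ rows) ∧
      σ.sum ≤ (cov n gl.flatten \ cov n u).card := by
  classical
  obtain ⟨gl, h1, h2, h3⟩ := exists_groups_of_isContained (nodup_columns n)
    (by rw [length_pendants hc]; exact Nat.le_add_left _ _) (fun g hg => by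
      rw [← length_newColumns, length_newColumns_eq, length_pendants hc]
      obtain ⟨L, rfl, -, -, h'⟩ := mem_groups.1 hg
      rw [toList_ofList]
      rw [mul_comm, ← Nat.le_div_iff_mul_le hc] at h'
      exact Nat.lt_of_le_of_lt (Nat.succ_le_succ h') (Nat.lt_succ_self _)) h
  have h4 := card_filter_covRel n gl (ofList u)
  refine ⟨gl.map Data.toList, by simpa using h1, ?_, ?_⟩
  · intro L hL
    obtain ⟨g, hg, rfl⟩ := List.mem_map.1 hL
    obtain ⟨L, rfl, h5, h6, -⟩ := mem_groups.1 (h2 g hg)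
    rw [toList_ofList]
    exact ⟨h5, h6⟩
  · refine h3.trans (le_of_eq ?_)
    rw [toList_ofList, List.flatMap_def] at h4
    convert h4 using 1

/-- The parts from `exists_parts` prescribe the shape of the tree. That shape has no child without
leaves, which the search relies on. -/
theorem exists_embeds {c p n m : ℕ} (hc : 0 < c) {rows u : List Data} {gl : List (List Data)}
    (h1 : ∀ L ∈ gl, L.length ≤ c ∧ (∀ r ∈ L, r ∈ rows) ∧ c * (cov n L \ cov n u).card ≤ p)
    (h2 : m ≤ (cov n gl.flatten \ cov n u).card) : ∃ σ : List ℕ, σ.length ≤ gl.length ∧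
      σ.sum = m ∧ (∀ s ∈ σ, 0 < s) ∧ Embeds c p n rows u σ := by
  classical
  have h4 := card_filter_covRel n (gl.map ofList) (ofList u)
  rw [toList_ofList, List.flatMap_def, List.map_map, show Data.toList ∘ ofList = id from
    funext toList_ofList, List.map_id] at h4
  rw [← h4] at h2
  obtain ⟨parts, p1, p2, p3, p4, p5, p6, p7⟩ := exists_parts (R := covRel (ofList u))
    (gl := gl.map ofList) (es := (columns (ofNat n)).toList) (m := m) (by convert h2 using 1)
  refine ⟨parts.map fun q => q.2.length, by simpa using p1, p7, ?_, ?_⟩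
  · intro s hs
    obtain ⟨b, hb, rfl⟩ := List.mem_map.1 hs
    exact p6 b hb
  · refine isContained_of_parts (nodup_pendants hc p) p3 p4 (fun b hb => ?_) p5
    obtain ⟨L, hL, hL'⟩ := List.mem_map.1 (p2 b hb)
    rw [← hL']
    exact mem_groups.2 ⟨L, rfl, by simpa using h1 L hL⟩

end TreeMachine

/-! ### Guessing heavy groups and enumerating tree shapes -/

namespace TreeMachine

/-! ## Correctness of the search -/

/-- At most `t` of the given rows cover at least `p` of the columns below `n`. -/
def Feasible (p n : ℕ) (rows : List Data) (t : ℕ) : Prop :=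
  ∃ L : List Data, L.length ≤ t ∧ (∀ r ∈ L, r ∈ rows) ∧ p ≤ (cov n L).card

/-- Extending `σ` by `a` leaves, and children at the cost of `c` from the budget `b`, leads to a
list that satisfies `ans`. -/
inductive Found (ans : List ℕ → Prop) (c : ℕ) : List ℕ → ℕ → ℕ → Prop
  | leaf {σ : List ℕ} {b : ℕ} : ans σ → Found ans c σ 0 b
  | openChild {σ : List ℕ} {a b : ℕ} : c ≤ b → Found ans c (0 :: σ) (a + 1) (b - c) →
      Found ans c σ (a + 1) b
  | addLeaf {s : ℕ} {σ : List ℕ} {a b : ℕ} : Found ans c ((s + 1) :: σ) a b →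
      Found ans c (s :: σ) (a + 1) b

theorem Found.exists_ans {ans : List ℕ → Prop} {c : ℕ} {σ : List ℕ} {a b : ℕ}
    (h : Found ans c σ a b) :
    ∃ σ', σ'.sum = σ.sum + a ∧ c * σ'.length ≤ c * σ.length + b ∧ ans σ' := by
  induction h with
  | @leaf σ b h => exact ⟨σ, by simp, by omega, h⟩
  | openChild h _ ih =>
    obtain ⟨σ', h1, h2, h3⟩ := ih
    refine ⟨σ', by simpa using h1, ?_, h3⟩
    rw [List.length_cons, mul_add, mul_one] at h2
    omega
  | addLeaf _ ih =>
    obtain ⟨σ', h1, h2, h3⟩ := ih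
    refine ⟨σ', ?_, by simpa using h2, h3⟩
    rw [h1, List.sum_cons, List.sum_cons]
    omega

theorem Found.addLeaves {ans : List ℕ → Prop} {c s a b : ℕ} {σ : List ℕ} (k : ℕ)
    (h : Found ans c ((s + k) :: σ) a b) : Found ans c (s :: σ) (a + k) b := by
  induction k generalizing s with
  | zero => exact h
  | succ k ih => exact .addLeaf (ih (by rwa [show s + 1 + k = s + (k + 1) by ring]))

/-- Both moves act on the front of the list, so the entries of `ρ` are produced from the last to the
first, each child being followed at once by its leaves. Positivity matters because a child can be
opened only while leaves remain to be added. -/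
theorem Found.of_ans {ans : List ℕ → Prop} {c : ℕ} {σ ρ : List ℕ} {b : ℕ}
    (hb : c * ρ.length ≤ b) (hpos : ∀ s ∈ ρ, 0 < s) (h : ans (ρ ++ σ)) :
    Found ans c σ ρ.sum b := by
  induction ρ using List.reverseRecOn generalizing σ b with
  | nil => exact .leaf h
  | append_singleton ρ s ih =>
    rw [List.length_append, List.length_singleton, mul_add, mul_one] at hb
    have hs : 0 < s := hpos s (by simp)
    have h1 := ih (σ := s :: σ) (b := b - c) (by omega) (fun s' hs' => hpos s' (by simp [hs']))
      (by simpa using h)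
    rw [← zero_add s] at h1
    have h2 := h1.addLeaves
    obtain ⟨s, rfl⟩ := Nat.exists_eq_add_of_lt hs
    rw [List.sum_append, List.sum_singleton]
    simp only [zero_add, ← add_assoc] at h2 ⊢
    exact .openChild (by omega) h2

theorem exists_chunks {α : Type*} (c q : ℕ) (L : List α) (h : L.length ≤ c * q) :
    ∃ gl : List (List α), gl.length ≤ q ∧ (∀ g ∈ gl, g.length ≤ c) ∧ gl.flatten = L := by
  induction q generalizing L with
  | zero =>
    obtain rfl : L = [] := by simpa using h
    exact ⟨[], by simp⟩
  | succ q ih =>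
    obtain ⟨gl, h1, h2, h3⟩ := ih (L.drop c) (by
      rw [List.length_drop]; rw [mul_add, mul_one] at h; omega)
    refine ⟨L.take c :: gl, by simpa using h1, ?_, ?_⟩
    · simpa using h2
    · rw [List.flatten_cons, h3, List.take_append_drop]

/-- A heavy group, with more than `p / c` elements outside of `u`, is merged into `u`, and `j`
counts these moves. By `hcov`, `j` moves have covered at least `j p / c` elements, so after `c`
moves `u` covers `p` elements and the process stops. A move adds at most `c` rows to `u` and removes
one group, so the total price `u.length + c * gl.length` does not grow. -/
theorem exists_good_groups {n p c : ℕ} {rows : List Data} (gl : List (List Data))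
    (u : List Data) (j r : ℕ) (hc : ∀ g ∈ gl, g.length ≤ c ∧ ∀ x ∈ g, x ∈ rows)
    (hu : ∀ x ∈ u, x ∈ rows) (hlen : u.length ≤ r + c * j) (hj : j ≤ c)
    (hcov : j * p ≤ c * (cov n u).card) (hp : p ≤ (cov n (gl.flatten ++ u)).card) :
    ∃ (gl' : List (List Data)) (u' : List Data), u'.length ≤ r + c * c ∧
      u'.length + c * gl'.length ≤ u.length + c * gl.length ∧ (∀ x ∈ u', x ∈ rows) ∧
      (∀ g ∈ gl', g.length ≤ c ∧ ∀ x ∈ g, x ∈ rows) ∧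
      p ≤ (cov n (gl'.flatten ++ u')).card ∧
      (p ≤ (cov n u').card ∨ ∀ g ∈ gl', c * (cov n g \ cov n u').card ≤ p) := by
  induction hk : gl.length generalizing gl u j with
  | zero =>
    obtain rfl : gl = [] := by simpa using hk
    refine ⟨[], u, ?_, by simp, hu, hc, hp, Or.inr (by simp)⟩
    exact hlen.trans (by gcongr)
  | succ k ih =>
    by_cases h1 : p ≤ (cov n u).card
    · exact ⟨gl, u, hlen.trans (by gcongr), by rw [hk], hu, hc, hp, Or.inl h1⟩
    by_cases h2 : ∀ g ∈ gl, c * (cov n g \ cov n u).card ≤ p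
    · exact ⟨gl, u, hlen.trans (by gcongr), by rw [hk], hu, hc, hp, Or.inr h2⟩
    push Not at h1 h2
    obtain ⟨g, hg, hbad⟩ := h2
    obtain ⟨s, t, rfl⟩ := List.append_of_mem hg
    have hjc : j < c := by
      by_contra h
      have : c * p ≤ j * p := Nat.mul_le_mul_right p (by omega)
      have h3 : c * (cov n u).card < c * p := by
        refine Nat.mul_lt_mul_of_pos_left h1 ?_
        rcases Nat.eq_zero_or_pos c with rfl | hc0
        · simp at hbad
        · exact hc0
      omega
    have hgc := hc g hg
    have hflat : cov n ((s ++ t).flatten ++ (g ++ u)) = cov n ((s ++ g :: t).flatten ++ u) := by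
      simp only [List.flatten_append, List.flatten_cons, cov_append]
      ext e
      simp only [Finset.mem_union]
      tauto
    obtain ⟨gl', u', h3, h4, h5⟩ := ih (s ++ t) (g ++ u) (j + 1)
      (fun g' hg' => hc g' (by
        rcases List.mem_append.1 hg' with h | h <;> simp [h]))
      (fun x hx => (List.mem_append.1 hx).elim (hgc.2 x) (hu x))
      (by rw [List.length_append]; linarith [hgc.1, mul_add c j 1]) (by omega)
      (by rw [card_cov_append, mul_add]; linarith) (by rwa [hflat])
      (by rw [List.length_append, List.length_cons] at hk; rw [List.length_append]; omega)
    refine ⟨gl', u', h3, h4.trans ?_, h5⟩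
    simp only [List.length_append]
    linarith [hgc.1, mul_add c s.length t.length, mul_add c s.length (t.length + 1),
      mul_add c t.length 1]

/-- The search from an initial choice of rows succeeds. -/
def FoundFrom (c p n : ℕ) (rows : List Data) (t : ℕ) (L : List Data) : Prop :=
  Found (Embeds c p n rows L) c [] (p - (cov n L).card) (t - L.length)

/-- Forwards, the first `t % c` rows start the list `u`, so that the others fit into `t / c` groups
and the price of `c` per group stays within `t`; then the heavy groups are merged. Backwards, each
child was paid with `c`, so the groups found by the oracle contain at most `t - L.length` rows in
total. -/
theorem feasible_iff {c : ℕ} (hc : 0 < c) (p n : ℕ) (rows : List Data) (t : ℕ) :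
    Feasible p n rows t ↔ ∃ L : List Data, L.length ≤ c + c * c ∧ L.length ≤ t ∧
      (∀ r ∈ L, r ∈ rows) ∧ FoundFrom c p n rows t L := by
  constructor
  · rintro ⟨L, h1, h2, h3⟩
    have hmod := Nat.mod_add_div t c
    obtain ⟨gl, g1, g2, g3⟩ := exists_chunks c (t / c) (L.drop (t % c)) (by
      rw [List.length_drop]; omega)
    obtain ⟨gl', u, k1, k2, k3, k4, k5, k6⟩ := exists_good_groups (n := n) (p := p) (c := c)
      (rows := rows) gl (L.take (t % c)) 0 c (fun g hg => ⟨g2 g hg, fun x hx => h2 x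
        (List.mem_of_mem_drop (g3 ▸ List.mem_flatten_of_mem hg hx))⟩)
      (fun x hx => h2 x (List.mem_of_mem_take hx))
      (by rw [List.length_take]; have := Nat.mod_lt t hc; omega) (by omega) (by simp) (by
        rw [g3]
        refine h3.trans (le_of_eq ?_)
        rw [cov_append, Finset.union_comm, ← cov_append, List.take_append_drop])
    have k7 : u.length + c * gl'.length ≤ t := by
      refine k2.trans ?_
      have : c * gl.length ≤ c * (t / c) := Nat.mul_le_mul_left c g1
      rw [List.length_take]
      omega
    refine ⟨u, by linarith, by omega, k3, ?_⟩
    -- If `u` already covers enough, no leaf is missing and the remaining groups, light or not, are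
    -- dropped.
    by_cases h0 : p ≤ (cov n u).card
    · rw [FoundFrom, Nat.sub_eq_zero_of_le h0]
      obtain ⟨σ, s1, -, -, s2⟩ := exists_embeds (p := p) (n := n) (rows := rows) (u := u) (gl := [])
        (m := 0) hc (by simp) (by simp)
      obtain rfl : σ = [] := by simpa using s1
      exact .leaf s2
    · obtain ⟨σ, s1, s2, s3, s4⟩ := exists_embeds (p := p) (n := n) (rows := rows) (u := u)
        (gl := gl') (m := p - (cov n u).card) hc
        (fun g hg => ⟨(k4 g hg).1, (k4 g hg).2, k6.resolve_left h0 g hg⟩) (by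
          rw [card_cov_append] at k5; omega)
      rw [FoundFrom, ← s2]
      refine Found.of_ans ?_ s3 (by simpa using s4)
      have : c * σ.length ≤ c * gl'.length := Nat.mul_le_mul_left c s1
      omega
  · rintro ⟨L, -, h2, h3, h4⟩
    obtain ⟨σ, s1, s2, s3⟩ := h4.exists_ans
    obtain ⟨gl, g1, g2, g3⟩ := s3.exists_groups hc
    have h5 : ∀ gl : List (List Data), (∀ L ∈ gl, L.length ≤ c ∧ ∀ r ∈ L, r ∈ rows) →
        gl.flatten.length ≤ c * gl.length ∧ ∀ r ∈ gl.flatten, r ∈ rows := by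
      intro gl
      induction gl with
      | nil => simp
      | cons g gl ih =>
        intro h
        simp only [List.mem_cons, forall_eq_or_imp] at h
        obtain ⟨i1, i2⟩ := ih h.2
        rw [List.flatten_cons, List.length_append, List.length_cons, mul_add]
        refine ⟨by omega, fun r hr => ?_⟩
        exact (List.mem_append.1 hr).elim (h.1.2 r) (i2 r)
    obtain ⟨h6, h7⟩ := h5 gl g2
    refine ⟨gl.flatten ++ L, ?_, fun r hr => (List.mem_append.1 hr).elim (h7 r) (h3 r), ?_⟩
    · have : c * gl.length ≤ c * σ.length := Nat.mul_le_mul_left c g1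
      simp only [List.length_nil, mul_zero, zero_add] at s2
      rw [List.length_append]
      omega
    · rw [card_cov_append]
      simp only [List.sum_nil, zero_add] at s1
      omega

/-! ## The size of the search tree -/

/-- The number of states below a search item with `a` leaves to be added and budget `b`. -/
def nodes (c : ℕ) : ℕ → ℕ → ℕ
  | 0, _ => 1
  | a + 1, b => 1 + (if _ : 0 < c ∧ c ≤ b then nodes c (a + 1) (b - c) else 0) + nodes c a b
termination_by a b => a + b

/-- Adding a leaf divides `x ^ (a + b)` by `x` and opening a child divides it by `x ^ c`, so `hxc`
closes the recursion. If both branches exist, the two terms `-1` pay for the node itself. If the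
budget is below `c`, the missing branch leaves a share of `1 / x ^ c`, and the factor `2 * x ^ c`
makes this share large enough. -/
theorem nodes_le {c : ℕ} {x : ℝ} (hx : 1 < x) (hxc : 1 / x + 1 / x ^ c ≤ 1) (a b : ℕ) :
    (nodes c a b : ℝ) ≤ 2 * x ^ c * x ^ (a + b) - 1 := by
  have hpos : ∀ k : ℕ, 0 < x ^ k := fun k => by positivity
  induction a, b using nodes.induct c with
  | case1 b =>
    have h1 := one_le_pow₀ hx.le (n := 0 + b)
    have h2 := one_le_pow₀ hx.le (n := c)
    simp only [nodes, Nat.cast_one]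
    nlinarith
  | case2 a b ih1 ih2 =>
    change (nodes c (a + 1) b : ℝ) ≤ 2 * x ^ c * x ^ (a + 1 + b) - 1
    rw [nodes]
    have h1 := one_le_pow₀ hx.le (n := a + 1 + b)
    have e2 : x ^ (a + b) = x ^ (a + 1 + b) * (1 / x) := by
      rw [show a + 1 + b = a + b + 1 by ring, pow_succ]
      field_simp
    have e3 : x ^ c * (1 / x ^ c) = 1 := mul_one_div_cancel (hpos c).ne'
    have e4 := mul_le_mul_of_nonneg_left hxc (mul_pos (hpos c) (hpos (a + 1 + b))).le
    rw [e2] at ih2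
    by_cases h : 0 < c ∧ c ≤ b
    · have ih1 := ih1 h
      have e1 : x ^ (a + 1 + (b - c)) = x ^ (a + 1 + b) * (1 / x ^ c) := by
        rw [mul_one_div, eq_div_iff (hpos c).ne', ← pow_add]
        congr 1
        omega
      rw [e1] at ih1
      rw [dif_pos h]
      push_cast
      linarith
    · rw [dif_neg h]
      push_cast
      have e5 : x ^ c * x ^ (a + 1 + b) * (1 / x ^ c) = x ^ (a + 1 + b) := by
        rw [mul_right_comm, e3, one_mul]
      linarith

end TreeMachine

theorem PMF.expect_add_const {α : Type*} (μ : PMF α) (f : α → ℝ≥0∞) (v : ℝ≥0∞) :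
    (μ.expect fun x => f x + v) = μ.expect f + v := by
  simp only [PMF.expect, mul_add]
  rw [ENNReal.tsum_add, ENNReal.tsum_mul_right, μ.tsum_coe, one_mul]

theorem PMF.expect_const_mul {α : Type*} (μ : PMF α) (f : α → ℝ≥0∞) (v : ℝ≥0∞) :
    (μ.expect fun x => v * f x) = v * μ.expect f := by
  simp only [PMF.expect]
  rw [← ENNReal.tsum_mul_left]
  exact tsum_congr fun x => by ring

/-! ### Oracle questions: accumulation of errors, calls, amplification -/

namespace TreeMachine

variable {a : ℕ}

theorem Does.add_const {c : Program} {x k : Data} {t : ℕ} {F : Data → Data → ℝ≥0∞} {v : ℝ≥0∞}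
    (h : Does a c x k t F v) (w : ℝ≥0∞) :
    Does a c x k t (fun y k' => F y k' + w) (v + w) := fun s hx hk hv => by
  obtain ⟨μ, h1, h2⟩ := h s hx hk (ne_top_of_le_ne_top hv le_self_add)
  refine ⟨μ, h1, ?_⟩
  rw [PMF.expect_add_const]
  gcongr

/-- Every number is the size of a tree, namely of its unary numeral, so the rules of `PolyBound`
also serve for functions of numbers. -/
theorem exists_pow_bound {g : ℕ → ℕ} (h : PolyBound fun x => g x.size) :
    ∃ C, ∀ S, g S ≤ (S + 2) ^ C := by
  obtain ⟨C, hC⟩ := h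
  exact ⟨C, fun S => by simpa using hC (ofNat S)⟩

/-! ## Loops that ask questions -/

/-- Ask a question about the accumulator, and update the accumulator with the answer. -/
def askBody (a : ℕ) (query c update : Program) : Program :=
  .seq (.seq (push a) query) (.seq c (.seq (swap a) (.seq (join a) update)))

/-- The state waits on the stack while the question is asked; `swap` and `join` then pair the answer
with it for the update. -/
theorem does_askBody {query update c : Program} {fq fu : Data → Data} {x k : Data}
    {tq τ tu : ℕ} {G H : Data → Data → ℝ≥0∞} {v : ℝ≥0∞}
    (hq : ∀ k, Det a query x k tq (fq x) k) (hc : Does a c (fq x) (.cons x k) τ H v)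
    (hH : ∀ y k', H y k' ≠ ⊤ → k' = .cons x k ∧
      (∀ k, Det a update (.cons y x) k tu (fu (.cons y x)) k) ∧ G (fu (.cons y x)) k ≤ H y k') :
    Does a (askBody a query c update) x k (tq + τ + tu + 20) G v := by
  refine (((det_push x k).seq (hq _)).seq_does (hc.seq (t' := 1 + 5 + (1 + 3 + tu))
    fun y k' h => ?_)).mono (by omega) (fun _ _ => le_rfl) le_rfl
  obtain ⟨rfl, h1, h2⟩ := hH y k' h
  exact ((det_swap _ _ _).seq ((det_join _ _ _).seq (h1 k)) G).mono le_rfl (fun _ _ => le_rfl) h2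

open Classical in
/-- The penalty for a wrong answer; it is infinite for anything that is not an answer. -/
noncomputable def verdict (b : Bool) (k y k' : Data) : ℝ≥0∞ :=
  if k' = k then (if y = ofBool b then 0 else if y = ofBool !b then 1 else ⊤) else ⊤

theorem ofBool_inj {b b' : Bool} : ofBool b = ofBool b' ↔ b = b' := by
  cases b <;> cases b' <;> simp [yes]

theorem verdict_right (b : Bool) (k : Data) : verdict b k (ofBool b) k = 0 := by simp [verdict]

theorem verdict_wrong {b b' : Bool} (h : b' ≠ b) (k : Data) : verdict b k (ofBool b') k = 1 := by
  have h' : b' = !b := by cases b <;> cases b' <;> simp_all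
  subst h'
  simp [verdict, ofBool_inj]

theorem verdict_ne_top {b : Bool} {k y k' : Data} (h : verdict b k y k' ≠ ⊤) :
    k' = k ∧ ∃ b', y = ofBool b' := by
  unfold verdict at h
  split_ifs at h with h1 h2 h3
  · exact ⟨h1, _, h2⟩
  · exact ⟨h1, _, h3⟩
  · exact (h rfl).elim
  · exact (h rfl).elim

/-- On the input `x`, the program `c` gives an answer within `t` steps, and the answer differs from
`b` with probability at most `e`. -/
def Answers (a : ℕ) (c : Program) (x : Data) (b : Bool) (t : ℕ) (e : ℝ≥0∞) : Prop :=
  ∀ k, Does a c x k t (verdict b k) e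

theorem Answers.mono {c : Program} {x : Data} {b : Bool} {t t' : ℕ} {e e' : ℝ≥0∞}
    (h : Answers a c x b t e) (ht : t ≤ t') (he : e ≤ e') : Answers a c x b t' e' := fun k =>
  (h k).mono ht (fun _ _ => le_rfl) he

theorem size_ofBool_le (b : Bool) : (ofBool b).size ≤ 1 := by cases b <;> simp [yes]

open Classical in
/-- The penalty for a final state of a loop that is not good; it is infinite for anything that is
not a final state. -/
noncomputable def loopVerdict {St : Type*} (enc : St → Data) (Inv Good : St → Prop) (k y k' : Data) :
    ℝ≥0∞ :=
  if k' = k then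
    if ∃ s, y = enc s ∧ Inv s ∧ y.head = .nil ∧ Good s then 0
    else if ∃ s, y = enc s ∧ Inv s ∧ y.head = .nil then 1 else ⊤
  else ⊤

theorem loopVerdict_ne_top {St : Type*} {enc : St → Data} {Inv Good : St → Prop} {k y k' : Data}
    (h : loopVerdict enc Inv Good k y k' ≠ ⊤) : k' = k ∧ ∃ s, y = enc s ∧ Inv s ∧ y.head = .nil ∧
      (Good s ∨ loopVerdict enc Inv Good k y k' = 1) := by
  unfold loopVerdict at h ⊢
  split_ifs at h ⊢ with h1 h2 h3
  · obtain ⟨s, h3, h4, h5, h6⟩ := h2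
    exact ⟨h1, s, h3, h4, h5, Or.inl h6⟩
  · obtain ⟨s, h3, h4, h5⟩ := h3
    exact ⟨h1, s, h3, h4, h5, Or.inr rfl⟩
  · exact (h rfl).elim
  · exact (h rfl).elim

-- The shell of both searches. `Inv` has to survive every answer, so the bounds on size and time
-- hold for all outcomes of the coins; `Good` has to survive correct answers only. Each round lowers
-- `M`, so at most `M s` questions are asked, and their errors add up to at most `M s * e`.
open Classical in
theorem exists_askLoop {query update : Data → Data} (hq : Poly a query) (hu : Poly a update)
    (c : Program) : ∃ d : Program, (c.CoinFree → d.CoinFree) ∧ ∃ C : ℕ,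
      ∀ {St : Type} (enc : St → Data) (Inv Good : St → Prop) (Q : Data → Bool → Prop) (M : St → ℕ)
        (S τ : ℕ) (e : ℝ≥0∞),
      (∀ x b, Q x b → Answers a c x b τ e) → (∀ s, Inv s → (enc s).size ≤ S) →
      (∀ s, Inv s → (enc s).head ≠ .nil → ∃ b, Q (query (enc s)) b ∧
        ∀ b', ∃ s', update (.cons (ofBool b') (enc s)) = enc s' ∧ Inv s' ∧ M s' < M s ∧
          (b' = b → Good s → Good s')) →
      ∀ s k, Inv s → Does a d (enc s) k (M s * ((S + 2) ^ C + τ) + 1)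
        (loopVerdict enc Inv Good k) ((if Good s then 0 else 1) + M s * e) := by
  obtain ⟨-, cq, fq, tq, ⟨Cq, hCq⟩, dq⟩ := hq
  obtain ⟨-, cu, fu, tu, ⟨Cu, hCu⟩, du⟩ := hu
  refine ⟨loop a (askBody a cq c cu), fun h => ?_, ?_⟩
  · exact ⟨⟨trivial, fq⟩, h, ⟨trivial, trivial, trivial⟩, ⟨trivial, trivial⟩, fu⟩
  obtain ⟨C, hC⟩ := exists_pow_bound (g := fun S => (S + 2) ^ Cq + (S + 4) ^ Cu + 21)
    ((((PolyBound.size.add (.const 2)).pow Cq).add ((PolyBound.size.add (.const 4)).pow Cu)).add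
      (.const 21))
  refine ⟨C, fun {St} enc Inv Good Q M S τ e hans hsize hstep s k hs => ?_⟩
  induction hm : M s using Nat.strong_induction_on generalizing s with
  | _ m ih =>
  subst hm
  by_cases hs0 : (enc s).head = .nil
  · refine (Does.loop_nil hs0).mono (by omega) (fun _ _ => le_rfl) ?_
    unfold loopVerdict
    rw [if_pos rfl]
    by_cases hg : Good s
    · rw [if_pos ⟨s, rfl, hs, hs0, hg⟩]
      exact zero_le
    · rw [if_neg hg]
      refine le_trans ?_ le_self_add
      split_ifs with h1 h2
      · exact zero_le
      · exact le_rfl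
      · exact (h2 ⟨s, rfl, hs, hs0⟩).elim
  obtain ⟨b, hQ, hnext⟩ := hstep s hs hs0
  have hxs := hsize s hs
  set x := enc s with hx
  -- The error bound after this round: the share of one question has been spent, and a state that is
  -- not good is charged with 1.
  let W : Data → ℝ≥0∞ := fun y =>
    (if ∃ s', y = enc s' ∧ Inv s' ∧ M s' < M s ∧ Good s' then 0 else 1) + (M s - 1 : ℕ) * e
  let G : Data → Data → ℝ≥0∞ := fun y k' =>
    if k' = k ∧ ∃ b', y = update (.cons (ofBool b') x) then W y else ⊤
  have hM : 0 < M s := by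
    obtain ⟨s', -, -, h, -⟩ := hnext true
    exact (Nat.zero_le _).trans_lt h
  have hbody : Does a (askBody a cq c cu) x k ((S + 2) ^ Cq + τ + (S + 4) ^ Cu + 20) G
      ((if Good s then 0 else 1) + M s * e) := by
    have h1 := (hans _ b hQ (.cons x k)).add_const ((if Good s then 0 else 1) + (M s - 1 : ℕ) * e)
    refine (does_askBody (fq := query) (fu := update)
      (fun k => (dq x k).mono ((hCq x).trans (Nat.pow_le_pow_left
        (Nat.add_le_add_right hxs 2) Cq))) h1 fun y k' hy => ?_).mono le_rfl (fun _ _ => le_rfl) ?_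
    · obtain ⟨rfl, b', rfl⟩ := verdict_ne_top (ne_top_of_le_ne_top hy le_self_add)
      refine ⟨rfl, fun k => (du _ k).mono ((hCu _).trans (Nat.pow_le_pow_left ?_ Cu)), ?_⟩
      · have := size_ofBool_le b'
        rw [Data.size_cons]
        omega
      · simp only [G, true_and, W]
        rw [if_pos ⟨b', rfl⟩, ← add_assoc]
        gcongr
        by_cases hg : Good s
        · by_cases hb : b' = b
          · obtain ⟨s', h2, h3, h4, h5⟩ := hnext b'
            rw [if_pos ⟨s', h2, h3, h4, h5 hb hg⟩]
            exact zero_le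
          · rw [verdict_wrong hb]
            split_ifs <;> simp
        · rw [if_neg hg]
          split_ifs <;> simp
    · rw [add_left_comm]
      gcongr
      calc e + (M s - 1 : ℕ) * e = (1 + (M s - 1 : ℕ)) * e := by ring
        _ ≤ M s * e := by
          gcongr
          norm_cast
          omega
  refine (hbody.loop_cons hs0 (t' := (M s - 1) * ((S + 2) ^ C + τ) + 1) fun y k' hy => ?_).mono
    ?_ (fun _ _ => le_rfl) le_rfl
  · by_cases hy' : k' = k ∧ ∃ b', y = update (.cons (ofBool b') x)
    · simp only [G, if_pos hy', W]
      obtain ⟨rfl, b', rfl⟩ := hy'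
      -- The encoding is not assumed to be injective, so a good state is preferred among those with
      -- this encoding.
      obtain ⟨s', h1, h2, h3, h4⟩ : ∃ s', update (.cons (ofBool b') x) = enc s' ∧ Inv s' ∧
          M s' < M s ∧ ((∃ s', update (.cons (ofBool b') x) = enc s' ∧ Inv s' ∧ M s' < M s ∧
            Good s') → Good s') := by
        by_cases h : ∃ s', update (.cons (ofBool b') x) = enc s' ∧ Inv s' ∧ M s' < M s ∧ Good s'
        · obtain ⟨s', h1, h2, h3, h4⟩ := h
          exact ⟨s', h1, h2, h3, fun _ => h4⟩
        · obtain ⟨s', h1, h2, h3, -⟩ := hnext b'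
          exact ⟨s', h1, h2, h3, fun h' => (h h').elim⟩
      have h5 := Nat.le_sub_one_of_lt h3
      have h6 := ih _ h3 s' h2 rfl
      rw [← h1] at h6
      refine h6.mono ?_ (fun _ _ => le_rfl) ?_
      · gcongr
      · gcongr
        by_cases hg : Good s'
        · rw [if_pos hg]
          exact zero_le
        · rw [if_neg hg, if_neg fun h => hg (h4 h)]
    · exact absurd (by simp only [G, if_neg hy']) hy
  · have h1 := hC S
    obtain ⟨m, hm⟩ := Nat.exists_eq_add_of_lt hM
    rw [hm, zero_add, Nat.add_sub_cancel, add_mul, one_mul]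
    omega

/-! ## Calling a program as a subroutine -/

/-- Empty the variables below `n`. -/
def clear : ℕ → Program
  | 0 => .skip
  | n + 1 => .seq (clear n) (.assign n .nil)

/-- Run `P` on the content of the accumulator, and store in the accumulator the bit that tells
whether the output is different from `nil`. -/
def call (a : ℕ) (P : Program) : Program :=
  .seq (.seq (.seq (.seq (clear a) (.assign 0 (.var a))) P) (.assign a (.var 0)))
    (.ite (.var a) (.assign a (.cons .nil .nil)) (.assign a .nil))

theorem coinFree_clear (n : ℕ) : (clear n).CoinFree := by
  induction n with
  | zero => trivial
  | succ n ih => exact ⟨ih, trivial⟩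

theorem coinFree_call {P : Program} (h : P.CoinFree) : (call a P).CoinFree :=
  ⟨⟨⟨⟨coinFree_clear a, trivial⟩, h⟩, trivial⟩, trivial, trivial⟩

theorem exec_clear (n : ℕ) (s : Store) :
    Exec (clear n) s (2 * n + 1) (PMF.pure fun x => if x < n then .nil else s x) := by
  induction n with
  | zero => simpa [clear] using Exec.skip s
  | succ n ih =>
    have h := ih.seq (ν := fun s' => PMF.pure (Function.update s' n .nil)) (t₂ := 1)
      (d := .assign n .nil) fun s' _ => Exec.assign n .nil s'
    rw [PMF.pure_bind] at h
    have h' : Function.update (fun x => if x < n then Data.nil else s x) n .nil =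
        fun x => if x < n + 1 then .nil else s x := by
      funext x
      by_cases hx : x = n
      · subst hx; simp
      · rw [Function.update_of_ne hx]
        by_cases hx' : x < n
        · simp [hx', Nat.lt_succ_of_lt hx']
        · simp [hx', show ¬ x < n + 1 by omega]
    rw [h'] at h
    exact h.mono (by omega)

/-- Clearing the variables below `a` restores on them the store with which `P` expects to start.
Accumulator and stack lie outside of its reach and survive the call. -/
theorem does_call {P : Program} (ha : P.bound ≤ a) (ha0 : 0 < a) {x : Data} {t : ℕ}
    (h : HaltsIn t (init P x)) (k : Data) (F : Data → Data → ℝ≥0∞) :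
    Does a (call a P) x k (t + 2 * a + 10) F
      ((run t (init P x)).expect fun γ => F (sel γ.output yes .nil) k) := by
  refine (Does.seq (t := t + 2 * a + 6) (t' := 2) (G := fun y k' => F (sel y yes .nil) k') ?_
    fun y k' _ => ?_).mono (by omega) (fun _ _ => le_rfl) le_rfl
  swap
  · by_cases hy : y = .nil
    · subst hy
      exact .ite_nil (Det.assign_acc _ _ (fun _ _ _ => rfl) F)
    · rw [sel_of_ne hy]
      exact .ite_cons hy (Det.assign_acc _ _ (fun _ _ _ => rfl) F)
  intro s hx hk _
  have h1 := (exec_clear a s).seq (d := .assign 0 (.var a)) (t₂ := 1)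
    (ν := fun s' => PMF.pure (Function.update s' 0 (s' a))) fun s' _ => Exec.assign 0 (.var a) s'
  rw [PMF.pure_bind] at h1
  have hs : Function.update (fun y => if y < a then Data.nil else s y) 0
      (if a < a then Data.nil else s a) = mergeStore a s (init P x).store := by
    funext y
    by_cases hy : y = 0
    · subst hy; simp [mergeStore, ha0, init, hx]
    · simp [mergeStore, init, Function.update_of_ne hy]
  rw [hs] at h1
  have h2 := h1.seq (d := P) (t₂ := t) (ν := fun _ =>
    (run t (init P x)).map fun γ => mergeStore a s γ.store) fun s' hs' => by
      rw [PMF.mem_support_pure_iff] at hs'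
      subst hs'
      exact Exec.of_run_init ha s x h
  rw [PMF.pure_bind] at h2
  have h3 := h2.seq (d := .assign a (.var 0)) (t₂ := 1)
    (ν := fun s' => PMF.pure (Function.update s' a (s' 0))) fun s' _ => Exec.assign a (.var 0) s'
  refine ⟨_, h3.mono (by omega), le_of_eq ?_⟩
  rw [PMF.bind_map, PMF.expect_bind]
  simp [PMF.expect_pure, mergeStore, ha0, hk, Config.output]

/-! ## Amplification by majority -/

/-- With a success probability of `2/3` the mean weight is at most `12 · 2/3 + 27 · 1/3 = 17`.
Adding 15 on `A` makes the weight constant, which avoids subtraction. -/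
theorem expect_ite_le {α : Type*} (μ : PMF α) (A : Set α) [DecidablePred (· ∈ A)]
    (h : (2 / 3 : ℝ≥0∞) ≤ μ.toOuterMeasure A) :
    (μ.expect fun x => if x ∈ A then 12 else 27) ≤ 17 := by
  have h1 : (μ.expect fun x => if x ∈ A then (12 : ℝ≥0∞) else 27) + 15 * μ.toOuterMeasure A =
      27 := by
    rw [PMF.toOuterMeasure_apply, PMF.expect, ← ENNReal.tsum_mul_left, ← ENNReal.tsum_add]
    have h2 : ∀ x, μ x * (if x ∈ A then (12 : ℝ≥0∞) else 27) + 15 * A.indicator μ x =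
        μ x * 27 := by
      intro x
      by_cases hx : x ∈ A
      · simp only [hx, if_true, Set.indicator_of_mem]
        ring
      · simp [hx]
    rw [tsum_congr h2, ENNReal.tsum_mul_right, μ.tsum_coe, one_mul]
  have h3 : (10 : ℝ≥0∞) ≤ 15 * μ.toOuterMeasure A := by
    refine le_trans ?_ (mul_le_mul_right h 15)
    rw [← mul_div_assoc, ENNReal.le_div_iff_mul_le (by simp) (by simp)]
    norm_num
  have h4 : (μ.expect fun x => if x ∈ A then (12 : ℝ≥0∞) else 27) + 10 ≤ 17 + 10 := by
    calc _ ≤ _ := add_le_add_right h3 _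
      _ = 27 := h1
      _ = 17 + 10 := by norm_num
  exact (ENNReal.add_le_add_iff_right (by simp)).1 h4

/-- The tally of the answers: repetitions that remain, question, positive and negative answers. -/
def tally (R q : Data) (i j : ℕ) : Data := .cons R (.cons q (.cons (ofNat i) (ofNat j)))

/-- Count an answer. -/
def tallyUpdate (y : Data) : Data :=
  .cons y.tail.head.tail (.cons y.tail.tail.head
    (sel y.head (.cons (.cons .nil y.tail.tail.tail.head) y.tail.tail.tail.tail)
      (.cons y.tail.tail.tail.head (.cons .nil y.tail.tail.tail.tail))))

theorem tallyUpdate_nil (r R q : Data) (i j : ℕ) :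
    tallyUpdate (.cons .nil (tally (.cons r R) q i j)) = tally R q i (j + 1) := by
  simp [tallyUpdate, tally]

theorem tallyUpdate_of_ne {y : Data} (hy : y ≠ .nil) (r R q : Data) (i j : ℕ) :
    tallyUpdate (.cons y (tally (.cons r R) q i j)) = tally R q (i + 1) j := by
  simp [tallyUpdate, tally, sel_of_ne hy]

theorem poly_tallyUpdate : Poly a tallyUpdate :=
  Poly.id.tail.head.tail.cons (Poly.id.tail.tail.head.cons
    (Poly.id.head.sel ((Poly.nil.cons Poly.id.tail.tail.tail.head).cons Poly.id.tail.tail.tail.tail)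
      (Poly.id.tail.tail.tail.head.cons (Poly.nil.cons Poly.id.tail.tail.tail.tail))))

/-- The right and the wrong answers in a tally have the weights 12 and 27. -/
noncomputable def tallyWeight (b : Bool) (i j : ℕ) : ℝ≥0∞ :=
  if b then 12 ^ i * 27 ^ j else 27 ^ i * 12 ^ j

theorem tallyWeight_succ (b : Bool) (y : Data) (i j : ℕ) (r R q : Data) :
    ∃ i' j', tallyUpdate (.cons y (tally (.cons r R) q i j)) = tally R q i' j' ∧
      i' + j' = i + j + 1 ∧ ∀ [Decidable (y = ofBool b)],
        tallyWeight b i' j' ≤ tallyWeight b i j * if y = ofBool b then 12 else 27 := by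
  have h12 : (12 : ℝ≥0∞) ≤ 27 := by norm_num
  by_cases hy : y = .nil
  · subst hy
    refine ⟨i, j + 1, tallyUpdate_nil _ _ _ _ _, by ring, ?_⟩
    cases b
    · simp [tallyWeight, pow_succ, mul_assoc]
    · simp [tallyWeight, pow_succ, mul_assoc, yes]
  · refine ⟨i + 1, j, tallyUpdate_of_ne hy _ _ _ _ _, by ring, ?_⟩
    intro _
    cases b
    · rw [if_neg (by simpa [ofBool] using hy)]
      simp only [tallyWeight, Bool.false_eq_true, if_false]
      exact le_of_eq (by ring)
    · split_ifs
      · simp [tallyWeight, pow_succ, mul_assoc, mul_comm]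
      · simp only [tallyWeight, if_true, pow_succ]
        calc (12 : ℝ≥0∞) ^ i * 12 * 27 ^ j = 12 ^ i * 27 ^ j * 12 := by ring
          _ ≤ _ := by gcongr

/-- As `12 · 27 = 18²`, pairs of a right and a wrong answer weigh as much as two factors 18, and
every surplus wrong answer weighs more than 18. -/
theorem le_pow_mul_pow {i j : ℕ} (h : i ≤ j) : (18 : ℝ≥0∞) ^ (i + j) ≤ 12 ^ i * 27 ^ j := by
  obtain ⟨d, rfl⟩ := Nat.exists_eq_add_of_le h
  calc (18 : ℝ≥0∞) ^ (i + (i + d)) = (18 * 18) ^ i * 18 ^ d := by rw [mul_pow]; ring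
    _ ≤ (12 * 27) ^ i * 27 ^ d := by
      refine mul_le_mul' (pow_le_pow_left₀ zero_le ?_ _) (pow_le_pow_left₀ zero_le ?_ _)
      · exact_mod_cast (by norm_num : 18 * 18 ≤ 12 * 27)
      · exact_mod_cast (by norm_num : 18 ≤ 27)
    _ = _ := by rw [mul_pow, pow_add]; ring

/-- If the majority is wrong, there are at least as many wrong answers as right ones; ties count as
negative. -/
theorem le_tallyWeight {b : Bool} {i j : ℕ} (h : decide (j < i) ≠ b) :
    (18 : ℝ≥0∞) ^ (i + j) ≤ tallyWeight b i j := by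
  cases b
  · have : j ≤ i := by simp at h; omega
    simp only [tallyWeight, Bool.false_eq_true, if_false]
    rw [add_comm, mul_comm]
    exact le_pow_mul_pow this
  · have : i ≤ j := by simpa using h
    simp only [tallyWeight, if_true]
    exact le_pow_mul_pow this

/-- The majority of the answers. -/
def majority (x : Data) : Data := sel (dropLen x.tail.tail.tail x.tail.tail.head) yes .nil

theorem majority_tally (R q : Data) (i j : ℕ) :
    majority (tally R q i j) = ofBool (decide (j < i)) := by
  unfold majority tally
  simp only [Data.tail_cons, Data.head_cons, dropLen_ofNat]
  by_cases h : j < i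
  · rw [sel_of_ne (by simp; omega)]; simp [h]
  · rw [show i - j = 0 by omega]; simp [h]

open Classical in
/-- A program that answers correctly with probability at least `2/3` can be repeated. -/
theorem exists_amplified {P : Program} (ha : P.bound ≤ a) (ha0 : 0 < a) :
    ∃ d : Program, (P.CoinFree → d.CoinFree) ∧ ∃ C : ℕ, ∀ (R q : Data) (b : Bool) (t : ℕ),
      HaltsIn t (init P q) →
      (2 / 3 : ℝ≥0∞) ≤ (run t (init P q)).toOuterMeasure {γ | γ.output ∈ ({ofBool b} : Set Data)} →
      Answers a d (.cons R q) b
        (R.toList.length * (t + ((Data.cons R q).size + 2) ^ C) + ((Data.cons R q).size + 2) ^ C)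
        (17 ^ R.toList.length / 18 ^ R.toList.length) := by
  obtain ⟨-, cu, fu, tu, ⟨Cu, hCu⟩, du⟩ := poly_tallyUpdate (a := a)
  obtain ⟨-, cq, fq, tq, ⟨Cq, hCq⟩, dq⟩ := Poly.id.tail.head (a := a)
  obtain ⟨-, ci, fi, ti, ⟨Ci, hCi⟩, di⟩ :=
    Poly.cons Poly.id.head (Poly.id.tail.cons (Poly.nil.cons Poly.nil)) (a := a)
  obtain ⟨-, cm, fm, tm, ⟨Cm, hCm⟩, dm⟩ :=
    Poly.sel (Poly.id.tail.tail.tail.dropLen Poly.id.tail.tail.head) Poly.yes Poly.nil (a := a)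
  have dm : ∀ x k, Det a cm x k (tm x) (majority x) k := dm
  refine ⟨.seq ci (.seq (loop a (askBody a cq (call a P) cu)) cm), fun h => ?_, ?_⟩
  · exact ⟨fi, ⟨⟨trivial, fq⟩, coinFree_call h, ⟨trivial, trivial, trivial⟩, ⟨trivial, trivial⟩,
      fu⟩, fm⟩
  obtain ⟨C, hC⟩ := exists_pow_bound (g := fun S =>
    (S + 2) ^ Ci + (2 * S + 4) ^ Cm + (2 * S + 4) ^ Cq + (2 * S + 6) ^ Cu + 2 * a + 100) (by
      have h2 (m : ℕ) := (PolyBound.const 2).mul PolyBound.size |>.add (.const m)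
      exact ((((((PolyBound.size.add (.const 2)).pow Ci).add ((h2 4).pow Cm)).add
        ((h2 4).pow Cq)).add ((h2 6).pow Cu)).add (.const _)).add (.const _))
  refine ⟨C, fun R q b t hP hb k => ?_⟩
  set S := (Data.cons R q).size with hS
  have hS' : S = R.size + q.size + 1 := rfl
  have hRS := length_toList_le R
  set N := R.toList.length
  -- The normalized weight of a tally is at least 1 whenever the majority of `N` answers is wrong,
  -- and its expectation grows at most by the factor 17 per answer. So `(17/18)^N` bounds the error
  -- probability, as in Markov's inequality.
  let W : Data → ℝ≥0∞ := fun y =>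
    tallyWeight b y.tail.tail.head.toList.length y.tail.tail.tail.toList.length * (18 ^ N)⁻¹
  have hW : ∀ R i j, W (tally R q i j) = tallyWeight b i j * (18 ^ N)⁻¹ := fun R i j => by simp [W, tally]
  let F : Data → Data → ℝ≥0∞ := fun y k' =>
    if k' = k ∧ ∃ i j, i + j = N ∧ y = tally .nil q i j then W y else ⊤
  have hloop : ∀ (L : List Data) (i j : ℕ), i + j + L.length = N → (ofList L).size ≤ R.size →
      Does a (loop a (askBody a cq (call a P) cu)) (tally (ofList L) q i j) k
        (L.length * (t + ((2 * S + 4) ^ Cq + (2 * S + 6) ^ Cu + 2 * a + 31)) + 1)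
        F (tallyWeight b i j * (18 ^ N)⁻¹ * 17 ^ L.length) := by
    intro L
    induction L with
    | nil =>
      intro i j hij _
      refine (Does.loop_nil rfl).mono (by omega) (fun _ _ => le_rfl) ?_
      rw [show F (tally (ofList []) q i j) k = W (tally (ofList []) q i j) from
        if_pos ⟨rfl, i, j, by simpa using hij, rfl⟩, hW]
      simp
    | cons r L ih =>
      intro i j hij hLR
      set x := tally (ofList (r :: L)) q i j with hx
      have hxs : x.size ≤ 2 * S + 2 := by
        simp only [hx, tally, Data.size_cons, size_ofNat]
        simp only [List.length_cons] at hij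
        omega
      let G : Data → Data → ℝ≥0∞ := fun y k' =>
        if k' = k ∧ ∃ i' j', i' + j' = i + j + 1 ∧ y = tally (ofList L) q i' j' then
          W y * 17 ^ L.length else ⊤
      let H : Data → Data → ℝ≥0∞ := fun y k' =>
        if k' = .cons x k ∧ ∃ b', y = ofBool b' then G (tallyUpdate (.cons y x)) k else ⊤
      have hbody : Does a (askBody a cq (call a P) cu) x k
          ((2 * S + 4) ^ Cq + (t + 2 * a + 10) + (2 * S + 6) ^ Cu + 20) G
          (tallyWeight b i j * (18 ^ N)⁻¹ * 17 ^ (r :: L).length) := by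
        refine (does_askBody (H := H) (fq := fun x => x.tail.head) (fu := tallyUpdate)
          (fun k => (dq x k).mono ((hCq x).trans (Nat.pow_le_pow_left (by omega) Cq)))
          (does_call ha ha0 (x := q) hP (.cons x k) H) fun y k' hy => ?_).mono le_rfl
          (fun _ _ => le_rfl) ?_
        · by_cases hy' : k' = .cons x k ∧ ∃ b', y = ofBool b'
          · refine ⟨hy'.1, fun k => (du _ k).mono ((hCu _).trans (Nat.pow_le_pow_left ?_ Cu)), ?_⟩
            · obtain ⟨-, b', rfl⟩ := hy'
              have := size_ofBool_le b'
              rw [Data.size_cons]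
              omega
            · simp only [H, if_pos hy']
              exact le_rfl
          · exact absurd (by simp only [H, if_neg hy']) hy
        · calc _ ≤ (run t (init P q)).expect fun γ => tallyWeight b i j * (18 ^ N)⁻¹ * 17 ^ L.length *
                if γ ∈ {γ : Config | γ.output ∈ ({ofBool b} : Set Data)} then 12 else 27 := by
                refine PMF.expect_mono_on fun γ _ => ?_
                obtain ⟨i', j', h1, h2, h3⟩ := tallyWeight_succ b (sel γ.output yes .nil) i j r
                  (ofList L) q
                have hb' : ∃ b', sel γ.output yes .nil = ofBool b' := by
                  cases γ.output with
                  | nil => exact ⟨false, rfl⟩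
                  | cons => exact ⟨true, rfl⟩
                simp only [H, true_and, if_pos hb']
                rw [hx, ofList, h1]
                simp only [G, true_and]
                rw [if_pos ⟨i', j', h2, rfl⟩, hW]
                calc _ ≤ tallyWeight b i j *
                      (if γ ∈ {γ : Config | γ.output ∈ ({ofBool b} : Set Data)} then 12 else 27) *
                      (18 ^ N)⁻¹ * 17 ^ L.length := by
                      refine mul_le_mul' (mul_le_mul' (h3.trans (mul_le_mul' le_rfl ?_)) le_rfl)
                        le_rfl
                      by_cases hγ : γ.output = ofBool b
                      · rw [if_pos (by rw [hγ]; cases b <;> rfl),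
                          if_pos (show γ ∈ {γ : Config | γ.output ∈ ({ofBool b} : Set Data)} by
                            simpa using hγ)]
                      · rw [if_neg (show γ ∉ {γ : Config | γ.output ∈ ({ofBool b} : Set Data)} by
                          simpa using hγ)]
                        split_ifs
                        · exact_mod_cast (by norm_num : 12 ≤ 27)
                        · exact le_rfl
                  _ = _ := by ring
            _ ≤ _ := by
                rw [PMF.expect_const_mul, List.length_cons, pow_succ, ← mul_assoc]
                gcongr
                exact expect_ite_le _ _ hb
      refine (hbody.loop_cons (by simp [hx, tally, ofList]) (t' := L.length *
        (t + ((2 * S + 4) ^ Cq + (2 * S + 6) ^ Cu + 2 * a + 31)) + 1) fun y k' hy => ?_).mono ?_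
        (fun _ _ => le_rfl) le_rfl
      · by_cases hy' : k' = k ∧ ∃ i' j', i' + j' = i + j + 1 ∧ y = tally (ofList L) q i' j'
        · simp only [G, if_pos hy']
          obtain ⟨rfl, i', j', h1, rfl⟩ := hy'
          rw [hW]
          refine ih i' j' ?_ ?_
          · simp only [List.length_cons] at hij
            omega
          · simp only [ofList, Data.size_cons] at hLR
            omega
        · exact absurd (by simp only [G, if_neg hy']) hy
      · rw [List.length_cons, add_mul, one_mul]
        omega
  have hinit : Det a ci (.cons R q) k ((S + 2) ^ Ci) (tally (ofList R.toList) q 0 0) k := by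
    rw [ofList_toList]
    exact (di (.cons R q) k).mono (hCi _)
  refine (hinit.seq_does ((hloop R.toList 0 0 (by simp [N]) (by simp)).seq
    (t' := (2 * S + 4) ^ Cm) fun y k' hy => ?_)).mono ?_ (fun _ _ => le_rfl) ?_
  · by_cases hy' : k' = k ∧ ∃ i j, i + j = N ∧ y = tally .nil q i j
    · simp only [F, if_pos hy']
      obtain ⟨rfl, i, j, hij, rfl⟩ := hy'
      rw [hW]
      refine (dm _ _ (verdict b k')).mono ((hCm _).trans (Nat.pow_le_pow_left ?_ Cm))
        (fun _ _ => le_rfl) ?_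
      · simp only [tally, Data.size_cons, Data.size_nil, size_ofNat]
        omega
      · rw [majority_tally]
        by_cases hb' : decide (j < i) = b
        · rw [hb', verdict_right]
          exact zero_le
        · rw [verdict_wrong hb', ← hij]
          calc (1 : ℝ≥0∞) = 18 ^ (i + j) * (18 ^ (i + j))⁻¹ :=
                (ENNReal.mul_inv_cancel (by simp) (by simp)).symm
            _ ≤ _ := by
              gcongr
              exact le_tallyWeight hb'
    · exact absurd (by simp only [F, if_neg hy']) hy
  · have := hC S
    change _ ≤ N * _ + _
    change 1 + (S + 2) ^ Ci + (1 + (N * _ + 1) + _) ≤ _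
    have h3 : N * (t + ((2 * S + 4) ^ Cq + (2 * S + 6) ^ Cu + 2 * a + 31)) ≤
        N * (t + (S + 2) ^ C) := by gcongr; omega
    omega
  · simp [tallyWeight, div_eq_mul_inv, mul_comm, N]

end TreeMachine

/-! ### Depth-first search over the tree shapes -/

namespace TreeMachine

variable {a : ℕ}

/-! ## The states of the search -/

/-- An item of the search: the chosen rows, the numbers of leaves of the pattern tree, the number of
leaves to be added, and the budget for children of the root. -/
structure Item : Type where
  u : List Data
  σ : List ℕ
  a : ℕ
  b : ℕ

namespace Item

/-- The encoding of an item. -/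
def toData (it : Item) : Data :=
  .cons (ofList it.u) (.cons (ofNat it.σ.length) (.cons (ofList (branchLabels it.σ))
    (.cons (ofNat it.a) (ofNat it.b))))

/-- The item with one more child of the root. -/
def opened (c : ℕ) (it : Item) : List Item :=
  if c ≤ it.b then [⟨it.u, 0 :: it.σ, it.a, it.b - c⟩] else []

/-- The item with one more leaf. -/
def extended (it : Item) : List Item :=
  match it.σ with
  | [] => []
  | s :: σ => [⟨it.u, (s + 1) :: σ, it.a - 1, it.b⟩]

/-- The items that replace an item. -/
def next (c : ℕ) (it : Item) : List Item := if it.a = 0 then [] else it.opened c ++ it.extended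

/-- Children are numbered from the end of the list and every child is listed after its leaves. Hence
a new child, or a new leaf of the first child, merely prepends one label and renames nothing. -/
theorem openChild_toData (c : ℕ) (it : Item) :
    openChild c it.toData = ofList ((it.opened c).map toData) := by
  unfold openChild opened
  by_cases h : c ≤ it.b
  · rw [sel_of_ne (by rw [mulLe_ne_nil]; simpa [toData, yes] using h), if_pos h]
    simp [toData, branchLabels]
  · have : mulLe c yes it.toData.tail.tail.tail.tail = .nil := by
      by_contra h'
      rw [← Ne, mulLe_ne_nil] at h'
      exact h (by simpa [toData, yes] using h')
    rw [this, if_neg h]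
    rfl

theorem addLeaf_toData (it : Item) : addLeaf it.toData = ofList (it.extended.map toData) := by
  obtain ⟨u, σ, a, b⟩ := it
  cases σ with
  | nil => rfl
  | cons s σ =>
    simp [addLeaf, toData, extended, branchLabels, List.replicate_succ]

/-- An item leads to a pattern tree in the host graph. -/
def Works (c p n : ℕ) (rows : List Data) (it : Item) : Prop :=
  Found (Embeds c p n rows it.u) c it.σ it.a it.b

theorem works_iff {c p n : ℕ} {rows : List Data} {it : Item} : it.Works c p n rows ↔
    (it.a = 0 ∧ Embeds c p n rows it.u it.σ) ∨ ∃ it' ∈ it.next c, it'.Works c p n rows := by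
  obtain ⟨u, σ, a, b⟩ := it
  constructor
  · intro h
    cases h with
    | leaf h => exact Or.inl ⟨rfl, h⟩
    | openChild hb h => exact Or.inr ⟨⟨u, 0 :: σ, _, b - c⟩, List.mem_append_left _
        (by rw [opened, if_pos hb]; exact List.mem_singleton_self _), h⟩
    | @addLeaf s σ _ _ h => exact Or.inr ⟨⟨u, (s + 1) :: σ, _, b⟩, List.mem_append_right _
        (List.mem_singleton_self _), h⟩
  · rintro (⟨rfl, h⟩ | ⟨it', h, h'⟩)
    · exact .leaf h
    · cases a with
      | zero => simp [next] at h
      | succ a =>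
        simp only [next, Nat.succ_ne_zero, if_false, List.mem_append, opened, extended] at h
        rcases h with h | h
        · split_ifs at h with hb
          · obtain rfl := List.mem_singleton.1 h
            exact .openChild hb h'
          · simp at h
        · cases σ with
          | nil => simp at h
          | cons s σ =>
            obtain rfl := List.mem_singleton.1 h
            exact .addLeaf h'

-- The invariant of the search: what the flag and the pending items promise together does not change
-- when the first item is processed with the correct answer.
open Classical in
theorem exists_works_next (c p n : ℕ) (rows : List Data) (it : Item) (its : List Item) (f : Bool) :
    (f = true ∨ ∃ it' ∈ it :: its, it'.Works c p n rows) ↔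
      (if it.a = 0 then decide (Embeds c p n rows it.u it.σ) || f else f) = true ∨
        ∃ it' ∈ it.next c ++ its, it'.Works c p n rows := by
  have h1 : (∃ it' ∈ it :: its, it'.Works c p n rows) ↔
      it.Works c p n rows ∨ ∃ it' ∈ its, it'.Works c p n rows := by simp
  have h2 : (∃ it' ∈ it.next c ++ its, it'.Works c p n rows) ↔
      (∃ it' ∈ it.next c, it'.Works c p n rows) ∨ ∃ it' ∈ its, it'.Works c p n rows := by
    simp only [List.mem_append, or_and_right, exists_or]
  rw [h1, h2, works_iff (it := it)]
  by_cases ha : it.a = 0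
  · simp only [ha, if_true, Bool.or_eq_true, decide_eq_true_eq, true_and, or_assoc]
    exact or_left_comm
  · simp only [ha, if_false, false_and, false_or]

/-- The total number of states below some items. -/
def total (c : ℕ) (its : List Item) : ℕ := (its.map fun it => nodes c it.a it.b).sum

theorem total_append (c : ℕ) (l l' : List Item) : total c (l ++ l') = total c l + total c l' := by
  simp [total]

/-- The inequality is strict because `nodes` counts the item itself; this makes `total` the measure
that bounds the number of questions. -/
theorem total_next_lt {c : ℕ} (hc : 0 < c) (it : Item) :
    total c (it.next c) < nodes c it.a it.b := by
  obtain ⟨u, σ, a, b⟩ := it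
  cases a with
  | zero => simp [next, total, nodes]
  | succ a =>
    simp only [next, Nat.succ_ne_zero, if_false, total_append]
    rw [nodes]
    have h1 : total c (opened c ⟨u, σ, a + 1, b⟩) ≤
        if 0 < c ∧ c ≤ b then nodes c (a + 1) (b - c) else 0 := by
      unfold opened
      by_cases hb : c ≤ b
      · simp [hb, hc, total]
      · simp [hb, total]
    have h2 : total c (extended ⟨u, σ, a + 1, b⟩) ≤ nodes c a b := by
      cases σ <;> simp [extended, total]
    simp only [dite_eq_ite]
    omega

/-- The invariant of the items. -/
structure Valid (c p t : ℕ) (rows : List Data) (it : Item) : Prop where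
  length_u : it.u.length ≤ c + c * c
  mem_rows : ∀ r ∈ it.u, r ∈ rows
  sum_le : it.σ.sum + it.a ≤ p
  length_le : c * it.σ.length + it.b ≤ t

theorem Valid.next {c p t : ℕ} {rows : List Data} {it : Item} (h : it.Valid c p t rows) {it' : Item}
    (h' : it' ∈ it.next c) :
    it'.Valid c p t rows ∧ it'.u = it.u := by
  obtain ⟨u, σ, a, b⟩ := it
  obtain ⟨h1, h2, h3, h4⟩ := h
  cases a with
  | zero => simp [Item.next] at h'
  | succ a =>
    simp only [Item.next, Nat.succ_ne_zero, if_false, List.mem_append, opened, extended] at h'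
    rcases h' with h | h
    · split_ifs at h with hb
      · obtain rfl := List.mem_singleton.1 h
        refine ⟨⟨h1, h2, by simpa using h3, ?_⟩, rfl⟩
        simp only [List.length_cons, mul_add, mul_one] at h4 ⊢
        omega
      · simp at h
    · cases σ with
      | nil => simp at h
      | cons s σ =>
        obtain rfl := List.mem_singleton.1 h
        refine ⟨⟨h1, h2, ?_, by simpa using h4⟩, rfl⟩
        simp only [List.sum_cons] at h3 ⊢
        omega

/-- The quantity that increases along the stack of the search. -/
def weight (it : Item) : ℕ := it.a + it.b

/-- Opening a child lowers the weight by `c` and adding a leaf lowers it by 1, so the two successors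
are in strict order only for `c ≥ 2`. Strictly increasing weights keep the stack of a depth-first
search short although the search tree is exponential. -/
theorem pairwise_next {c : ℕ} (hc : 2 ≤ c) (it : Item) :
    (it.next c).Pairwise (fun x y => x.weight < y.weight) ∧
      ∀ x ∈ it.next c, x.weight < it.weight := by
  obtain ⟨u, σ, a, b⟩ := it
  cases a with
  | zero => simp [next]
  | succ a =>
    by_cases hb : c ≤ b
    · cases σ <;> simp [next, opened, extended, hb, weight] <;> omega
    · cases σ <;> simp [next, opened, extended, hb, weight]

theorem length_le_of_pairwise {l : List Item} {B : ℕ}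
    (h : l.Pairwise (fun x y => x.weight < y.weight)) (hB : ∀ x ∈ l, x.weight ≤ B) :
    l.length ≤ B + 1 := by
  have h1 : (l.map weight).Nodup :=
    (List.pairwise_map.2 h).imp fun h => h.ne
  have h2 := List.toFinset_card_of_nodup h1
  rw [List.length_map] at h2
  rw [← h2, ← Finset.card_range (B + 1)]
  refine Finset.card_le_card fun x hx => ?_
  simp only [List.mem_toFinset, List.mem_map] at hx
  obtain ⟨it, hit, rfl⟩ := hx
  simpa using Nat.lt_succ_of_le (hB it hit)

end Item

theorem size_branchLabels_le (σ : List ℕ) :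
    (ofList (branchLabels σ)).size ≤ (σ.sum + σ.length) * (σ.length + 6) := by
  rw [← length_branchLabels]
  refine size_ofList_le fun x hx => ?_
  obtain ⟨j, -, h1, rfl | ⟨rfl, -⟩⟩ := mem_branchLabels hx
  · simp [groupLabel, yes]; omega
  · simp [elemLabel, yes]; omega

theorem Item.Valid.size_le {c p t X : ℕ} {rows : List Data} {it : Item}
    (h : it.Valid c p t rows) (hc : 0 < c) (hp : p ≤ X) (ht : t ≤ X)
    (hr : ∀ r ∈ rows, r.size ≤ X) :
    it.toData.size ≤ (c + c * c) * (X + 1) + X + 2 * X * (X + 6) + 2 * X + 4 := by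
  obtain ⟨h1, h2, h3, h4⟩ := h
  have h5 : (ofList it.u).size ≤ (c + c * c) * (X + 1) :=
    (size_ofList_le fun x hx => hr x (h2 x hx)).trans (Nat.mul_le_mul_right _ h1)
  have h6 : it.σ.length ≤ c * it.σ.length := Nat.le_mul_of_pos_left _ hc
  have h7 : (ofList (branchLabels it.σ)).size ≤ 2 * X * (X + 6) :=
    (size_branchLabels_le _).trans (Nat.mul_le_mul (by omega) (by omega))
  simp only [toData, Data.size_cons, size_ofNat]
  omega

/-- The data that do not change during the search. -/
def context (Rl : Data) (p n : ℕ) (rows : List Data) : Data :=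
  .cons Rl (.cons (ofNat p) (.cons (ofNat n) (ofList rows)))

/-- The encoding of a state of the search. -/
def searchState (ctx : Data) (its : List Item) (f : Bool) : Data :=
  .cons (ofList (its.map Item.toData)) (.cons (ofBool f) ctx)

theorem searchQuery_searchState (c p n : ℕ) (Rl : Data) (rows : List Data) (it : Item)
    (its : List Item) (f : Bool) :
    searchQuery c (searchState (context Rl p n rows) (it :: its) f) = .cons Rl (queryOf c (ofNat p)
      (ofNat n) (ofList rows) (ofList it.u) (ofList (branchLabels it.σ))) := rfl

theorem searchUpdate_searchState (c : ℕ) (ctx : Data) (b : Bool) (it : Item) (its : List Item)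
    (f : Bool) : searchUpdate c (.cons (ofBool b) (searchState ctx (it :: its) f)) =
      searchState ctx (it.next c ++ its) (if it.a = 0 then b || f else f) := by
  unfold searchUpdate searchState
  simp only [List.map_cons, ofList_cons, Data.tail_cons, Data.head_cons, Item.openChild_toData,
    Item.addLeaf_toData]
  rw [show it.toData.tail.tail.tail.head = ofNat it.a from rfl]
  by_cases ha : it.a = 0
  · simp only [ha, ofNat_zero, sel_nil, if_true, Item.next, List.nil_append]
    cases b <;> rfl
  · rw [sel_of_ne (by simpa using ha), if_neg ha]
    simp [Item.next, ha, app]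

theorem searchInit_eq (j p n t : ℕ) (Rl : Data) (rows : List Data) :
    ∃ its : List Item, searchInit j (.cons (context Rl p n rows) (ofNat t)) =
        searchState (context Rl p n rows) its false ∧ its.length ≤ (rows.length + 1) ^ j ∧
      ∀ it, it ∈ its ↔ ∃ L : List Data, L.length ≤ j ∧ L.length ≤ t ∧ (∀ r ∈ L, r ∈ rows) ∧
        it = ⟨L, [], p - (cov n L).card, t - L.length⟩ := by
  have h : ∀ s ∈ (selections j (ofList rows) (ofNat t)).toList, ∃ L : List Data,
      L.length ≤ j ∧ L.length ≤ t ∧ (∀ r ∈ L, r ∈ rows) ∧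
        s = .cons (ofList L) (ofNat (t - L.length)) := fun s hs => mem_selections.1 hs
  refine ⟨(selections j (ofList rows) (ofNat t)).toList.map fun s => ⟨s.head.toList, [],
    p - (cov n s.head.toList).card, s.tail.toList.length⟩, ?_, ?_, ?_⟩
  · unfold searchInit searchState context
    simp only [Data.head_cons, Data.tail_cons, ofBool_false, List.map_map]
    congr 2
    refine List.map_congr_left fun s hs => ?_
    obtain ⟨L, -, -, -, rfl⟩ := h s hs
    have h1 (x : Data) : dropLen x (ofNat p) = ofNat (p - x.toList.length) := by
      simp [dropLen, ofNat]
    have h2 : cov n [] = ∅ := by simp [cov]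
    simp [Item.toData, branchLabels, h1, length_newColumns_eq, h2]
  · rw [List.length_map]
    have := length_selections j (ofList rows) (ofNat t)
    rwa [toList_ofList] at this
  · intro it
    simp only [List.mem_map]
    constructor
    · rintro ⟨s, hs, rfl⟩
      obtain ⟨L, h1, h2, h3, rfl⟩ := h s hs
      exact ⟨L, h1, h2, h3, by simp⟩
    · rintro ⟨L, h1, h2, h3, rfl⟩
      exact ⟨_, mem_selections.2 ⟨L, h1, h2, h3, rfl⟩, by simp⟩

/-- The states of the search: items that have been added, initial items, and the flag. -/
structure SearchState : Type where
  fresh : List Item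
  old : List Item
  flag : Bool

-- The state stays polynomial: the added items have distinct weights of at most `p + t`, and the
-- initial items, polynomially many, only become fewer. The number of questions is at most that of
-- initial items times the bound `V` for the search tree of each.
open Classical in
theorem exists_search {c : ℕ} (hc : 2 ≤ c) (d : Program) : ∃ D : Program,
    (d.CoinFree → D.CoinFree) ∧ ∃ C : ℕ, ∀ (Rl : Data) (p n t : ℕ) (rows : List Data) (V τ : ℕ)
      (e : ℝ≥0∞),
      (∀ (u : List Data) (σ : List ℕ), σ.sum ≤ p → c * σ.length ≤ t →
        Answers a d (.cons Rl (queryOf c (ofNat p) (ofNat n) (ofList rows) (ofList u)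
          (ofList (branchLabels σ)))) (decide (Embeds c p n rows u σ)) τ e) →
      (∀ i ≤ p, ∀ j ≤ t, nodes c i j ≤ V) →
      Answers a D (.cons (context Rl p n rows) (ofNat t)) (decide (Feasible p n rows t))
        ((rows.length + 1) ^ (c + c * c) * V *
            (((Data.cons (context Rl p n rows) (ofNat t)).size + 2) ^ C + τ) +
          ((Data.cons (context Rl p n rows) (ofNat t)).size + 2) ^ C)
        ((rows.length + 1) ^ (c + c * c) * V * e) := by
  have hc0 : 0 < c := by omega
  obtain ⟨-, ci, fi, ti, ⟨Ci, hCi⟩, di⟩ := Poly.searchInit (a := a) (c + c * c)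
  obtain ⟨-, cf, ff, tf, ⟨Cf, hCf⟩, df⟩ := Poly.id.tail.head (a := a)
  obtain ⟨dl, fl, Cl, hl⟩ := exists_askLoop (Poly.searchQuery (a := a) c)
    (Poly.searchUpdate c) d
  obtain ⟨Cs, hCs⟩ := exists_pow_bound (g := fun X =>
    (2 * X + 1 + (X + 1) ^ (c + c * c)) *
      ((c + c * c) * (X + 1) + X + 2 * X * (X + 6) + 2 * X + 4 + 1) + X + 2) (by
      have hX := PolyBound.size
      have h1 := hX.add (.const 1)
      have h2 := (PolyBound.const 2).mul hX
      have h3 := (((PolyBound.const (c + c * c)).mul h1).add hX).add (h2.mul (hX.add (.const 6)))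
      exact ((((h2.add (.const 1)).add (h1.pow _)).mul
        (((h3.add h2).add (.const 4)).add (.const 1))).add hX).add (.const 2))
  obtain ⟨C, hC⟩ := exists_pow_bound (g := fun X =>
    (X + 2) ^ Ci + ((X + 2) ^ Cs + 2) ^ Cl + ((X + 2) ^ Cs + 2) ^ Cf + 3) (by
      have h2 := PolyBound.size.add (.const 2)
      have hs := (h2.pow Cs).add (.const 2)
      exact (((h2.pow Ci).add (hs.pow Cl)).add (hs.pow Cf)).add (.const 3))
  refine ⟨.seq ci (.seq dl cf), fun h => ⟨fi, fl h, ff⟩, C, fun Rl p n t rows V τ e hans hV k => ?_⟩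
  set X := (Data.cons (context Rl p n rows) (ofNat t)).size with hX
  have hX' : X = Rl.size + (p + (n + (ofList rows).size + 1) + 1) + 1 + t + 1 := by
    simp [hX, context]
  obtain ⟨its, h1, h2, h3⟩ := searchInit_eq (c + c * c) p n t Rl rows
  have hrow : ∀ r ∈ rows, r.size ≤ X := fun r hr => by
    have := size_le_of_mem_toList (x := ofList rows) (y := r) (by simpa using hr)
    omega
  have hrows : rows.length ≤ X := by
    have := length_toList_le (ofList rows)
    rw [toList_ofList] at this
    omega
  let enc : SearchState → Data := fun s => searchState (context Rl p n rows) (s.fresh ++ s.old) s.flag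
  let Inv : SearchState → Prop := fun s =>
    s.fresh.Pairwise (fun x y => x.weight < y.weight) ∧ s.old.length ≤ its.length ∧
      ∀ it ∈ s.fresh ++ s.old, it.Valid c p t rows
  let Good : SearchState → Prop := fun s =>
    (s.flag = true ∨ ∃ it ∈ s.fresh ++ s.old, it.Works c p n rows) ↔ Feasible p n rows t
  let Q : Data → Bool → Prop := fun x b => ∃ (u : List Data) (σ : List ℕ), σ.sum ≤ p ∧
    c * σ.length ≤ t ∧ x = .cons Rl (queryOf c (ofNat p) (ofNat n) (ofList rows) (ofList u)
      (ofList (branchLabels σ))) ∧ b = decide (Embeds c p n rows u σ)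
  have hsize : ∀ s, Inv s → (enc s).size ≤ (X + 2) ^ Cs := by
    rintro ⟨fresh, old, f⟩ ⟨i1, i2, i3⟩
    refine le_trans ?_ (hCs X)
    have h4 : fresh.length ≤ 2 * X + 1 := Item.length_le_of_pairwise i1 fun it hit => by
      obtain ⟨-, -, h5, h6⟩ := i3 it (List.mem_append_left _ hit)
      unfold Item.weight
      omega
    have h5 : (fresh ++ old).length ≤ 2 * X + 1 + (X + 1) ^ (c + c * c) := by
      rw [List.length_append]
      exact Nat.add_le_add h4 (i2.trans (h2.trans (Nat.pow_le_pow_left (by omega) _)))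
    have h6 : (ofList ((fresh ++ old).map Item.toData)).size ≤ (fresh ++ old).length *
        ((c + c * c) * (X + 1) + X + 2 * X * (X + 6) + 2 * X + 4 + 1) := by
      have := size_ofList_le (l := (fresh ++ old).map Item.toData) fun x hx => by
        obtain ⟨it, hit, rfl⟩ := List.mem_map.1 hx
        exact (i3 it hit).size_le hc0 (X := X) (by omega) (by omega) hrow
      rwa [List.length_map] at this
    have h7 := Nat.mul_le_mul_right
      ((c + c * c) * (X + 1) + X + 2 * X * (X + 6) + 2 * X + 4 + 1) h5
    have h8 := size_ofBool_le f
    have h9 : (context Rl p n rows).size + 1 ≤ X := by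
      rw [hX, Data.size_cons]; omega
    simp only [enc, searchState, Data.size_cons]
    omega
  have hstep : ∀ s, Inv s → (enc s).head ≠ .nil → ∃ b, Q (searchQuery c (enc s)) b ∧
      ∀ b', ∃ s', searchUpdate c (.cons (ofBool b') (enc s)) = enc s' ∧ Inv s' ∧
        Item.total c (s'.fresh ++ s'.old) < Item.total c (s.fresh ++ s.old) ∧
        (b' = b → Good s → Good s') := by
    rintro ⟨fresh, old, f⟩ ⟨i1, i2, i3⟩ hne
    -- An initial item is taken only when no added items are left, so its successors start a new
    -- increasing stack.
    obtain ⟨it, fresh', old', hsplit, j1, j2⟩ : ∃ it fresh' old', fresh ++ old =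
        it :: (fresh' ++ old') ∧ (it.next c ++ fresh').Pairwise (fun x y => x.weight < y.weight) ∧
        old'.length ≤ its.length := by
      have hn := Item.pairwise_next hc
      cases fresh with
      | nil =>
        cases old with
        | nil => exact (hne rfl).elim
        | cons it old => exact ⟨it, [], old, rfl, by simpa using (hn it).1, by
            simp only [List.length_cons] at i2; omega⟩
      | cons it fresh =>
        rw [List.pairwise_cons] at i1
        refine ⟨it, fresh, old, rfl, ?_, i2⟩
        rw [List.pairwise_append]
        exact ⟨(hn it).1, i1.2, fun x hx y hy => ((hn it).2 x hx).trans (i1.1 y hy)⟩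
    simp only at i3
    rw [hsplit] at i3
    simp only [List.mem_cons, forall_eq_or_imp] at i3
    obtain ⟨hit, i3⟩ := i3
    refine ⟨decide (Embeds c p n rows it.u it.σ), ?_, fun b' => ⟨⟨it.next c ++ fresh', old',
      if it.a = 0 then b' || f else f⟩, ?_, ⟨j1, j2, ?_⟩, ?_, ?_⟩⟩
    · refine ⟨it.u, it.σ, by have := hit.sum_le; omega, by have := hit.length_le; omega, ?_, rfl⟩
      simp only [enc, hsplit]
      exact searchQuery_searchState ..
    · simp only [enc, hsplit, List.append_assoc]
      exact searchUpdate_searchState ..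
    · intro it' h'
      rw [List.append_assoc, List.mem_append] at h'
      exact h'.elim (fun h => (hit.next h).1) (i3 it')
    · simp only [hsplit, List.append_assoc]
      rw [Item.total_append]
      have := Item.total_next_lt hc0 it
      simp only [Item.total, List.map_cons, List.sum_cons] at this ⊢
      omega
    · rintro rfl hg
      simp only [Good] at hg ⊢
      rw [← hg, hsplit, List.append_assoc]
      exact (Item.exists_works_next ..).symm
  have hinit : Inv ⟨[], its, false⟩ := ⟨List.Pairwise.nil, le_rfl, fun it hit => by
    obtain ⟨L, k1, k2, k3, rfl⟩ := (h3 it).1 (by simpa using hit)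
    exact ⟨k1, k3, by simp, by simp⟩⟩
  have hgood : Good ⟨[], its, false⟩ := by
    simp only [Good, Bool.false_eq_true, false_or, List.nil_append, feasible_iff hc0, h3]
    constructor
    · rintro ⟨it, ⟨L, k1, k2, k3, rfl⟩, k4⟩
      exact ⟨L, k1, k2, k3, k4⟩
    · rintro ⟨L, k1, k2, k3, k4⟩
      exact ⟨_, ⟨L, k1, k2, k3, rfl⟩, k4⟩
  have hM : Item.total c its ≤ (rows.length + 1) ^ (c + c * c) * V := by
    refine le_trans ?_ (Nat.mul_le_mul_right V h2)
    unfold Item.total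
    have := List.sum_le_card_nsmul (its.map fun it => nodes c it.a it.b) V fun x hx => by
      obtain ⟨it, hit, rfl⟩ := List.mem_map.1 hx
      obtain ⟨L, k1, k2, k3, rfl⟩ := (h3 it).1 hit
      exact hV _ (by simp) _ (by simp)
    simpa using this
  have hloop := hl enc Inv Good Q (fun s => Item.total c (s.fresh ++ s.old)) ((X + 2) ^ Cs) τ e
    (by rintro _ _ ⟨u, σ, k1, k2, rfl, rfl⟩; exact hans u σ k1 k2) hsize hstep ⟨[], its, false⟩ k
    hinit
  rw [if_pos hgood, zero_add, List.nil_append] at hloop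
  have hi : Det a ci (.cons (context Rl p n rows) (ofNat t)) k ((X + 2) ^ Ci)
      (enc ⟨[], its, false⟩) k := by
    have := (di (.cons (context Rl p n rows) (ofNat t)) k).mono (hCi _)
    rwa [h1] at this
  refine (hi.seq_does (hloop.seq (t' := ((X + 2) ^ Cs + 2) ^ Cf) fun y k' hy => ?_)).mono ?_
    (fun _ _ => le_rfl) ?_
  · obtain ⟨rfl, ⟨fresh, old, f⟩, rfl, j1, j2, j3⟩ := loopVerdict_ne_top hy
    refine (df (enc ⟨fresh, old, f⟩) k' (verdict _ k')).mono ((hCf _).trans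
      (Nat.pow_le_pow_left (Nat.add_le_add_right (hsize _ j1) 2) Cf)) (fun _ _ => le_rfl) ?_
    change verdict _ k' (ofBool f) k' ≤ _
    rcases j3 with j3 | j3
    · have hnil : fresh ++ old = [] := by
        have : ofList ((fresh ++ old).map Item.toData) = ofList [] := j2
        simpa using ofList_injective this
      simp only [Good, hnil, List.not_mem_nil, false_and, exists_false, or_false] at j3
      rw [show f = decide (Feasible p n rows t) by
        rw [Bool.eq_iff_iff, decide_eq_true_eq]; exact j3, verdict_right]
      exact zero_le
    · rw [j3]
      by_cases hf : f = decide (Feasible p n rows t)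
      · rw [hf, verdict_right]
        exact zero_le
      · rw [verdict_wrong hf]
  · have h4 := hC X
    have h5 : Item.total c its * (((X + 2) ^ Cs + 2) ^ Cl + τ) ≤
        (rows.length + 1) ^ (c + c * c) * V * ((X + 2) ^ C + τ) :=
      Nat.mul_le_mul hM (by omega)
    change 1 + (X + 2) ^ Ci + (1 + (Item.total c its * (((X + 2) ^ Cs + 2) ^ Cl + τ) + 1) +
      ((X + 2) ^ Cs + 2) ^ Cf) ≤ _
    omega
  · gcongr
    exact_mod_cast hM

end TreeMachine

/-! ### From deciding feasibility to finding a smallest subfamily -/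

namespace TreeMachine

variable {a : ℕ}

/-! ## Subfamilies -/

section Family

variable {n m : ℕ} (S : Fin m → Finset (Fin n)) (p : ℕ)

/-- At most `t` sets of the subfamily `A` cover at least `p` elements. -/
def HasCover (A : Finset (Fin m)) (t : ℕ) : Prop :=
  ∃ J ⊆ A, J.card ≤ t ∧ IsPartialCover S p J

variable {S p}

theorem HasCover.mono {A B : Finset (Fin m)} {t : ℕ} (h : HasCover S p A t) (hAB : A ⊆ B) :
    HasCover S p B t :=
  let ⟨J, h1, h2⟩ := h
  ⟨J, h1.trans hAB, h2⟩

/-- A cover inside `K` with at most `t` sets cannot omit a member of `K`, since none is dispensable.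
So it is `K` itself, and no cover has fewer than `t` sets. -/
theorem isMinPartialCover_of_hasCover {K : Finset (Fin m)} {t : ℕ} (h1 : HasCover S p K t)
    (h2 : ∀ i ∈ K, ¬ HasCover S p (K.erase i) t)
    (h3 : t = 0 ∨ 0 < t ∧ ¬ HasCover S p Finset.univ (t - 1)) : IsMinPartialCover S p K := by
  obtain ⟨J, hJ, hJt, hJc⟩ := h1
  obtain rfl : J = K := by
    refine hJ.antisymm fun i hi => ?_
    by_contra hiJ
    exact h2 i hi ⟨J, Finset.subset_erase.2 ⟨hJ, hiJ⟩, hJt, hJc⟩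
  refine ⟨hJc, fun J' hJ' => hJt.trans ?_⟩
  rcases h3 with rfl | ⟨h3, h4⟩
  · exact Nat.zero_le _
  · by_contra h
    exact h4 ⟨J', Finset.subset_univ _, by omega, hJ'⟩

/-- One set for each of `p` covered elements suffices, so a bound of `p` on the number of sets is no
restriction. -/
theorem not_isPartialCover (h : ¬ HasCover S p Finset.univ p) (I : Finset (Fin m)) :
    ¬ IsPartialCover S p I := by
  classical
  intro hI
  obtain ⟨T, hT, rfl⟩ := Finset.exists_subset_card_eq hI
  have h1 : ∀ e ∈ T, ∃ i, e ∈ S i := fun e he => by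
    obtain ⟨i, -, hi⟩ := Finset.mem_biUnion.1 (hT he)
    exact ⟨i, hi⟩
  by_cases hm : Nonempty (Fin m)
  · choose! g hg using h1
    refine h ⟨T.image g, Finset.subset_univ _, Finset.card_image_le, Finset.card_le_card fun e he =>
      Finset.mem_biUnion.2 ⟨g e, Finset.mem_image_of_mem g he, hg e he⟩⟩
  · obtain rfl : T = ∅ := Finset.eq_empty_of_forall_notMem fun e he => hm ⟨(h1 e he).choose⟩
    exact h ⟨∅, by simp, by simp, by simp [IsPartialCover]⟩

theorem hasBit_ofSet {e : ℕ} {s : Set (Fin n)} :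
    HasBit e (ofSet s) ↔ ∃ h : e < n, (⟨e, h⟩ : Fin n) ∈ s := by
  classical
  unfold HasBit ofSet dropLen
  rw [toList_ofList, length_ofNat]
  by_cases h : e < n
  · rw [List.drop_eq_getElem_cons (by simpa using h)]
    by_cases h' : (⟨e, h⟩ : Fin n) ∈ s <;> simp [h, h']
  · rw [List.drop_of_length_le (by simpa using h)]
    simp [h]

theorem feasible_map_iff {l : List (Fin m)} {t : ℕ} :
    Feasible p n (l.map fun i => ofSet (S i : Set (Fin n))) t ↔ HasCover S p l.toFinset t := by
  classical
  constructor
  · rintro ⟨L, h1, h2, h3⟩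
    have h4 : ∀ r ∈ L, ∃ i, i ∈ l ∧ ofSet (S i : Set (Fin n)) = r := fun r hr => by
      simpa using h2 r hr
    by_cases hm : Nonempty (Fin m)
    -- Different sets can have equal rows; one index is chosen for each row.
    · choose! g hg using h4
      refine ⟨(L.map g).toFinset, fun i hi => ?_, (List.toFinset_card_le _).trans (by simpa using h1),
        h3.trans ?_⟩
      · simp only [List.mem_toFinset, List.mem_map] at hi
        obtain ⟨r, hr, rfl⟩ := hi
        simpa using (hg r hr).1
      · rw [← Finset.card_map Fin.valEmbedding]
        refine Finset.card_le_card fun e he => ?_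
        obtain ⟨he, r, hr, hr'⟩ := mem_cov.1 he
        rw [← (hg r hr).2, hasBit_ofSet] at hr'
        obtain ⟨h5, h6⟩ := hr'
        simp only [Finset.mem_map, Finset.mem_biUnion, List.mem_toFinset, List.mem_map]
        exact ⟨⟨e, he⟩, ⟨g r, ⟨r, hr, rfl⟩, by simpa using h6⟩, rfl⟩
    · obtain rfl : L = [] := List.eq_nil_iff_forall_not_mem.2 fun r hr => hm ⟨(h4 r hr).choose⟩
      refine ⟨∅, by simp, by simp, ?_⟩
      simpa [IsPartialCover, cov] using h3
  · rintro ⟨J, h1, h2, h3⟩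
    refine ⟨J.toList.map fun i => ofSet (S i : Set (Fin n)), by simpa using h2, fun r hr => ?_,
      le_trans (Nat.le_trans h3 ?_) le_rfl⟩
    · simp only [List.mem_map, Finset.mem_toList] at hr ⊢
      obtain ⟨i, hi, rfl⟩ := hr
      exact ⟨i, by simpa using h1 hi, rfl⟩
    · rw [← Finset.card_map Fin.valEmbedding]
      refine Finset.card_le_card fun e he => ?_
      simp only [Finset.mem_map, Finset.mem_biUnion] at he
      obtain ⟨e, ⟨i, hi, hi'⟩, rfl⟩ := he
      refine mem_cov.2 ⟨e.2, _, List.mem_map.2 ⟨i, by simpa using hi, rfl⟩, ?_⟩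
      rw [hasBit_ofSet]
      exact ⟨e.2, by simpa using hi'⟩

end Family

/-! ## The states of the greedy search -/

/-- A state: the remaining rounds for the bound, the bound, the remaining sets, and the sets that
have been examined, with the information whether they have been kept. -/
structure GreedyState (m : ℕ) : Type where
  q : ℕ
  t : ℕ
  rest : List (Fin m)
  done : List (Fin m × Bool)

namespace GreedyState

variable {m n : ℕ}

/-- The sets that have been kept. -/
def kept (done : List (Fin m × Bool)) : List (Fin m) :=
  ((done.filter fun x => x.2).map fun x => x.1).reverse

@[simp] theorem kept_cons_true (i : Fin m) (done : List (Fin m × Bool)) :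
    kept ((i, true) :: done) = kept done ++ [i] := by simp [kept]

@[simp] theorem kept_cons_false (i : Fin m) (done : List (Fin m × Bool)) :
    kept ((i, false) :: done) = kept done := by simp [kept]

theorem mem_kept {i : Fin m} {done : List (Fin m × Bool)} : i ∈ kept done ↔ (i, true) ∈ done := by
  simp [kept]

/-- The sets that have not been dropped. -/
def alive (s : GreedyState m) : List (Fin m) := s.rest ++ kept s.done

theorem length_kept_le (done : List (Fin m × Bool)) : (kept done).length ≤ done.length := by
  simpa [kept] using List.length_filter_le _ done

/-- The encoding of a state. -/
noncomputable def toData (ctx : Data) (S : Fin m → Finset (Fin n)) (s : GreedyState m) : Data :=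
  .cons (ofList (List.replicate s.q .nil ++ List.replicate s.rest.length yes))
    (.cons ctx (.cons (ofNat s.t) (.cons
      (ofList (s.alive.map fun i => ofSet (S i : Set (Fin n))))
      (ofList (s.done.map fun x => ofBool x.2)))))

/-- The next state. -/
def next (b : Bool) : GreedyState m → GreedyState m
  | ⟨q + 1, t, rest, done⟩ => ⟨q, if b then t - 1 else t, rest, done⟩
  | ⟨0, t, i :: rest, done⟩ => ⟨0, t, rest, (i, !b) :: done⟩
  | ⟨0, t, [], done⟩ => ⟨0, t, [], done⟩

theorem greedyUpdate_toData (ctx : Data) (S : Fin m → Finset (Fin n)) (b : Bool)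
    {s : GreedyState m} (h : (s.toData ctx S).head ≠ .nil) :
    greedyUpdate (.cons (ofBool b) (s.toData ctx S)) = (s.next b).toData ctx S := by
  obtain ⟨q, t, rest, done⟩ := s
  cases q with
  | succ q => cases b <;> simp [toData, next, greedyUpdate, List.replicate_succ, alive]
  | zero =>
    cases rest with
    | nil => simp [toData] at h
    | cons i rest =>
      cases b <;> simp [toData, next, greedyUpdate, List.replicate_succ, alive, app]

/-- The sets and the bound in the question that is asked. -/
def question : GreedyState m → List (Fin m) × ℕ
  | ⟨_ + 1, t, rest, done⟩ => (rest ++ kept done, t - 1)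
  | ⟨0, t, rest, done⟩ => (rest.tail ++ kept done, t)

theorem greedyQuery_toData (Rl : Data) (p : ℕ) (S : Fin m → Finset (Fin n))
    {s : GreedyState m}
    (h : (s.toData (.cons Rl (.cons (ofNat p) (ofNat n))) S).head ≠ .nil) :
    greedyQuery (s.toData (.cons Rl (.cons (ofNat p) (ofNat n))) S) =
      .cons (context Rl p n (s.question.1.map fun i => ofSet (S i : Set (Fin n))))
        (ofNat s.question.2) := by
  obtain ⟨q, t, rest, done⟩ := s
  cases q with
  | succ q => simp [toData, question, greedyQuery, List.replicate_succ, alive, context]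
  | zero =>
    cases rest with
    | nil => simp [toData] at h
    | cons i rest => simp [toData, question, greedyQuery, List.replicate_succ, alive, context]

/-- The invariant. -/
structure Inv (p : ℕ) (s : GreedyState m) : Prop where
  le : s.t ≤ p + 1
  q_le : s.q ≤ p + 1
  eq : s.rest.reverse ++ s.done.map (fun x => x.1) = List.finRange m
  done : 0 < s.q → s.done = []

variable {p : ℕ} {s : GreedyState m}

theorem Inv.next (h : s.Inv p) (b : Bool) : (s.next b).Inv p := by
  obtain ⟨q, t, rest, done⟩ := s
  obtain ⟨h1, h2, h3, h4⟩ := h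
  cases q with
  | succ q =>
    refine ⟨?_, ?_, h3, fun _ => h4 q.succ_pos⟩
    · simp only [GreedyState.next] at h1 ⊢
      split_ifs <;> omega
    · simp only [GreedyState.next] at h2 ⊢
      omega
  | zero =>
    cases rest with
    | nil => exact ⟨h1, h2, h3, h4⟩
    | cons i rest => exact ⟨h1, h2, by simpa [GreedyState.next] using h3, by simp [GreedyState.next]⟩

theorem Inv.length (h : s.Inv p) : s.rest.length + s.done.length = m := by
  have := congrArg List.length h.eq
  simpa using this

/-- The state is correct. -/
structure Good (p : ℕ) (S : Fin m → Finset (Fin n)) (s : GreedyState m) : Prop where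
  hasCover : s.t ≤ p → HasCover S p s.alive.toFinset s.t
  minimal : s.t ≤ p → ∀ i ∈ kept s.done, ¬ HasCover S p (s.alive.toFinset.erase i) s.t
  least : s.t ≤ s.q ∨ 0 < s.t ∧ ¬ HasCover S p Finset.univ (s.t - 1)

/-- In the first phase `t ≤ q` persists as long as all answers are positive, and the first negative
answer certifies that `t - 1` sets do not suffice. In the second phase a set is dropped if the
others still contain a cover of size `t`. Without the guard `t ≤ p` the initial bound `p + 1` would
presuppose a cover. -/
theorem Good.next {S : Fin m → Finset (Fin n)} (h : s.Good p S) (hs : s.Inv p) {b : Bool}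
    (hb : b = true ↔ HasCover S p s.question.1.toFinset s.question.2) : (s.next b).Good p S := by
  obtain ⟨q, t, rest, done⟩ := s
  obtain ⟨h1, h2, h3⟩ := h
  simp only at h1 h2 h3
  cases q with
  | succ q =>
    obtain rfl : done = [] := hs.done q.succ_pos
    have huniv : (rest ++ kept []).toFinset = Finset.univ := by
      ext i
      have := List.mem_finRange i
      rw [← hs.eq] at this
      simpa [kept] using this
    simp only [question, GreedyState.next, huniv] at hb ⊢
    simp only [alive, huniv] at h1
    by_cases h : HasCover S p Finset.univ (t - 1)
    · obtain rfl := hb.2 h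
      refine ⟨fun _ => ?_, fun _ i hi => by simp [kept] at hi, Or.inl ?_⟩
      · simp only [alive, huniv]
        exact h
      · simp only [if_true]
        rcases h3 with h3 | h3
        · omega
        · exact (h3.2 h).elim
    · obtain rfl : b = false := Bool.eq_false_iff.2 fun h' => h (hb.1 h')
      refine ⟨fun h' => ?_, fun _ i hi => by simp [kept] at hi, Or.inr ⟨?_, h⟩⟩
      · simp only [alive, huniv]
        exact h1 h'
      · rcases Nat.eq_zero_or_pos t with rfl | ht
        · exact (h (h1 (Nat.zero_le _))).elim
        · exact ht
  | zero =>
    cases rest with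
    | nil => exact ⟨h1, h2, h3⟩
    | cons i rest =>
      simp only [question, GreedyState.next, List.tail_cons] at hb ⊢
      by_cases h : HasCover S p (rest ++ kept done).toFinset t
      · obtain rfl := hb.2 h
        refine ⟨fun _ => by simpa [alive] using h, fun h' j hj hj' => ?_, h3⟩
        simp only [alive, Bool.not_true, kept_cons_false] at hj hj'
        -- A set that was indispensable among more sets remains so among fewer.
        refine h2 h' j hj (hj'.mono (Finset.erase_subset_erase _ fun x hx => ?_))
        simp only [List.mem_toFinset, List.mem_append, alive, List.mem_cons] at hx ⊢
        tauto
      · obtain rfl : b = false := Bool.eq_false_iff.2 fun h' => h (hb.1 h')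
        have heq : (rest ++ (kept done ++ [i])).toFinset = (i :: rest ++ kept done).toFinset := by
          ext x
          simp only [List.mem_toFinset, List.mem_append, List.mem_cons, List.not_mem_nil, or_false]
          tauto
        refine ⟨fun h' => ?_, fun h' j hj hj' => ?_, h3⟩
        · simp only [alive, Bool.not_false, kept_cons_true, heq]
          exact h1 h'
        · simp only [alive, Bool.not_false, kept_cons_true, heq, List.mem_append,
            List.mem_singleton] at hj hj'
          rcases hj with hj | rfl
          · exact h2 h' j hj hj'
          · refine h (hj'.mono fun x hx => ?_)
            simp only [Finset.mem_erase, List.mem_toFinset, List.mem_append, List.mem_cons] at hx ⊢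
            tauto

/-- The sets were examined in reverse order and each verdict was prepended, so the verdicts spell
the characteristic vector. A final bound of `p + 1` means that `p` sets do not suffice, hence no
subfamily does. -/
theorem greedyOutput_toData {Rl : Data} {S : Fin m → Finset (Fin n)} (h : s.Good p S)
    (hs : s.Inv p) (hnil : (s.toData (.cons Rl (.cons (ofNat p) (ofNat n))) S).head = .nil) :
    greedyOutput (s.toData (.cons Rl (.cons (ofNat p) (ofNat n))) S) ∈
      partialCoverAnswers S p := by
  classical
  obtain ⟨q, t, rest, done⟩ := s
  have h0 : List.replicate q Data.nil ++ List.replicate rest.length yes = [] :=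
    ofList_injective hnil
  obtain ⟨rfl, rfl⟩ : q = 0 ∧ rest = [] := by simpa using h0
  obtain ⟨h1, h2, h3⟩ := h
  have hle := hs.le
  simp only [nonpos_iff_eq_zero] at h1 h2 h3 hle
  have hout : greedyOutput (toData (.cons Rl (.cons (ofNat p) (ofNat n))) S ⟨0, t, [], done⟩) =
      sel (ofNat (t - p)) .nil (.cons .nil (ofList (done.map fun x => ofBool x.2))) := by
    simp [greedyOutput, toData]
  rw [hout]
  by_cases ht : t ≤ p
  · rw [Nat.sub_eq_zero_of_le ht, ofNat_zero, sel_nil]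
    refine Or.inl ⟨(kept done).toFinset, isMinPartialCover_of_hasCover
      (by simpa [alive] using h1 ht) (fun i hi => by simpa [alive] using h2 ht i (by simpa using hi))
      h3, ?_⟩
    congr 1
    unfold ofSet
    have heq : done.map (fun x => x.1) = List.finRange m := by simpa using hs.eq
    rw [List.ofFn_eq_map, ← heq, List.map_map]
    congr 1
    refine List.map_congr_left fun x hx => ?_
    simp only [Function.comp_apply]
    congr 1
    obtain ⟨i, b⟩ := x
    have hmem : i ∈ kept done ↔ b = true := by
      rw [mem_kept]
      constructor
      · intro h
        have hnd : (done.map fun x => x.1).Nodup := heq ▸ List.nodup_finRange m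
        have := List.inj_on_of_nodup_map hnd hx h rfl
        simpa using this
      · rintro rfl
        exact hx
    simp [hmem]
  · rw [sel_of_ne (by simp; omega)]
    refine Or.inr ⟨not_isPartialCover ?_, rfl⟩
    rcases h3 with rfl | h3
    · omega
    · rw [show t - 1 = p by omega] at h3
      exact h3.2

end GreedyState

theorem size_ofSet_le {n : ℕ} (s : Set (Fin n)) : (ofSet s).size ≤ 2 * n := by
  unfold ofSet
  refine (size_ofList_le (B := 1) fun x hx => ?_).trans (by rw [List.length_ofFn, mul_comm])
  obtain ⟨i, rfl⟩ := List.mem_ofFn.1 hx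
  exact size_ofBool_le _

/-- An instance of the covering problem. -/
noncomputable def instanceOf {n m : ℕ} (S : Fin m → Finset (Fin n)) (p : ℕ) : Data :=
  .cons (ofNat p) (.cons (ofNat n) (ofFamily S))

/-- The list that determines the number of repetitions. -/
noncomputable def repetitions {n m : ℕ} (K : ℕ) (S : Fin m → Finset (Fin n)) (p : ℕ) : Data :=
  copies K (.cons .nil (app (ofNat p) (ofFamily S)))

theorem length_repetitions {n m : ℕ} (K : ℕ) (S : Fin m → Finset (Fin n)) (p : ℕ) :
    (repetitions K S p).toList.length = K * (p + m + 1) := by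
  simp [repetitions, length_copies, ofFamily]

theorem greedyInit_eq {n m : ℕ} (K : ℕ) (S : Fin m → Finset (Fin n)) (p : ℕ) :
    greedyInit K (instanceOf S p) =
      GreedyState.toData (.cons (repetitions K S p) (.cons (ofNat p) (ofNat n))) S
        ⟨p + 1, p + 1, (List.finRange m).reverse, []⟩ := by
  have h : ofFamily S = ofList ((List.finRange m).map fun i => ofSet (S i : Set (Fin n))) := by
    rw [ofFamily, List.ofFn_eq_map]
  have h2 : (Data.cons .nil (ofNat p)).toList = List.replicate (p + 1) .nil := by
    simp [ofNat, List.replicate_succ]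
  unfold greedyInit instanceOf GreedyState.toData
  simp only [Data.head_cons, Data.tail_cons, GreedyState.alive, GreedyState.kept, List.filter_nil,
    List.map_nil, List.reverse_nil, List.append_nil, ofList_nil, List.map_reverse,
    List.length_reverse, List.length_finRange, app, rev, toList_ofList, h2]
  rw [h]
  simp [repetitions, h, app, Function.comp_def]

/-- There are `p + 1` questions about the bound and one about each of the `m` sets, which gives both
the factor in the running time and the one in the error. -/
theorem exists_greedy (K : ℕ) (d : Program) : ∃ D : Program,
    (d.CoinFree → D.CoinFree) ∧ ∃ C : ℕ, ∀ {n m : ℕ} (S : Fin m → Finset (Fin n)) (p τ : ℕ)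
      (e : ℝ≥0∞),
      (∀ (l : List (Fin m)) (t : ℕ) [Decidable (HasCover S p l.toFinset t)], l.length ≤ m →
        t ≤ p + 1 → Answers a d (.cons (context (repetitions K S p) p n
          (l.map fun i => ofSet (S i : Set (Fin n)))) (ofNat t))
          (decide (HasCover S p l.toFinset t)) τ e) →
      ∀ [DecidablePred (· ∈ partialCoverAnswers S p)] (k : Data), Does a D (instanceOf S p) k
        ((p + 1 + m) * (((instanceOf S p).size + 2) ^ C + τ) + ((instanceOf S p).size + 2) ^ C)
        (fun y _ => if y ∈ partialCoverAnswers S p then 0 else 1) ((p + 1 + m : ℕ) * e) := by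
  classical
  obtain ⟨⟨Cg, hCg⟩, ci, fi, ti, ⟨Ci, hCi⟩, di⟩ := Poly.greedyInit (a := a) K
  obtain ⟨-, cf, ff, tf, ⟨Cf, hCf⟩, df⟩ := Poly.greedyOutput (a := a)
  obtain ⟨dl, fl, Cl, hl⟩ := exists_askLoop (Poly.greedyQuery (a := a)) Poly.greedyUpdate d
  obtain ⟨Cs, hCs⟩ := exists_pow_bound (g := fun X =>
    (X + 2) ^ Cg + 2 * X + X * (2 * X + 1) + 2 * X + 10 + X) (by
      have hX := PolyBound.size
      have h2 := (PolyBound.const 2).mul hX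
      exact (((((((hX.add (.const 2)).pow Cg).add h2).add (hX.mul (h2.add (.const 1)))).add h2).add
        (.const 10)).add hX))
  obtain ⟨C, hC⟩ := exists_pow_bound (g := fun X =>
    (X + 2) ^ Ci + ((X + 2) ^ Cs + 2) ^ Cl + ((X + 2) ^ Cs + 2) ^ Cf + 3) (by
      have h2 := PolyBound.size.add (.const 2)
      have hs := (h2.pow Cs).add (.const 2)
      exact (((h2.pow Ci).add (hs.pow Cl)).add (hs.pow Cf)).add (.const 3))
  refine ⟨.seq ci (.seq dl cf), fun h => ⟨fi, fl h, ff⟩, C, fun {n m} S p τ e hans _ k => ?_⟩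
  set X := (instanceOf S p).size with hX
  have hX' : X = p + (n + (ofFamily S).size + 1) + 1 := by simp [hX, instanceOf]
  have hm : m ≤ (ofFamily S).size := by
    have := length_toList_le (ofFamily S)
    simpa [ofFamily] using this
  set Rl := repetitions K S p with hRl
  set ctx := Data.cons Rl (.cons (ofNat p) (ofNat n)) with hctx
  have hinit : (greedyInit K (instanceOf S p)).size ≤ (X + 2) ^ Cg := hCg _
  rw [greedyInit_eq] at hinit
  set s₀ : GreedyState m := ⟨p + 1, p + 1, (List.finRange m).reverse, []⟩
  have hctxs : ctx.size ≤ (X + 2) ^ Cg := by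
    refine le_trans ?_ hinit
    rw [← hRl, ← hctx]
    simp only [GreedyState.toData, Data.size_cons]
    omega
  have hsize : ∀ s : GreedyState m, s.Inv p → (s.toData ctx S).size ≤ (X + 2) ^ Cs := by
    intro s hs
    refine le_trans ?_ (hCs X)
    have h1 := hs.length
    have h2 := hs.le
    have h3 := hs.q_le
    have h4 := GreedyState.length_kept_le s.done
    have h5 : (ofList (s.done.map fun x => ofBool x.2)).size ≤ s.done.length * (1 + 1) := by
      have := size_ofList_le (l := s.done.map fun x => ofBool x.2) (B := 1) fun x hx => by
        obtain ⟨y, -, rfl⟩ := List.mem_map.1 hx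
        exact size_ofBool_le _
      rwa [List.length_map] at this
    have h6 : (ofList (s.alive.map fun i => ofSet (S i : Set (Fin n)))).size ≤ X * (2 * X + 1) := by
      have := size_ofList_le (l := s.alive.map fun i => ofSet (S i : Set (Fin n))) (B := 2 * X)
        fun x hx => by
          obtain ⟨y, -, rfl⟩ := List.mem_map.1 hx
          exact (size_ofSet_le _).trans (by omega)
      rw [List.length_map, GreedyState.alive, List.length_append] at this
      exact this.trans (Nat.mul_le_mul_right _ (by omega))
    have h7 : (ofList (List.replicate s.q Data.nil ++
        List.replicate s.rest.length yes)).size ≤ s.q + 2 * s.rest.length := by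
      simp [size_ofList, yes]
      omega
    simp only [GreedyState.toData, Data.size_cons, size_ofNat]
    omega
  let Q : Data → Bool → Prop := fun x b => ∃ (l : List (Fin m)) (t : ℕ), l.length ≤ m ∧
    t ≤ p + 1 ∧ x = .cons (context Rl p n (l.map fun i => ofSet (S i : Set (Fin n)))) (ofNat t) ∧
    b = decide (HasCover S p l.toFinset t)
  have hstep : ∀ s : GreedyState m, s.Inv p → (s.toData ctx S).head ≠ .nil →
      ∃ b, Q (greedyQuery (s.toData ctx S)) b ∧ ∀ b', ∃ s' : GreedyState m,
        greedyUpdate (.cons (ofBool b') (s.toData ctx S)) = s'.toData ctx S ∧ s'.Inv p ∧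
          s'.q + s'.rest.length < s.q + s.rest.length ∧ (b' = b → s.Good p S → s'.Good p S) := by
    intro s hs hne
    refine ⟨decide (HasCover S p s.question.1.toFinset s.question.2), ⟨_, _, ?_, ?_,
      GreedyState.greedyQuery_toData Rl p S hne, rfl⟩, fun b' => ⟨_,
      GreedyState.greedyUpdate_toData ctx S b' hne, hs.next b', ?_, ?_⟩⟩
    · have h1 := hs.length
      have h4 := GreedyState.length_kept_le s.done
      obtain ⟨q, t, rest, done⟩ := s
      cases q <;> simp [GreedyState.question] at h1 h4 ⊢ <;> omega
    · have h2 := hs.le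
      obtain ⟨q, t, rest, done⟩ := s
      cases q <;> simp [GreedyState.question] at h2 ⊢ <;> omega
    · obtain ⟨q, t, rest, done⟩ := s
      cases q with
      | succ q => simp [GreedyState.next]
      | zero =>
        cases rest with
        | nil => simp [GreedyState.toData] at hne
        | cons i rest => simp [GreedyState.next]
    · rintro rfl hg
      exact hg.next hs (by simp)
  have hs₀ : s₀.Inv p := ⟨le_rfl, le_rfl, by simp [s₀], fun _ => rfl⟩
  -- The bound `p + 1` violates the guard `t ≤ p`, so nothing is claimed about covers at the start.
  have hg₀ : s₀.Good p S := ⟨fun h => by simp [s₀] at h, fun h => by simp [s₀] at h, Or.inl le_rfl⟩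
  have hloop := hl (fun s : GreedyState m => s.toData ctx S) (GreedyState.Inv p)
    (GreedyState.Good p S) Q (fun s => s.q + s.rest.length) ((X + 2) ^ Cs) τ e
    (by rintro _ _ ⟨l, t, k1, k2, rfl, rfl⟩; exact hans l t k1 k2) hsize hstep s₀ k hs₀
  rw [if_pos hg₀, zero_add] at hloop
  have hM : s₀.q + s₀.rest.length = p + 1 + m := by simp [s₀]
  rw [hM] at hloop
  have hi : Det a ci (instanceOf S p) k ((X + 2) ^ Ci) (s₀.toData ctx S) k := by
    have := (di (instanceOf S p) k).mono (hCi _)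
    rwa [greedyInit_eq] at this
  refine (hi.seq_does (hloop.seq (t' := ((X + 2) ^ Cs + 2) ^ Cf) fun y k' hy => ?_)).mono ?_
    (fun _ _ => le_rfl) le_rfl
  · obtain ⟨rfl, s, rfl, j1, j2, j3⟩ := loopVerdict_ne_top hy
    refine (df (s.toData ctx S) k' _).mono ((hCf _).trans
      (Nat.pow_le_pow_left (Nat.add_le_add_right (hsize _ j1) 2) Cf)) (fun _ _ => le_rfl) ?_
    rcases j3 with j3 | j3
    · rw [if_pos (GreedyState.greedyOutput_toData j3 j1 j2)]
      exact zero_le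
    · rw [j3]
      split_ifs
      · exact zero_le
      · exact le_rfl
  · have h4 := hC X
    have h5 : (p + 1 + m) * (((X + 2) ^ Cs + 2) ^ Cl + τ) ≤ (p + 1 + m) * ((X + 2) ^ C + τ) :=
      Nat.mul_le_mul_left _ (by omega)
    omega

end TreeMachine

/-! ### Assembly of the layers: running time and error -/

namespace TreeMachine

variable {a : ℕ}

/-! ## Tree containment as an oracle -/

theorem size_ofGraph_le {n N : ℕ} (G : SimpleGraph (Fin n)) (h : n ≤ N) :
    (ofGraph G).size ≤ N * (2 * N + 1) := by
  unfold ofGraph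
  refine (size_ofList_le (B := 2 * N) fun x hx => ?_).trans ?_
  · obtain ⟨i, rfl⟩ := List.mem_ofFn.1 hx
    exact (size_ofSet_le _).trans (by omega)
  · rw [List.length_ofFn]
    exact Nat.mul_le_mul_right _ h

theorem size_ofFamily_le {n m : ℕ} (S : Fin m → Finset (Fin n)) :
    (ofFamily S).size ≤ m * (2 * n + 1) := by
  unfold ofFamily
  refine (size_ofList_le (B := 2 * n) fun x hx => ?_).trans (by rw [List.length_ofFn])
  obtain ⟨i, rfl⟩ := List.mem_ofFn.1 hx
  exact size_ofSet_le _

/-- On the input `x`, the program `P` halts within `t` steps, and answers `b` with probability at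
least `2/3`. -/
def Decides (P : Program) (x : Data) (b : Bool) (t : ℕ) : Prop :=
  HaltsIn t (init P x) ∧
    (2 / 3 : ℝ≥0∞) ≤ (run t (init P x)).toOuterMeasure {γ | γ.output ∈ ({ofBool b} : Set Data)}

theorem Decides.mono {P : Program} {x : Data} {b : Bool} {t t' : ℕ} (h : Decides P x b t)
    (ht : t ≤ t') : Decides P x b t' := by
  refine ⟨h.1.mono ht, ?_⟩
  obtain ⟨d, rfl⟩ := Nat.exists_eq_add_of_le ht
  rw [h.1.run_add]
  exact h.2

theorem two_thirds_le_one : (2 / 3 : ℝ≥0∞) ≤ 1 :=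
  ENNReal.div_le_of_le_mul (by rw [one_mul]; exact_mod_cast (by norm_num : 2 ≤ 3))

/-- From here on both modes are treated alike, as certainty is a special case of probability at
least `2/3`. -/
theorem Program.AnswersWithin.decides {P : Program} {μ : Mode} {x : Data} {b : Bool} {t : ℕ}
    (h : P.AnswersWithin μ x {ofBool b} t) : Decides P x b t := by
  refine ⟨h.1, ?_⟩
  cases μ with
  | deterministic =>
    refine two_thirds_le_one.trans (le_of_eq ?_)
    exact ((PMF.toOuterMeasure_apply_eq_one_iff _ _).2 h.2.2).symm
  | randomized => exact h.2

theorem Program.AnswersWithin.coinFree {P : Program} {x : Data} {A : Set Data} {t : ℕ}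
    (h : P.AnswersWithin .deterministic x A t) : P.CoinFree := h.2.1

/-- A bound for the number of vertices of the host graphs. -/
def hostBound (c p n m : ℕ) : ℕ := p + 3 + (m + 1) ^ c + n

/-- A bound for the number of vertices of the pattern trees. -/
def patternBound (c p : ℕ) : ℕ := p + 2 * ((p + 1) / c) + 3

theorem mul_add_le {u v τ : ℕ} : u * (τ + v) + v ≤ (u * (1 + v) + v) * (τ + 1) := by
  nlinarith [Nat.zero_le (u * v * τ), Nat.zero_le (v * τ)]

-- Three layers are nested: `p + 1 + m` feasibility questions, for each at most `(m + 1) ^ (c + c *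
-- c) * V` containment questions, and for each of these `K * (p + m + 1)` calls of the oracle. Apart
-- from `V` and `τ`, all costs are polynomial in `n + m + p`.
open Classical in
theorem exists_cover_program {c : ℕ} (hc : 2 ≤ c) (K : ℕ) {P : Program} (ha : P.bound ≤ a)
    (ha0 : 0 < a) : ∃ D : Program, (P.CoinFree → D.CoinFree) ∧ ∃ C : ℕ,
      ∀ {n m : ℕ} (S : Fin m → Finset (Fin n)) (p V τ : ℕ),
      (∀ i ≤ p, ∀ j ≤ p + 1, nodes c i j ≤ V) →
      (∀ {n' k : ℕ} (G : SimpleGraph (Fin n')) (T : SimpleGraph (Fin k)), T.IsTree →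
        n' ≤ hostBound c p n m → k ≤ patternBound c p →
        Decides P (.cons (ofGraph G) (ofGraph T)) (decide (T.IsContained G)) τ) →
      ∀ k, Does a D (instanceOf S p) k ((n + m + p + 2) ^ C * ((V + 1) * (τ + 1)))
        (fun y _ => if y ∈ partialCoverAnswers S p then 0 else 1)
        (((p + 1 + m) * ((m + 1) ^ (c + c * c) * V) : ℕ) *
          (17 ^ (K * (p + m + 1)) / 18 ^ (K * (p + m + 1)))) := by
  have hc0 : 0 < c := by omega
  obtain ⟨d₁, f₁, C₁, h₁⟩ := exists_amplified ha ha0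
  obtain ⟨d₂, f₂, C₂, h₂⟩ := exists_search (a := a) hc d₁
  obtain ⟨d₃, f₃, C₃, h₃⟩ := exists_greedy (a := a) K d₂
  obtain ⟨CR, hCR⟩ := (Poly.copies (a := 0) K
    (Poly.nil.cons (Poly.id.head.app Poly.id.tail.tail))).1
  -- With `s = n + m + p`, the functions `gX`, `gR`, `gZ`, `gY` bound the sizes of the instance, of
  -- the list of repetitions, and of the inputs to the amplified oracle and to the search; `B₂`,
  -- `B₃`, `B₄` are the polynomial factors in the times of the three layers.
  let gX : ℕ → ℕ := fun s => 2 * s + s * (2 * s + 1) + 2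
  let gR : ℕ → ℕ := fun s => (gX s + 2) ^ CR
  let gZ : ℕ → ℕ := fun s => gR s + (2 * s + 3 + (s + 1) ^ c) * (2 * (2 * s + 3 + (s + 1) ^ c) + 1) +
    (3 * s + 5) * (2 * (3 * s + 5) + 1) + 2
  let gY : ℕ → ℕ := fun s => gR s + gX s + 3 * s + 10
  let B₂ : ℕ → ℕ := fun s => K * (s + 1) * (1 + (gZ s + 2) ^ C₁) + (gZ s + 2) ^ C₁
  let B₃ : ℕ → ℕ := fun s => (s + 1) ^ (c + c * c) * ((gY s + 2) ^ C₂ + B₂ s) + (gY s + 2) ^ C₂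
  let B₄ : ℕ → ℕ := fun s => (s + 1) * ((gX s + 2) ^ C₃ + B₃ s) + (gX s + 2) ^ C₃
  obtain ⟨C, hC⟩ := exists_pow_bound (g := B₄) (by
    have hs := PolyBound.size
    have h1 := hs.add (.const 1)
    have h2 := (PolyBound.const 2).mul hs
    have pX : PolyBound fun x => gX x.size := (h2.add (hs.mul (h2.add (.const 1)))).add (.const 2)
    have pR : PolyBound fun x => gR x.size := (pX.add (.const 2)).pow CR
    have pH := (h2.add (.const 3)).add (h1.pow c)
    have pk := ((PolyBound.const 3).mul hs).add (.const 5)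
    have pZ : PolyBound fun x => gZ x.size :=
      ((pR.add (pH.mul (((PolyBound.const 2).mul pH).add (.const 1)))).add
        (pk.mul (((PolyBound.const 2).mul pk).add (.const 1)))).add (.const 2)
    have pY : PolyBound fun x => gY x.size :=
      ((pR.add pX).add ((PolyBound.const 3).mul hs)).add (.const 10)
    have pZ₁ := (pZ.add (.const 2)).pow C₁
    have pB₂ : PolyBound fun x => B₂ x.size :=
      (((PolyBound.const K).mul h1).mul ((PolyBound.const 1).add pZ₁)).add pZ₁
    have pY₂ := (pY.add (.const 2)).pow C₂
    have pB₃ : PolyBound fun x => B₃ x.size := ((h1.pow _).mul (pY₂.add pB₂)).add pY₂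
    have pX₃ := (pX.add (.const 2)).pow C₃
    exact (h1.mul (pX₃.add pB₃)).add pX₃)
  refine ⟨d₃, fun h => f₃ (f₂ (f₁ h)), C, fun {n m} S p V τ hV hP k => ?_⟩
  set s := n + m + p with hs
  set E := c + c * c
  have hfam : (ofFamily S).size ≤ s * (2 * s + 1) :=
    (size_ofFamily_le S).trans (Nat.mul_le_mul (by omega) (by omega))
  have hX : (instanceOf S p).size ≤ gX s := by
    simp only [instanceOf, Data.size_cons, size_ofNat, gX]
    omega
  have hR : (repetitions K S p).size ≤ gR s :=
    (hCR (instanceOf S p)).trans (Nat.pow_le_pow_left (Nat.add_le_add_right hX 2) _)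
  have hlen : (repetitions K S p).toList.length = K * (p + m + 1) := length_repetitions K S p
  have key₁ : ∀ (u rows : List Data) (σ : List ℕ) (t : ℕ), rows.length ≤ m → t ≤ p + 1 →
      σ.sum ≤ p → c * σ.length ≤ t →
      Answers a d₁ (.cons (repetitions K S p) (queryOf c (ofNat p) (ofNat n) (ofList rows)
        (ofList u) (ofList (branchLabels σ)))) (decide (Embeds c p n rows u σ)) (B₂ s * (τ + 1))
        (17 ^ (K * (p + m + 1)) / 18 ^ (K * (p + m + 1))) := by
    intro u rows σ t hrows ht hσ hσt
    have hσl : σ.length ≤ (p + 1) / c := by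
      rw [Nat.le_div_iff_mul_le hc0, mul_comm]
      omega
    have hdiv := Nat.div_le_self (p + 1) c
    have hdiv' : p / c ≤ (p + 1) / c := Nat.div_le_div_right (by omega)
    have hk : (patternOf c p σ).length ≤ patternBound c p := by
      rw [length_patternOf hc0, patternBound]
      generalize p / c = q at *
      omega
    have hn : (hostOf c p n rows u).length ≤ hostBound c p n m := by
      refine (length_hostOf_le hc0 p n rows u).trans ?_
      unfold hostBound
      gcongr
    obtain ⟨g1, g2⟩ := hP (labelGraph (covRel (ofList u)) (hostOf c p n rows u))
      (labelGraph lenEq (patternOf c p σ)) (isTree_pattern _ σ) hn hk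
    rw [← queryOf_eq] at g1 g2
    have hq : (queryOf c (ofNat p) (ofNat n) (ofList rows) (ofList u)
        (ofList (branchLabels σ))).size + gR s + 1 ≤ gZ s := by
      rw [queryOf_eq, Data.size_cons]
      have hH : hostBound c p n m ≤ 2 * s + 3 + (s + 1) ^ c := by
        have : (m + 1) ^ c ≤ (s + 1) ^ c := Nat.pow_le_pow_left (by omega) _
        unfold hostBound
        omega
      have hk' : patternBound c p ≤ 3 * s + 5 := by
        unfold patternBound
        generalize (p + 1) / c = q at *
        omega
      have e1 := size_ofGraph_le (labelGraph (covRel (ofList u)) (hostOf c p n rows u)) (hn.trans hH)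
      have e2 := size_ofGraph_le (labelGraph lenEq (patternOf c p σ)) (hk.trans hk')
      simp only [gZ]
      omega
    refine (h₁ (repetitions K S p) _ _ τ g1 g2).mono ?_ (by rw [hlen])
    rw [hlen]
    have hZ : ((Data.cons (repetitions K S p) (queryOf c (ofNat p) (ofNat n) (ofList rows) (ofList u)
        (ofList (branchLabels σ)))).size + 2) ^ C₁ ≤ (gZ s + 2) ^ C₁ :=
      Nat.pow_le_pow_left (by rw [Data.size_cons]; omega) _
    refine le_trans ?_ mul_add_le
    have : K * (p + m + 1) ≤ K * (s + 1) := Nat.mul_le_mul_left _ (by omega)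
    gcongr
  have key₂ : ∀ (l : List (Fin m)) (t : ℕ), l.length ≤ m → t ≤ p + 1 →
      Answers a d₂ (.cons (context (repetitions K S p) p n
        (l.map fun i => ofSet (S i : Set (Fin n)))) (ofNat t))
        (decide (Feasible p n (l.map fun i => ofSet (S i : Set (Fin n))) t))
        (B₃ s * ((V + 1) * (τ + 1)))
        (((m + 1) ^ E * V : ℕ) * (17 ^ (K * (p + m + 1)) / 18 ^ (K * (p + m + 1)))) := by
    intro l t hl ht
    set rows := l.map fun i => ofSet (S i : Set (Fin n))
    have hrows : rows.length ≤ m := by simpa [rows] using hl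
    refine (h₂ (repetitions K S p) p n t rows V _ _
      (fun u σ => key₁ u rows σ t hrows ht) (fun i hi j hj => hV i hi j (hj.trans ht))).mono ?_ ?_
    · have hsz : (ofList rows).size ≤ s * (2 * s + 1) := by
        refine (size_ofList_le (B := 2 * n) fun x hx => ?_).trans
          (Nat.mul_le_mul (by omega) (by omega))
        obtain ⟨i, -, rfl⟩ := List.mem_map.1 hx
        exact size_ofSet_le _
      have hY : ((Data.cons (context (repetitions K S p) p n rows) (ofNat t)).size + 2) ^ C₂ ≤
          (gY s + 2) ^ C₂ := by
        refine Nat.pow_le_pow_left ?_ _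
        simp only [context, Data.size_cons, size_ofNat, gY, gX]
        omega
      have hE : (rows.length + 1) ^ E ≤ (s + 1) ^ E := Nat.pow_le_pow_left (by omega) _
      generalize ((Data.cons (context (repetitions K S p) p n rows) (ofNat t)).size + 2) ^ C₂ = y at *
      calc (rows.length + 1) ^ E * V * (y + B₂ s * (τ + 1)) + y
          ≤ (s + 1) ^ E * V * ((gY s + 2) ^ C₂ + B₂ s * (τ + 1)) + (gY s + 2) ^ C₂ := by gcongr
        _ ≤ (s + 1) ^ E * (V + 1) * ((gY s + 2) ^ C₂ * (τ + 1) + B₂ s * (τ + 1)) +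
            (gY s + 2) ^ C₂ * ((V + 1) * (τ + 1)) := by
            gcongr
            · omega
            · exact Nat.le_mul_of_pos_right _ (by omega)
            · exact Nat.le_mul_of_pos_right _ (by positivity)
        _ = _ := by simp only [B₃]; ring
    · push_cast
      gcongr
  refine (h₃ S p (B₃ s * ((V + 1) * (τ + 1))) (((m + 1) ^ E * V : ℕ) *
    (17 ^ (K * (p + m + 1)) / 18 ^ (K * (p + m + 1)))) (fun l t inst hl ht => ?_) k).mono ?_ ?_ ?_
  · have := key₂ l t hl ht
    convert this using 2
    exact feasible_map_iff.symm
  · have hX' : ((instanceOf S p).size + 2) ^ C₃ ≤ (gX s + 2) ^ C₃ :=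
      Nat.pow_le_pow_left (by omega) _
    refine le_trans ?_ (Nat.mul_le_mul_right _ (hC s))
    generalize ((instanceOf S p).size + 2) ^ C₃ = y at *
    have hW : 0 < (V + 1) * (τ + 1) := by positivity
    generalize (V + 1) * (τ + 1) = W at *
    calc (p + 1 + m) * (y + B₃ s * W) + y
        ≤ (s + 1) * ((gX s + 2) ^ C₃ * W + B₃ s * W) + (gX s + 2) ^ C₃ * W := by
          have := Nat.le_mul_of_pos_right ((gX s + 2) ^ C₃) hW
          have h1 : p + 1 + m ≤ s + 1 := by omega
          exact Nat.add_le_add (Nat.mul_le_mul h1 (Nat.add_le_add_right (hX'.trans this) _))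
            (hX'.trans this)
      _ = _ := by simp only [B₄]; ring
  · intro y _
    exact le_rfl
  · rw [Nat.cast_mul (p + 1 + m), mul_assoc]

end TreeMachine

/-! ## Constants -/

/-- Of the four factors `x`, two pay for the search tree, whose budgets are both about `p`, one for
the vertices of the pattern beyond `p`, and one for the polynomial in `p`. -/
theorem exists_base {b : ℝ} (hb : b < 2) : ∃ x : ℝ, 1 < x ∧ b * x ^ 4 < 2 := by
  have h : ∀ᶠ x in nhdsWithin (1 : ℝ) (Set.Ioi 1), b * x ^ 4 < 2 := by
    refine Filter.Eventually.filter_mono nhdsWithin_le_nhds ?_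
    refine ContinuousAt.eventually_lt (by fun_prop) continuousAt_const ?_
    simpa using hb
  obtain ⟨x, h1, h2⟩ := (h.and self_mem_nhdsWithin).exists
  exact ⟨x, h2, h1⟩

/-- The condition `2 ≤ c` orders the stack of the search, `4 ≤ x ^ c` pays for the extra vertices of
the pattern, and the last one is the recursion of `nodes_le`. -/
theorem exists_exponent {x : ℝ} (hx : 1 < x) :
    ∃ c : ℕ, 2 ≤ c ∧ 4 ≤ x ^ c ∧ 1 / x + 1 / x ^ c ≤ 1 := by
  have h := (tendsto_pow_atTop_atTop_of_one_lt hx).eventually_ge_atTop (max 4 (x / (x - 1)))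
  obtain ⟨c, h1, h2⟩ := (h.and (Filter.eventually_ge_atTop 2)).exists
  refine ⟨c, h2, (le_max_left _ _).trans h1, ?_⟩
  have h3 : 0 < x - 1 := by linarith
  have h4 := one_div_le_one_div_of_le (div_pos (by linarith) h3) ((le_max_right _ _).trans h1)
  rw [one_div_div] at h4
  have h5 : 1 / x + (x - 1) / x = 1 := by
    have : x ≠ 0 := by linarith
    field_simp
    ring
  linarith

theorem exists_repetitions (E : ℕ) : ∃ K : ℕ, 2 ^ E * 17 ^ K ≤ 18 ^ K := by
  obtain ⟨K, hK⟩ := pow_unbounded_of_one_lt ((2 : ℝ) ^ E) (by norm_num : (1 : ℝ) < 18 / 17)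
  refine ⟨K, ?_⟩
  rw [div_pow, lt_div_iff₀ (by positivity)] at hK
  exact_mod_cast hK.le

/-- Since `p` is not bounded in terms of `n` and `m`, polynomial factors in `p` have to be absorbed
by the exponential one. -/
theorem exists_pow_le_mul_pow {x : ℝ} (hx : 1 < x) (D : ℕ) :
    ∃ B : ℝ, 0 < B ∧ ∀ p : ℕ, ((p : ℝ) + 2) ^ D ≤ B * x ^ p := by
  have h := tendsto_pow_const_mul_const_pow_of_abs_lt_one D (r := 1 / x) (by
    rw [abs_of_pos (by positivity), div_lt_one (by linarith)]
    exact hx)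
  obtain ⟨B, hB⟩ := h.bddAbove_range
  have hx0 : 0 < x := by linarith
  refine ⟨max B 1 * x ^ 2, by positivity, fun p => ?_⟩
  have h1 := hB ⟨p + 2, rfl⟩
  simp only at h1
  rw [one_div, inv_pow, ← div_eq_mul_inv, div_le_iff₀ (by positivity)] at h1
  push_cast at h1
  refine h1.trans ?_
  rw [mul_assoc, ← pow_add, add_comm 2 p]
  gcongr
  exact le_max_left _ _

namespace TreeMachine

/-! ## The main reduction -/

/-- With `b ≤ 0` and `k = 1` the time bound would be zero, but an initial configuration is not
halting. Positivity makes powers of `2 - ε` comparable with those of a larger base. -/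
theorem pos_of_kTreeSolvable {μ : Mode} {b : ℝ} (h : KTreeSolvable μ b) : 0 < b := by
  obtain ⟨P, C, h⟩ := h
  by_contra hb
  have hT : (⊥ : SimpleGraph (Fin 1)).IsTree := .of_subsingleton
  obtain ⟨t, ht, h1, -⟩ := h 1 1 ⊥ ⊥ hT
  have h2 : (t : ℝ) ≤ 0 := by
    refine ht.trans ?_
    rw [pow_one]
    refine mul_nonpos_of_nonpos_of_nonneg (mul_nonpos_of_nonneg_of_nonpos (by positivity) ?_)
      (by positivity)
    linarith
  obtain rfl : t = 0 := by exact_mod_cast le_antisymm h2 (Nat.cast_nonneg t)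
  have h3 := h1 _ (by rw [run, PMF.mem_support_pure_iff])
  simp [Config.Halted, init] at h3

open Classical in
/-- Run a program on the input, and return the accumulator. -/
theorem answersWithin_of_does {a : ℕ} {D : Program} {x : Data} {A : Set Data} {t : ℕ}
    {e : ℝ≥0∞} (h : Does a D x .nil t (fun y _ => if y ∈ A then 0 else 1) e) (he : e ≤ 1 / 3)
    (μ : Mode) (hμ : μ = .deterministic → D.CoinFree) :
    Program.AnswersWithin (.seq (.assign a (.var 0)) (.seq D (.assign 0 (.var a)))) μ x A
      (t + 4) := by
  set R := Program.seq (.assign a (.var 0)) (.seq D (.assign 0 (.var a))) with hR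
  set s : Store := Function.update (fun _ => .nil) 0 x
  have e1 : Tri R s (t + 4) (fun s' => if s' 0 ∈ A then 0 else 1) e := by
    have h1 : Tri (.assign a (.var 0)) s 1
        (fun s' => if s' a = x ∧ s' (a + 1) = .nil then e else ⊤) e := by
      have := Tri.of_pure (f := fun s' : Store => if s' a = x ∧ s' (a + 1) = .nil then e else ⊤)
        (Exec.assign a (.var 0) s)
      simpa [s, Expr.eval] using this
    refine (h1.seq (t' := 1 + t + 1) fun s₁ hs₁ => ?_).mono (by omega) (fun _ => le_rfl) le_rfl
    by_cases h2 : s₁ a = x ∧ s₁ (a + 1) = .nil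
    · rw [if_pos h2]
      refine (h s₁ h2.1 h2.2).seq fun s₂ _ => ?_
      have := Tri.of_pure (f := fun s' : Store => if s' 0 ∈ A then (0 : ℝ≥0∞) else 1)
        (Exec.assign 0 (.var a) s₂)
      simpa [Expr.eval] using this
    · exact absurd (if_neg h2) hs₁
  have h13 : (1 / 3 : ℝ≥0∞) ≠ ⊤ := ENNReal.div_ne_top (by simp) (by simp)
  obtain ⟨ν, h1, h2⟩ := e1 (ne_top_of_le_ne_top h13 he)
  have h3 : run (t + 4) (init R x) = ν.bind fun s' => PMF.pure ⟨[], s'⟩ := by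
    refine h1 [] 0 fun s' _ γ hγ => ?_
    rw [run, PMF.mem_support_pure_iff] at hγ
    rw [hγ]
    rfl
  have hhalt : ∀ γ ∈ (run (t + 4) (init R x)).support, γ.Halted := by
    intro γ hγ
    rw [h3, PMF.mem_support_bind_iff] at hγ
    obtain ⟨s', -, hγ⟩ := hγ
    rw [PMF.mem_support_pure_iff] at hγ
    rw [hγ]
    rfl
  have hprob : (2 / 3 : ℝ≥0∞) ≤ (run (t + 4) (init R x)).toOuterMeasure {γ | γ.output ∈ A} := by
    have h4 : ((run (t + 4) (init R x)).expect fun γ => if γ.output ∈ A then 0 else 1) ≤ 1 / 3 := by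
      rw [h3, PMF.expect_bind]
      simp only [PMF.expect_pure]
      exact h2.trans he
    have h5 : (run (t + 4) (init R x)).toOuterMeasure {γ | γ.output ∈ A} +
        ((run (t + 4) (init R x)).expect fun γ => if γ.output ∈ A then 0 else 1) = 1 := by
      rw [PMF.toOuterMeasure_apply, PMF.expect, ← ENNReal.tsum_add,
        ← (run (t + 4) (init R x)).tsum_coe]
      refine tsum_congr fun γ => ?_
      by_cases hγ : γ.output ∈ A <;> simp [hγ]
    have h6 : (2 / 3 : ℝ≥0∞) + 1 / 3 = 1 := by
      rw [ENNReal.div_add_div_same]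
      norm_num
      exact ENNReal.div_self (by simp) (by simp)
    refine (ENNReal.add_le_add_iff_right h13).1 ?_
    rw [h6]
    exact h5.symm.le.trans (add_le_add_right h4 _)
  refine ⟨hhalt, ?_⟩
  cases μ with
  | randomized => exact hprob
  | deterministic =>
    have hfree : R.CoinFree := ⟨trivial, hμ rfl, trivial⟩
    refine ⟨hfree, ?_⟩
    -- The run of a coin-free program is a point mass, so a success probability of at least `2/3`
    -- means certain success.
    obtain ⟨γ', hγ'⟩ := run_coinFree (t + 4) (γ := init R x) (by simpa [init] using hfree)
    rw [hγ'] at hprob ⊢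
    intro γ hγ
    rw [PMF.mem_support_pure_iff] at hγ
    subst hγ
    by_contra hγ
    rw [PMF.toOuterMeasure_pure_apply,
      if_neg (show γ ∉ {γ : Config | γ.output ∈ A} from hγ)] at hprob
    simp at hprob

/-- The union bound. With `w = p + m + 1`, three times the number of questions is at most `2 ^ (E
w)` for a constant `E`, and `K w` repetitions push the error of each below `2 ^ (-E w)`. -/
theorem error_le {c K p m V : ℕ} (hK : 2 ^ (c + c * c + (c + 6)) * 17 ^ K ≤ 18 ^ K)
    (hV : V ≤ 2 ^ (2 + c + 2 * p)) :
    (((p + 1 + m) * ((m + 1) ^ (c + c * c) * V) : ℕ) : ℝ≥0∞) *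
      (17 ^ (K * (p + m + 1)) / 18 ^ (K * (p + m + 1))) ≤ 1 / 3 := by
  set w := p + m + 1 with hw
  have h0 : p + 1 + m = w := by omega
  have h1 : w ≤ 2 ^ w := Nat.lt_two_pow_self.le
  have h2 : (m + 1) ^ (c + c * c) ≤ (2 ^ w) ^ (c + c * c) :=
    Nat.pow_le_pow_left (by omega) _
  have h3 : 2 + c + 2 * p ≤ (c + 2) * w := by
    rw [hw]
    nlinarith [Nat.zero_le (c * p), Nat.zero_le (c * m)]
  have h4 : V ≤ 2 ^ ((c + 2) * w) := hV.trans (Nat.pow_le_pow_right (by norm_num) h3)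
  have h5 : 3 ≤ 2 ^ (2 * w) := by
    calc 3 ≤ 2 ^ (2 * 1) := by norm_num
      _ ≤ 2 ^ (2 * w) := Nat.pow_le_pow_right (by norm_num) (by omega)
  have h6 : 3 * (w * ((m + 1) ^ (c + c * c) * V)) * 17 ^ (K * w) ≤ 18 ^ (K * w) := by
    calc 3 * (w * ((m + 1) ^ (c + c * c) * V)) * 17 ^ (K * w)
        ≤ 2 ^ (2 * w) * (2 ^ w * ((2 ^ w) ^ (c + c * c) * 2 ^ ((c + 2) * w))) * 17 ^ (K * w) := by
          gcongr
      _ = 2 ^ ((c + c * c + (c + 5)) * w) * 17 ^ (K * w) := by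
          rw [← pow_mul, ← pow_add, ← pow_add, ← pow_add]
          congr 2
          ring
      _ ≤ 2 ^ ((c + c * c + (c + 6)) * w) * 17 ^ (K * w) := by gcongr <;> norm_num
      _ = (2 ^ (c + c * c + (c + 6)) * 17 ^ K) ^ w := by rw [mul_pow, pow_mul, pow_mul]
      _ ≤ (18 ^ K) ^ w := Nat.pow_le_pow_left hK w
      _ = 18 ^ (K * w) := by rw [pow_mul]
  rw [h0, ← mul_div_assoc]
  refine ENNReal.div_le_of_le_mul ?_
  rw [mul_comm (1 / 3 : ℝ≥0∞), ← mul_div_assoc, mul_one, ENNReal.le_div_iff_mul_le (by simp) (by simp)]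
  calc _ = ((3 * (w * ((m + 1) ^ (c + c * c) * V)) * 17 ^ (K * w) : ℕ) : ℝ≥0∞) := by
        push_cast
        ring
    _ ≤ ((18 ^ (K * w) : ℕ) : ℝ≥0∞) := by exact_mod_cast h6
    _ = _ := by push_cast; ring

/-- Pendant vertices and children contribute about `p / c` vertices each, and each pair costs `b ^ 2
≤ 4 ≤ x ^ c`. The factor 8 covers the three remaining vertices. -/
theorem pow_patternBound_le {b x : ℝ} {c : ℕ} (hb1 : 1 ≤ b) (hb2 : b ≤ 2) (hx : 1 < x)
    (hxc : 4 ≤ x ^ c) (p : ℕ) : b ^ patternBound c p ≤ 8 * b ^ p * x ^ (p + 1) := by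
  have h1 : (b ^ 2) ^ ((p + 1) / c) ≤ x ^ (p + 1) := by
    calc (b ^ 2) ^ ((p + 1) / c) ≤ (x ^ c) ^ ((p + 1) / c) := by
          gcongr
          nlinarith
      _ = x ^ (c * ((p + 1) / c)) := by rw [pow_mul]
      _ ≤ x ^ (p + 1) := pow_le_pow_right₀ hx.le (Nat.mul_div_le _ _)
  have h2 : b ^ 3 ≤ 8 := by
    calc b ^ 3 ≤ 2 ^ 3 := by gcongr
      _ = 8 := by norm_num
  calc b ^ patternBound c p = b ^ 3 * b ^ p * (b ^ 2) ^ ((p + 1) / c) := by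
        rw [patternBound, pow_add, pow_add, pow_mul]
        ring
    _ ≤ _ := by gcongr

end TreeMachine

open TreeMachine in
theorem theorem4 (ε : ℝ) (hε : 0 < ε) :
    ∃ δ : ℝ, 0 < δ ∧ ∀ μ : TreeMachine.Mode,
      KTreeSolvable μ (2 - ε) → PartialCoverSolvable μ (2 - δ) := by
  -- A base of at least 1 makes the time bound increase with the number of vertices of the pattern;
  -- the value `3 / 2` also yields `x ≤ 2`.
  set b := max (2 - ε) (3 / 2) with hb
  have hb2 : b < 2 := max_lt (by linarith) (by norm_num)
  have hb32 : 3 / 2 ≤ b := le_max_right _ _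
  have hbε : 2 - ε ≤ b := le_max_left _ _
  obtain ⟨x, hx, hbx⟩ := exists_base hb2
  obtain ⟨c, hc, hxc4, hxc⟩ := exists_exponent hx
  obtain ⟨K, hK⟩ := exists_repetitions (c + c * c + (c + 6))
  have hx2 : x ≤ 2 := by
    by_contra h
    have : (2 : ℝ) ^ 4 ≤ x ^ 4 := by gcongr; linarith
    nlinarith
  refine ⟨2 - b * x ^ 4, by linarith, fun μ hμ => ?_⟩
  rw [sub_sub_cancel]
  have hpos := pos_of_kTreeSolvable hμ
  obtain ⟨P, C₀, hP⟩ := hμ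
  obtain ⟨D, fD, C₁, hD⟩ := exists_cover_program (a := P.bound + 1) hc K (P := P) (by omega)
    (by omega)
  obtain ⟨C₂, hC₂⟩ := exists_pow_bound (g := fun s => 4 * s + 9 + (s + 1) ^ c)
    ((((PolyBound.const 4).mul PolyBound.size).add (.const 9)).add
      ((PolyBound.size.add (.const 1)).pow c))
  set C₃ := C₁ + C₂ * C₀
  obtain ⟨B, hB0, hB⟩ := exists_pow_le_mul_pow hx C₃
  -- The factor 120 is `5 · 3 · 8`: from absorbing the final 4 steps, from `V + 1`, and from
  -- `pow_patternBound_le`.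
  set Q : ℝ := 120 * (C₀ + 1) * x ^ (c + 2) * B
  refine ⟨.seq (.assign (P.bound + 1) (.var 0)) (.seq D (.assign 0 (.var (P.bound + 1)))),
    max ⌈Q⌉₊ C₃, fun n m p S => ?_⟩
  set V := ⌊2 * x ^ c * x ^ (2 * p + 1)⌋₊
  set k₀ := patternBound c p with hk₀
  set H := hostBound c p n m with hH
  set τ := ⌊C₀ * b ^ k₀ * ((H : ℝ) + k₀ + 1) ^ C₀⌋₊
  have hb0 : 0 ≤ b := by linarith
  have hx0 : 0 < x := by linarith
  have hV : (V : ℝ) ≤ 2 * x ^ c * x ^ (2 * p + 1) := Nat.floor_le (by positivity)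
  have hτ : (τ : ℝ) ≤ C₀ * b ^ k₀ * ((H : ℝ) + k₀ + 1) ^ C₀ := Nat.floor_le (by positivity)
  have hnodes : ∀ i ≤ p, ∀ j ≤ p + 1, nodes c i j ≤ V := by
    intro i hi j hj
    refine Nat.le_floor ((nodes_le hx hxc i j).trans ?_)
    have : x ^ (i + j) ≤ x ^ (2 * p + 1) := pow_le_pow_right₀ hx.le (by omega)
    have h2 : 2 * x ^ c * x ^ (i + j) ≤ 2 * x ^ c * x ^ (2 * p + 1) := by gcongr
    linarith
  have hdec : ∀ {n' k : ℕ} (G : SimpleGraph (Fin n')) (T : SimpleGraph (Fin k)), T.IsTree →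
      n' ≤ H → k ≤ k₀ →
      Decides P (.cons (ofGraph G) (ofGraph T)) (@decide (T.IsContained G)
        (Classical.propDecidable _)) τ := by
    intro n' k G T hT hn hk
    obtain ⟨t, ht, hA⟩ := hP n' k G T hT
    refine hA.decides.mono (Nat.le_floor (ht.trans ?_))
    have h1 : (2 - ε) ^ k ≤ b ^ k₀ :=
      (pow_le_pow_left₀ hpos.le hbε k).trans (pow_le_pow_right₀ (by linarith) hk)
    gcongr
  have hdoes := hD S p V τ hnodes hdec .nil
  have hVn : V ≤ 2 ^ (2 + c + 2 * p) := by
    have : (V : ℝ) ≤ ((2 ^ (2 + c + 2 * p) : ℕ) : ℝ) := by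
      refine hV.trans ?_
      push_cast
      calc 2 * x ^ c * x ^ (2 * p + 1) ≤ 2 * 2 ^ c * 2 ^ (2 * p + 1) := by gcongr
        _ = _ := by ring
    exact_mod_cast this
  refine ⟨_, ?_, answersWithin_of_does hdoes (error_le hK hVn) μ ?_⟩
  · have h1 : (n : ℝ) + m + p + 2 ≤ ((n : ℝ) + m + 1) * (p + 2) := by
      have : (0 : ℝ) ≤ (n + m) * p := by positivity
      have : (0 : ℝ) ≤ n + m := by positivity
      have : (0 : ℝ) ≤ p := by positivity
      nlinarith
    have h2 : (H : ℝ) + k₀ + 1 ≤ ((n : ℝ) + m + p + 2) ^ C₂ := by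
      have h3 : H + k₀ + 1 ≤ (n + m + p + 2) ^ C₂ := by
        refine le_trans ?_ (hC₂ (n + m + p))
        have h4 : (m + 1) ^ c ≤ (n + m + p + 1) ^ c := Nat.pow_le_pow_left (by omega) _
        have h5 := Nat.div_le_self (p + 1) c
        rw [hH, hk₀, hostBound, patternBound]
        generalize (p + 1) / c = q at *
        omega
      exact_mod_cast h3
    have h3 : (V : ℝ) + 1 ≤ 3 * x ^ (c + 1) * x ^ (2 * p) := by
      have h4 : 1 ≤ x ^ (c + 1 + 2 * p) := one_le_pow₀ hx.le
      have h5 : x ^ (c + 1 + 2 * p) = x ^ (c + 1) * x ^ (2 * p) := pow_add ..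
      have h6 : 2 * x ^ c * x ^ (2 * p + 1) = 2 * (x ^ (c + 1) * x ^ (2 * p)) := by ring
      linarith
    have h4 : (τ : ℝ) + 1 ≤ (C₀ + 1) * (8 * b ^ p * x ^ (p + 1)) *
        (((n : ℝ) + m + p + 2) ^ C₂) ^ C₀ := by
      have h5 : 1 ≤ b ^ k₀ * ((H : ℝ) + k₀ + 1) ^ C₀ :=
        one_le_mul_of_one_le_of_one_le (one_le_pow₀ (by linarith)) (one_le_pow₀ (by
          have : (0 : ℝ) ≤ H + k₀ := by positivity
          linarith))
      calc (τ : ℝ) + 1 ≤ (C₀ + 1) * b ^ k₀ * ((H : ℝ) + k₀ + 1) ^ C₀ := by linarith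
        _ ≤ _ := by
          gcongr
          exact pow_patternBound_le (by linarith) hb2.le hx hxc4 p
    have h5 : ((n : ℝ) + m + p + 2) ^ C₃ ≤ ((n : ℝ) + m + 1) ^ C₃ * (B * x ^ p) := by
      calc ((n : ℝ) + m + p + 2) ^ C₃ ≤ (((n : ℝ) + m + 1) * (p + 2)) ^ C₃ := by gcongr
        _ = ((n : ℝ) + m + 1) ^ C₃ * ((p : ℝ) + 2) ^ C₃ := by rw [mul_pow]
        _ ≤ _ := by gcongr; exact hB p
    push_cast
    calc ((n : ℝ) + m + p + 2) ^ C₁ * (((V : ℝ) + 1) * ((τ : ℝ) + 1)) + 4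
        ≤ 5 * (((n : ℝ) + m + p + 2) ^ C₁ * (((V : ℝ) + 1) * ((τ : ℝ) + 1))) := by
          have h6 : 1 ≤ ((n : ℝ) + m + p + 2) ^ C₁ * (((V : ℝ) + 1) * ((τ : ℝ) + 1)) := by
            refine one_le_mul_of_one_le_of_one_le (one_le_pow₀ ?_)
              (one_le_mul_of_one_le_of_one_le ?_ ?_)
            · have : (0 : ℝ) ≤ n + m + p := by positivity
              linarith
            · simp
            · simp
          linarith
      _ ≤ 5 * (((n : ℝ) + m + p + 2) ^ C₁ * ((3 * x ^ (c + 1) * x ^ (2 * p)) *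
            ((C₀ + 1) * (8 * b ^ p * x ^ (p + 1)) * (((n : ℝ) + m + p + 2) ^ C₂) ^ C₀))) := by
          gcongr
      _ = 120 * (C₀ + 1) * x ^ (c + 2) * (b ^ p * x ^ (3 * p)) * ((n : ℝ) + m + p + 2) ^ C₃ := by
          ring
      _ ≤ 120 * (C₀ + 1) * x ^ (c + 2) * (b ^ p * x ^ (3 * p)) *
            (((n : ℝ) + m + 1) ^ C₃ * (B * x ^ p)) := by gcongr
      _ = Q * (b * x ^ 4) ^ p * ((n : ℝ) + m + 1) ^ C₃ := by
          rw [mul_pow, ← pow_mul]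
          ring
      _ ≤ _ := by
          gcongr
          · exact (Nat.le_ceil Q).trans (by exact_mod_cast le_max_left _ _)
          · have : (0 : ℝ) ≤ n + m := by positivity
            linarith
          · exact le_max_right _ _
  · rintro rfl
    -- Any single instance shows that the oracle is coin-free.
    obtain ⟨t, -, hA⟩ := hP 1 1 ⊥ ⊥ .of_subsingleton
    exact fD hA.coinFree
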